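/- Let $G$ be a compact Lie group acting smoothly and by isometries on a closed (compact, without boundary, not necessarily connected) smooth Riemannian manifold $M$, and let $E \to M$ be a smooth $G$-equivariant Hermitian vector bundle (a smooth complex vector bundle with a smooth Hermitian metric and a smooth action of $G$ on $E$ that covers the action on $M$ and is unitary between the fibres). For $x \in M$ let $G_x$ be its isotropy group. A tube around $x$ is an open $G$-invariant neighbourhood $W_x$ of the orbit $Gx$ together with a $G$-equivariant diffeomorphism $G \times_{G_x} U_x \cong W_x$ sending $[1,0]$ to $x$, where the slice $U_x$ is an open ball centred at $0$ in an orthogonal representation of $G_x$. Let $L^2(W_x,E)$ be the space of square-integrable sections of $E$ over $W_x$ with respect to the Riemannian volume, on which $G$ acts by $(gs)(y) = g\,(s(g^{-1}y))$. Let $\alpha$ be an irreducible unitary representation of $G$, and let $L^2(W_x,E)_\alpha$ be the $\alpha$-isotypical component, i.e. the closed sum of all $G$-submodules of $L^2(W_x,E)$ that are isomorphic to $\alpha$. Then $$\mathcal N_\alpha := \{x \in M : \text{there is a tube } W_x \text{ around } x \text{ such that } L^2(W_x,E)_\alpha = \{0\}\}$$ is a $G$-invariant subset of $M$ that is both open and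 closed. -/

import Mathlib

open MeasureTheory Manifold Bundle Set Filter
open scoped ContDiff Topology ENNReal

namespace EquivariantL2

section Volume

variable {n : ℕ} {M : Type*} [TopologicalSpace M] [ChartedSpace (EuclideanSpace ℝ (Fin n)) M]
  [RiemannianBundle (fun x : M ↦ TangentSpace (𝓡 n) x)]

/-- The Gram matrix `g_{ij}(u) = ⟨∂_i, ∂_j⟩` of the Riemannian metric at the point with
coordinates `u` in the chart around `x`. -/
noncomputable def gramMatrix (x : M) (u : EuclideanSpace ℝ (Fin n)) :
    Matrix (Fin n) (Fin n) ℝ :=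
  Matrix.of fun i j ↦
    inner ℝ
      (mfderiv (𝓡 n) (𝓡 n) (chartAt (EuclideanSpace ℝ (Fin n)) x).symm u
        (EuclideanSpace.single i (1 : ℝ)))
      (mfderiv (𝓡 n) (𝓡 n) (chartAt (EuclideanSpace ℝ (Fin n)) x).symm u
        (EuclideanSpace.single j (1 : ℝ)))

theorem inner_mfderiv_congr {p q : EuclideanSpace ℝ (Fin n) → M} {u : EuclideanSpace ℝ (Fin n)}
    (h : p =ᶠ[𝓝 u] q) (v w : EuclideanSpace ℝ (Fin n)) :
    inner ℝ (mfderiv (𝓡 n) (𝓡 n) p u v) (mfderiv (𝓡 n) (𝓡 n) p u w) =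
      inner ℝ (mfderiv (𝓡 n) (𝓡 n) q u v) (mfderiv (𝓡 n) (𝓡 n) q u w) := by
  have h1 : ∀ (y y' : M) (_ : y = y') (a b : EuclideanSpace ℝ (Fin n)),
      inner ℝ (show TangentSpace (𝓡 n) y from a) (show TangentSpace (𝓡 n) y from b) =
      inner ℝ (show TangentSpace (𝓡 n) y' from a) (show TangentSpace (𝓡 n) y' from b) := by
    rintro y _ rfl a b
    rfl
  have h2 := h.mfderiv_eq (I := 𝓡 n) (I' := 𝓡 n)
  have h3 : (mfderiv (𝓡 n) (𝓡 n) p u : EuclideanSpace ℝ (Fin n) →L[ℝ] EuclideanSpace ℝ (Fin n)) =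
    (mfderiv (𝓡 n) (𝓡 n) q u : EuclideanSpace ℝ (Fin n) →L[ℝ] EuclideanSpace ℝ (Fin n)) := h2
  have h4 := h1 (p u) (q u) h.self_of_nhds
    ((mfderiv (𝓡 n) (𝓡 n) p u : EuclideanSpace ℝ (Fin n) →L[ℝ] EuclideanSpace ℝ (Fin n)) v)
    ((mfderiv (𝓡 n) (𝓡 n) p u : EuclideanSpace ℝ (Fin n) →L[ℝ] EuclideanSpace ℝ (Fin n)) w)
  refine h4.trans ?_
  rw [h3]
  rfl

theorem gram_comp {T : Type*} [NormedAddCommGroup T] [InnerProductSpace ℝ T]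
    (L : EuclideanSpace ℝ (Fin n) →ₗ[ℝ] T)
    (P : EuclideanSpace ℝ (Fin n) →ₗ[ℝ] EuclideanSpace ℝ (Fin n)) :
    (Matrix.of fun i j ↦ inner ℝ (L (P (EuclideanSpace.single i (1 : ℝ))))
      (L (P (EuclideanSpace.single j (1 : ℝ)))) : Matrix (Fin n) (Fin n) ℝ) =
    (LinearMap.toMatrix (EuclideanSpace.basisFun (Fin n) ℝ).toBasis
      (EuclideanSpace.basisFun (Fin n) ℝ).toBasis P).transpose *
      (Matrix.of fun i j ↦ inner ℝ (L (EuclideanSpace.single i (1 : ℝ)))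
        (L (EuclideanSpace.single j (1 : ℝ)))) *
      LinearMap.toMatrix (EuclideanSpace.basisFun (Fin n) ℝ).toBasis
        (EuclideanSpace.basisFun (Fin n) ℝ).toBasis P := by
  have hP : ∀ v : EuclideanSpace ℝ (Fin n),
      L v = ∑ k, v k • L (EuclideanSpace.single k (1 : ℝ)) := by
    intro v
    conv_lhs => rw [← (EuclideanSpace.basisFun (Fin n) ℝ).sum_repr v]
    simp [map_sum]
  ext i j
  rw [Matrix.mul_apply]
  simp only [Matrix.of_apply, Matrix.mul_apply, Matrix.transpose_apply, LinearMap.toMatrix_apply,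
    OrthonormalBasis.coe_toBasis, OrthonormalBasis.coe_toBasis_repr_apply,
    EuclideanSpace.basisFun_apply, EuclideanSpace.basisFun_repr]
  rw [hP (P (EuclideanSpace.single i 1)), hP (P (EuclideanSpace.single j 1))]
  rw [inner_sum]
  refine Finset.sum_congr rfl fun l _ ↦ ?_
  rw [sum_inner, Finset.sum_mul]
  refine Finset.sum_congr rfl fun k _ ↦ ?_
  rw [real_inner_smul_left, real_inner_smul_right]
  ring

variable [MeasurableSpace M]

/-- The measure on `M`, concentrated on the domain of the chart around `x`, which in this chart
is `√(det g_{ij}) du₁ ⋯ duₙ`. -/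
noncomputable def chartVolume (x : M) : Measure M :=
  Measure.map (chartAt (EuclideanSpace ℝ (Fin n)) x).symm
    ((volume.restrict (chartAt (EuclideanSpace ℝ (Fin n)) x).target).withDensity
      fun u ↦ ENNReal.ofReal √(gramMatrix x u).det)

variable (n M) in
/-- The Riemannian volume measure: the measures `√(det g_{ij}) du₁ ⋯ duₙ` of the charts agree on
the overlaps of their domains, and the volume measure is obtained by gluing them. (The gluing of a
family of measures which agree on overlaps is their supremum.) -/
noncomputable def riemannianVolume : Measure M :=
  ⨆ x : M, chartVolume (n := n) x

variable [BorelSpace M]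

theorem chartVolume_apply (x : M) {A : Set M} (hA : MeasurableSet A)
    (hAx : A ⊆ (chartAt (EuclideanSpace ℝ (Fin n)) x).source) :
    chartVolume (n := n) x A = ∫⁻ u in (chartAt (EuclideanSpace ℝ (Fin n)) x) '' A,
      ENNReal.ofReal √(gramMatrix x u).det := by
  set e := chartAt (EuclideanSpace ℝ (Fin n)) x
  have hm : AEMeasurable e.symm ((volume.restrict e.target).withDensity
      fun u ↦ ENNReal.ofReal √(gramMatrix x u).det) :=
    (e.continuousOn_symm.aemeasurable e.open_target.measurableSet).mono_ac
      (withDensity_absolutelyContinuous _ _)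
  have himg : e '' A = e.target ∩ e.symm ⁻¹' A := e.image_eq_target_inter_inv_preimage hAx
  have hpre : NullMeasurableSet (e.symm ⁻¹' A) (volume.restrict e.target) :=
    (e.continuousOn_symm.aemeasurable e.open_target.measurableSet).nullMeasurableSet_preimage hA
  unfold chartVolume
  rw [Measure.map_apply_of_aemeasurable hm hA, withDensity_apply₀ _ hpre,
    Measure.restrict_restrict₀ hpre, himg, inter_comm]

theorem chartVolume_compl_source (x : M) :
    chartVolume (n := n) x (chartAt (EuclideanSpace ℝ (Fin n)) x).sourceᶜ = 0 := by
  set e := chartAt (EuclideanSpace ℝ (Fin n)) x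
  have hm : AEMeasurable e.symm ((volume.restrict e.target).withDensity
      fun u ↦ ENNReal.ofReal √(gramMatrix x u).det) :=
    (e.continuousOn_symm.aemeasurable e.open_target.measurableSet).mono_ac
      (withDensity_absolutelyContinuous _ _)
  unfold chartVolume
  rw [Measure.map_apply_of_aemeasurable hm e.open_source.measurableSet.compl]
  refine (withDensity_absolutelyContinuous _ _) ?_
  have : ∀ᵐ u ∂(volume.restrict e.target), u ∈ e.target :=
    ae_restrict_mem e.open_target.measurableSet
  refine measure_mono_null ?_ this
  intro u hu hu'
  exact hu (e.map_target hu')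

/-- The change of variables formula: an isometric diffeomorphism preserves the measures
`√(det g_{ij}) du₁ ⋯ duₙ`. -/
theorem chartVolume_image [IsManifold (𝓡 n) ∞ M] {f : M → M} (hf : ContMDiff (𝓡 n) (𝓡 n) ∞ f)
    (hinj : Function.Injective f)
    (hiso : ∀ (x : M) (v w : TangentSpace (𝓡 n) x),
      inner ℝ (mfderiv (𝓡 n) (𝓡 n) f x v) (mfderiv (𝓡 n) (𝓡 n) f x w) = inner ℝ v w)
    (x z : M) {A : Set M} (hA : MeasurableSet A) (hfA : MeasurableSet (f '' A))
    (hAx : A ⊆ (chartAt (EuclideanSpace ℝ (Fin n)) x).source)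
    (hAz : f '' A ⊆ (chartAt (EuclideanSpace ℝ (Fin n)) z).source) :
    chartVolume (n := n) z (f '' A) = chartVolume (n := n) x A := by
  rw [chartVolume_apply z hfA hAz, chartVolume_apply x hA hAx]
  set e := chartAt (EuclideanSpace ℝ (Fin n)) x with he
  set e' := chartAt (EuclideanSpace ℝ (Fin n)) z with he'
  set ψ : EuclideanSpace ℝ (Fin n) → EuclideanSpace ℝ (Fin n) := fun u ↦ e' (f (e.symm u))
    with hψ
  have hdom : ∀ u ∈ e '' A, u ∈ e.target ∧ e.symm u ∈ A := by
    rintro u ⟨a, ha, rfl⟩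
    exact ⟨e.map_source (hAx ha), by rwa [e.left_inv (hAx ha)]⟩
  have hsym : ∀ u ∈ e '' A, MDifferentiableAt (𝓡 n) (𝓡 n) e.symm u := fun u hu ↦
    mdifferentiableAt_atlas_symm (chart_mem_atlas _ x) (hdom u hu).1
  have hfd : ∀ y, MDifferentiableAt (𝓡 n) (𝓡 n) f y := fun y ↦
    (hf y).mdifferentiableAt (by simp)
  have he'd : ∀ u ∈ e '' A, MDifferentiableAt (𝓡 n) (𝓡 n) e' (f (e.symm u)) := fun u hu ↦
    mdifferentiableAt_atlas (chart_mem_atlas _ z) (hAz ⟨_, (hdom u hu).2, rfl⟩)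
  have hψd : ∀ u ∈ e '' A, MDifferentiableAt (𝓡 n) (𝓡 n) ψ u := fun u hu ↦
    (he'd u hu).comp u ((hfd _).comp u (hsym u hu))
  have himg : e' '' (f '' A) = ψ '' (e '' A) := by
    ext w
    constructor
    · rintro ⟨_, ⟨a, ha, rfl⟩, rfl⟩
      exact ⟨e a, ⟨a, ha, rfl⟩, by simp only [hψ]; rw [e.left_inv (hAx ha)]⟩
    · rintro ⟨_, ⟨a, ha, rfl⟩, rfl⟩
      exact ⟨f a, ⟨a, ha, rfl⟩, by simp only [hψ]; rw [e.left_inv (hAx ha)]⟩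
  have hψinj : InjOn ψ (e '' A) := by
    intro u hu w hw h
    have h1 := e'.injOn (hAz ⟨_, (hdom u hu).2, rfl⟩) (hAz ⟨_, (hdom w hw).2, rfl⟩) h
    exact e.symm.injOn (hdom u hu).1 (hdom w hw).1 (hinj h1)
  have hmeas : MeasurableSet (e '' A) := by
    rw [e.image_eq_target_inter_inv_preimage hAx]
    have h1 : Measurable (e.target.domRestrict e.symm) :=
      (continuousOn_iff_continuous_domRestrict.1 e.continuousOn_symm).measurable
    have h2 := e.open_target.measurableSet.subtype_image (h1 hA)
    convert h2 using 1
    ext u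
    simp [Set.domRestrict, and_comm]
  rw [himg, lintegral_image_eq_lintegral_abs_det_fderiv_mul volume hmeas
    (f' := fun u ↦ fderiv ℝ ψ u)
    (fun u hu ↦ ((hψd u hu).differentiableAt.hasFDerivAt).hasFDerivWithinAt) hψinj]
  refine setLIntegral_congr_fun hmeas fun u hu ↦ ?_
  have hgram : gramMatrix x u = (LinearMap.toMatrix (EuclideanSpace.basisFun (Fin n) ℝ).toBasis
      (EuclideanSpace.basisFun (Fin n) ℝ).toBasis (fderiv ℝ ψ u).toLinearMap).transpose *
      gramMatrix z (ψ u) * LinearMap.toMatrix (EuclideanSpace.basisFun (Fin n) ℝ).toBasis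
      (EuclideanSpace.basisFun (Fin n) ℝ).toBasis (fderiv ℝ ψ u).toLinearMap := by
    have hev : (fun w ↦ f (e.symm w)) =ᶠ[𝓝 u] fun w ↦ e'.symm (ψ w) := by
      have hc : ContinuousAt (fun w ↦ f (e.symm w)) u :=
        ((hfd _).comp u (hsym u hu)).continuousAt
      filter_upwards [hc.preimage_mem_nhds
        (e'.open_source.mem_nhds (hAz ⟨_, (hdom u hu).2, rfl⟩))] with w hw
      exact (e'.left_inv hw).symm
    have hψu : MDifferentiableAt (𝓡 n) (𝓡 n) e'.symm (ψ u) :=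
      mdifferentiableAt_atlas_symm (chart_mem_atlas _ z)
        (e'.map_source (hAz ⟨_, (hdom u hu).2, rfl⟩))
    have hc1 : mfderiv (𝓡 n) (𝓡 n) (fun w ↦ f (e.symm w)) u =
        (mfderiv (𝓡 n) (𝓡 n) f (e.symm u)).comp (mfderiv (𝓡 n) (𝓡 n) e.symm u) :=
      mfderiv_comp u (hfd _) (hsym u hu)
    have hc2 : mfderiv (𝓡 n) (𝓡 n) (fun w ↦ e'.symm (ψ w)) u =
        (mfderiv (𝓡 n) (𝓡 n) e'.symm (ψ u)).comp (mfderiv (𝓡 n) (𝓡 n) ψ u) :=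
      mfderiv_comp u hψu (hψd u hu)
    have hg := gram_comp (mfderiv (𝓡 n) (𝓡 n) e'.symm (ψ u)).toLinearMap
      (fderiv ℝ ψ u).toLinearMap
    refine Eq.trans ?_ hg
    ext i j
    have h5 := inner_mfderiv_congr hev (EuclideanSpace.single i (1 : ℝ))
      (EuclideanSpace.single j (1 : ℝ))
    rw [hc1, hc2, mfderiv_eq_fderiv] at h5
    exact (hiso _ _ _).symm.trans h5
  have hdet : (gramMatrix x u).det = (fderiv ℝ ψ u).det ^ 2 * (gramMatrix z (ψ u)).det := by
    rw [hgram, Matrix.det_mul, Matrix.det_mul, Matrix.det_transpose, LinearMap.det_toMatrix]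
    change _ = (LinearMap.det _) ^ 2 * _
    ring
  rw [hdet, Real.sqrt_mul (sq_nonneg _), Real.sqrt_sq_eq_abs,
    ENNReal.ofReal_mul (abs_nonneg _)]

/-- A group acting by isometric diffeomorphisms preserves the Riemannian volume. -/
theorem smulInvariantMeasure_riemannianVolume [IsManifold (𝓡 n) ∞ M] [CompactSpace M]
    {G : Type*} [Group G] [MulAction G M]
    (hf : ∀ g : G, ContMDiff (𝓡 n) (𝓡 n) ∞ (fun x : M ↦ g • x))
    (hiso : ∀ (g : G) (x : M) (v w : TangentSpace (𝓡 n) x),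
      inner ℝ (mfderiv (𝓡 n) (𝓡 n) (fun x : M ↦ g • x) x v)
        (mfderiv (𝓡 n) (𝓡 n) (fun x : M ↦ g • x) x w) = inner ℝ v w) :
    SMulInvariantMeasure G M (riemannianVolume n M) := by
  have hmeas : ∀ g : G, Measurable (fun x : M ↦ g • x) := fun g ↦ (hf g).continuous.measurable
  have himg : ∀ (g : G) (A : Set M), (fun x : M ↦ g • x) '' A = (fun x : M ↦ g⁻¹ • x) ⁻¹' A := by
    intro g A
    ext y
    constructor
    · rintro ⟨a, ha, rfl⟩
      simpa using ha
    · intro hy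
      exact ⟨g⁻¹ • y, hy, by simp⟩
  obtain ⟨t, ht⟩ := CompactSpace.elim_nhds_subcover
    (fun x : M ↦ (chartAt (EuclideanSpace ℝ (Fin n)) x).source) (fun x ↦ chart_source_mem_nhds _ x)
  have hpiece : ∀ (g : G) (x : M) (r : Finset M) (s : Set M), MeasurableSet s →
      s ⊆ (chartAt (EuclideanSpace ℝ (Fin n)) x).source →
      (fun x : M ↦ g • x) '' s ⊆ ⋃ z ∈ r, (chartAt (EuclideanSpace ℝ (Fin n)) z).source →
      chartVolume (n := n) x s ≤ riemannianVolume n M ((fun x : M ↦ g • x) '' s) := by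
    classical
    intro g x r
    induction r using Finset.induction_on with
    | empty =>
      intro s _ _ h
      have : s = ∅ := by simpa using h
      simp [this]
    | insert a r _ ih =>
      intro s hs hsx hsr
      set B : Set M := (fun x : M ↦ g • x) ⁻¹' (chartAt (EuclideanSpace ℝ (Fin n)) a).source
      have hB : MeasurableSet B :=
        hmeas g (chartAt (EuclideanSpace ℝ (Fin n)) a).open_source.measurableSet
      have hgB : MeasurableSet ((fun x : M ↦ g • x) '' (s ∩ B)) := by
        rw [himg]; exact hmeas g⁻¹ (hs.inter hB)
      have h1 : chartVolume (n := n) x (s ∩ B) ≤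
          riemannianVolume n M ((fun x : M ↦ g • x) '' (s ∩ B)) := by
        rw [← chartVolume_image (hf g) (MulAction.injective g) (hiso g) x a (hs.inter hB) hgB
          (inter_subset_left.trans hsx) (by rintro _ ⟨y, hy, rfl⟩; exact hy.2)]
        exact (le_iSup (fun x : M ↦ chartVolume (n := n) x) a) _
      have h2 : chartVolume (n := n) x (s \ B) ≤
          riemannianVolume n M ((fun x : M ↦ g • x) '' (s \ B)) := by
        refine ih _ (hs.diff hB) (sdiff_subset.trans hsx) ?_
        rintro _ ⟨y, hy, rfl⟩
        have h3 := hsr ⟨y, hy.1, rfl⟩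
        rw [Finset.set_biUnion_insert] at h3
        exact h3.resolve_left hy.2
      calc chartVolume (n := n) x s
          = chartVolume (n := n) x (s ∩ B) + chartVolume (n := n) x (s \ B) :=
            (measure_inter_add_sdiff s hB).symm
        _ ≤ riemannianVolume n M ((fun x : M ↦ g • x) '' (s ∩ B)) +
            riemannianVolume n M ((fun x : M ↦ g • x) '' (s \ B)) := add_le_add h1 h2
        _ = riemannianVolume n M ((fun x : M ↦ g • x) '' (s ∩ B) ∪
            (fun x : M ↦ g • x) '' (s \ B)) := by
            refine (measure_union' ?_ hgB).symm
            exact (disjoint_image_iff (MulAction.injective g)).2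
              (disjoint_sdiff_right.mono_left inter_subset_right)
        _ = riemannianVolume n M ((fun x : M ↦ g • x) '' s) := by
            rw [← image_union, inter_union_sdiff]
  have key : ∀ (g : G) (A : Set M), MeasurableSet A →
      riemannianVolume n M A ≤ riemannianVolume n M ((fun x : M ↦ g • x) ⁻¹' A) := by
    intro g A hA
    have hle : riemannianVolume n M ≤
        Measure.map (fun x : M ↦ g⁻¹⁻¹ • x) (riemannianVolume n M) := by
      refine iSup_le fun x ↦ ?_
      rw [Measure.le_iff]
      intro A hA
      rw [Measure.map_apply (hmeas g⁻¹⁻¹) hA, ← himg g⁻¹ A]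
      set S := (chartAt (EuclideanSpace ℝ (Fin n)) x).source
      have hS : MeasurableSet S := (chartAt (EuclideanSpace ℝ (Fin n)) x).open_source.measurableSet
      calc chartVolume (n := n) x A
          = chartVolume (n := n) x (A ∩ S) + chartVolume (n := n) x (A \ S) :=
            (measure_inter_add_sdiff A hS).symm
        _ = chartVolume (n := n) x (A ∩ S) := by
            have h0 : chartVolume (n := n) x (A \ S) = 0 :=
              measure_mono_null (fun y hy ↦ hy.2) (chartVolume_compl_source x)
            rw [h0, add_zero]
        _ ≤ riemannianVolume n M ((fun x : M ↦ g⁻¹ • x) '' (A ∩ S)) :=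
            hpiece g⁻¹ x t _ (hA.inter hS) inter_subset_right (ht ▸ subset_univ _)
        _ ≤ _ := measure_mono (image_mono inter_subset_left)
    have h := hle A
    rw [inv_inv, Measure.map_apply (hmeas g) hA] at h
    exact h
  refine ⟨fun g A hA ↦ le_antisymm ?_ (key g A hA)⟩
  have := key g⁻¹ _ (hmeas g hA)
  simpa [preimage_preimage] using this

end Volume
section Sections

variable {M : Type*} [TopologicalSpace M] [MeasurableSpace M]
  {F : Type*} [NormedAddCommGroup F] [NormedSpace ℂ F]
  {E : M → Type*} [TopologicalSpace (TotalSpace F E)] [∀ x, NormedAddCommGroup (E x)]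

variable (F) in
/-- A section `s` of `E` is measurable if it is (almost everywhere equal to) a Borel map from `M`
to the total space of `E`. -/
def IsMeasurableSection (ν : Measure M) (s : ∀ x, E x) : Prop :=
  @AEMeasurable M (TotalSpace F E) (borel _) _ (fun x ↦ TotalSpace.mk' F x (s x)) ν

/-- Measurability of a section can be read in local trivializations. -/
theorem isMeasurableSection_iff [BorelSpace M] [CompactSpace M] [FiberBundle F E]
    [FiniteDimensional ℂ F] (ν : Measure M) (s : ∀ x, E x) :
    IsMeasurableSection F ν s ↔ ∀ x₀ : M,
      @AEMeasurable M F (borel F) _ (fun y ↦ (trivializationAt F E x₀ ⟨y, s y⟩).2)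
        (ν.restrict (trivializationAt F E x₀).baseSet) := by
  let : MeasurableSpace F := borel F
  have : BorelSpace F := ⟨rfl⟩
  let : MeasurableSpace (TotalSpace F E) := borel _
  have : BorelSpace (TotalSpace F E) := ⟨rfl⟩
  have : ProperSpace F := FiniteDimensional.proper ℂ F
  classical
  constructor
  · intro h x₀
    have h : AEMeasurable (fun x ↦ TotalSpace.mk' F x (s x)) ν := h
    set e := trivializationAt F E x₀
    have h1 : Measurable (e.source.piecewise (fun p ↦ (e p).2) (fun _ ↦ (0 : F))) :=
      ContinuousOn.measurable_piecewise (continuous_snd.comp_continuousOn e.continuousOn)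
        continuousOn_const e.open_source.measurableSet
    refine (h1.comp_aemeasurable (h.mono_measure Measure.restrict_le_self)).congr ?_
    filter_upwards [ae_restrict_mem e.open_baseSet.measurableSet] with y hy
    have : TotalSpace.mk' F y (s y) ∈ e.source := e.mem_source.2 hy
    simp [Function.comp, Set.piecewise, this]
  · intro h
    rcases isEmpty_or_nonempty M with hM | ⟨⟨m⟩⟩
    · exact (measurable_of_empty _).aemeasurable
    obtain ⟨t, ht⟩ := CompactSpace.elim_nhds_subcover
      (fun x : M ↦ (trivializationAt F E x).baseSet)
      (fun x ↦ (trivializationAt F E x).open_baseSet.mem_nhds (mem_baseSet_trivializationAt F E x))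
    have hν : ν = ν.restrict (⋃ i : t, (trivializationAt F E (i : M)).baseSet) := by
      have : (⋃ i : t, (trivializationAt F E (i : M)).baseSet) = univ := by
        rw [← top_eq_univ, ← ht, iUnion_subtype]
      rw [this, Measure.restrict_univ]
    change AEMeasurable (fun x ↦ TotalSpace.mk' F x (s x)) ν
    rw [hν, aemeasurable_iUnion_iff]
    rintro ⟨x₀, -⟩
    have h2 := h x₀
    set e := trivializationAt F E x₀
    have h1 : Measurable (e.target.piecewise e.toOpenPartialHomeomorph.symm
        (fun _ ↦ TotalSpace.mk' F m (s m))) :=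
      ContinuousOn.measurable_piecewise e.toOpenPartialHomeomorph.continuousOn_symm
        continuousOn_const e.open_target.measurableSet
    refine (h1.comp_aemeasurable (aemeasurable_id.prodMk h2)).congr ?_
    filter_upwards [ae_restrict_mem e.open_baseSet.measurableSet] with y hy
    have h3 : TotalSpace.mk' F y (s y) ∈ e.source := e.mem_source.2 hy
    have h4 : (y, (e ⟨y, s y⟩).2) = e ⟨y, s y⟩ := by
      ext
      · exact (e.coe_fst h3).symm
      · rfl
    have h5 : e ⟨y, s y⟩ ∈ e.target := e.map_source h3
    simp only [Function.comp, id, h4, Set.piecewise, h5, if_true]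
    exact e.toOpenPartialHomeomorph.left_inv h3

end Sections

section L2

variable {n : ℕ} {M : Type*} [TopologicalSpace M] [ChartedSpace (EuclideanSpace ℝ (Fin n)) M]
  {F : Type*} [NormedAddCommGroup F] [NormedSpace ℂ F]
  {E : M → Type*} [TopologicalSpace (TotalSpace F E)] [∀ x, NormedAddCommGroup (E x)]
  [∀ x, InnerProductSpace ℂ (E x)] [FiberBundle F E]

variable (n F E) in
/-- The Hermitian inner products on the fibres of `E` form a smooth Hermitian metric: the function
`v ↦ ‖v‖²` is smooth on the total space of `E` (by polarization, this says that the coefficients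
of the metric in local trivializations are smooth). -/
class IsSmoothHermitianBundle : Prop where
  contMDiff_norm_sq : ContMDiff ((𝓡 n).prod 𝓘(ℝ, F)) 𝓘(ℝ, ℝ) ∞
    (fun p : TotalSpace F E ↦ ‖p.2‖ ^ 2)

variable (n F E) in
set_option linter.unusedSectionVars false in
theorem continuous_norm_totalSpace [IsSmoothHermitianBundle n F E] :
    Continuous fun p : TotalSpace F E ↦ ‖p.2‖ := by
  have h := (IsSmoothHermitianBundle.contMDiff_norm_sq (n := n) (F := F) (E := E)).continuous.sqrt
  simpa [Real.sqrt_sq] using h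

variable [MeasurableSpace M]

variable (n) in
theorem IsMeasurableSection.aestronglyMeasurable_norm [IsSmoothHermitianBundle n F E]
    {ν : Measure M} {s : ∀ x, E x} (hs : IsMeasurableSection F ν s) :
    AEStronglyMeasurable (fun x ↦ ‖s x‖) ν := by
  let _ : MeasurableSpace (TotalSpace F E) := borel _
  have _ : BorelSpace (TotalSpace F E) := ⟨rfl⟩
  have h : AEMeasurable (fun x ↦ TotalSpace.mk' F x (s x)) ν := hs
  exact ((continuous_norm_totalSpace n F E).measurable.comp_aemeasurable h).aestronglyMeasurable

variable [BorelSpace M] [CompactSpace M] [FiniteDimensional ℂ F] [VectorBundle ℂ F E]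

theorem IsMeasurableSection.add {ν : Measure M} {s t : ∀ x, E x}
    (hs : IsMeasurableSection F ν s) (ht : IsMeasurableSection F ν t) :
    IsMeasurableSection F ν (s + t) := by
  let _ : MeasurableSpace F := borel F
  have _ : BorelSpace F := ⟨rfl⟩
  have _ : ProperSpace F := FiniteDimensional.proper ℂ F
  rw [isMeasurableSection_iff] at hs ht ⊢
  intro x₀
  refine (AEMeasurable.add (hs x₀) (ht x₀)).congr ?_
  filter_upwards [ae_restrict_mem (trivializationAt F E x₀).open_baseSet.measurableSet] with y hy
  exact (((trivializationAt F E x₀).linear ℂ hy).map_add (s y) (t y)).symm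

theorem IsMeasurableSection.const_smul {ν : Measure M} {s : ∀ x, E x}
    (hs : IsMeasurableSection F ν s) (c : ℂ) : IsMeasurableSection F ν (c • s) := by
  let _ : MeasurableSpace F := borel F
  have _ : BorelSpace F := ⟨rfl⟩
  have _ : ProperSpace F := FiniteDimensional.proper ℂ F
  rw [isMeasurableSection_iff] at hs ⊢
  intro x₀
  refine (AEMeasurable.const_smul (hs x₀) c).congr ?_
  filter_upwards [ae_restrict_mem (trivializationAt F E x₀).open_baseSet.measurableSet] with y hy
  exact (((trivializationAt F E x₀).linear ℂ hy).map_smul c (s y)).symm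

theorem isMeasurableSection_zero {ν : Measure M} :
    IsMeasurableSection F ν (0 : ∀ x, E x) := by
  let _ : MeasurableSpace F := borel F
  rw [isMeasurableSection_iff]
  intro x₀
  refine (aemeasurable_const (b := (0 : F))).congr ?_
  filter_upwards [ae_restrict_mem (trivializationAt F E x₀).open_baseSet.measurableSet] with y hy
  exact (((trivializationAt F E x₀).linear ℂ hy).map_zero).symm

variable (n F E) in
/-- The vector space of measurable sections `s` of `E` which are square-integrable with respect to
the measure `ν`, that is, `∫ ‖s x‖² dν(x) < ∞`. -/
def squareIntegrableSections [IsSmoothHermitianBundle n F E] (ν : Measure M) :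
    Submodule ℂ (∀ x, E x) where
  carrier := {s | IsMeasurableSection F ν s ∧ eLpNorm (fun x ↦ ‖s x‖) 2 ν < ⊤}
  zero_mem' := ⟨isMeasurableSection_zero, by simp⟩
  add_mem' := by
    rintro s t ⟨hs, hs'⟩ ⟨ht, ht'⟩
    refine ⟨hs.add ht, ?_⟩
    refine lt_of_le_of_lt (eLpNorm_mono_real (g := (fun x ↦ ‖s x‖) + fun x ↦ ‖t x‖) ?_)
      (lt_of_le_of_lt (eLpNorm_add_le (hs.aestronglyMeasurable_norm n)
        (ht.aestronglyMeasurable_norm n) (by norm_num)) (ENNReal.add_lt_top.2 ⟨hs', ht'⟩))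
    intro x
    simpa using norm_add_le (s x) (t x)
  smul_mem' := by
    rintro c s ⟨hs, hs'⟩
    refine ⟨hs.const_smul c, ?_⟩
    have : (fun x ↦ ‖(c • s) x‖) = ‖c‖ • fun x ↦ ‖s x‖ := by
      funext x
      exact norm_smul c (s x)
    rw [this, eLpNorm_const_smul]
    exact ENNReal.mul_lt_top (by simp) hs'

variable [IsSmoothHermitianBundle n F E]

variable (n F E) in
/-- The square-integrable sections, with the seminorm `‖s‖ = (∫ ‖s x‖² dν(x))^{1/2}`. -/
def PreL2 (ν : Measure M) : Type _ := squareIntegrableSections n F E ν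

noncomputable instance (ν : Measure M) : AddCommGroup (PreL2 n F E ν) :=
  inferInstanceAs (AddCommGroup (squareIntegrableSections n F E ν))

noncomputable instance (ν : Measure M) : Module ℂ (PreL2 n F E ν) :=
  inferInstanceAs (Module ℂ (squareIntegrableSections n F E ν))

noncomputable instance (ν : Measure M) : Norm (PreL2 n F E ν) :=
  ⟨fun s ↦ (eLpNorm (fun x ↦ ‖s.1 x‖) 2 ν).toReal⟩

theorem PreL2.core (ν : Measure M) : SeminormedSpace.Core ℂ (PreL2 n F E ν) where
  norm_nonneg _ := ENNReal.toReal_nonneg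
  norm_smul c s := by
    have : (fun x ↦ ‖(c • s).1 x‖) = ‖c‖ • fun x ↦ ‖s.1 x‖ := by
      funext x
      exact norm_smul c (s.1 x)
    change (eLpNorm (fun x ↦ ‖(c • s).1 x‖) 2 ν).toReal = _
    rw [this, eLpNorm_const_smul, ENNReal.toReal_mul]
    simp [Norm.norm]
  norm_triangle s t := by
    change (eLpNorm (fun x ↦ ‖s.1 x + t.1 x‖) 2 ν).toReal ≤
      (eLpNorm (fun x ↦ ‖s.1 x‖) 2 ν).toReal + (eLpNorm (fun x ↦ ‖t.1 x‖) 2 ν).toReal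
    rw [← ENNReal.toReal_add s.2.2.ne t.2.2.ne]
    refine ENNReal.toReal_mono (ENNReal.add_lt_top.2 ⟨s.2.2, t.2.2⟩).ne ?_
    refine (eLpNorm_mono_real (g := (fun x ↦ ‖s.1 x‖) + fun x ↦ ‖t.1 x‖) ?_).trans
      (eLpNorm_add_le (s.2.1.aestronglyMeasurable_norm n)
        (t.2.1.aestronglyMeasurable_norm n) (by norm_num))
    intro x
    simpa using norm_add_le (s.1 x) (t.1 x)

noncomputable instance (ν : Measure M) : SeminormedAddCommGroup (PreL2 n F E ν) :=
  SeminormedAddCommGroup.ofCore (PreL2.core ν)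

noncomputable instance (ν : Measure M) : NormedSpace ℂ (PreL2 n F E ν) where
  norm_smul_le c s := ((PreL2.core ν).norm_smul c s).le

variable (n F E) in
/-- The space `L²(E, ν)` of square-integrable sections of `E`, two sections being identified when
the seminorm of their difference vanishes, that is, when they are equal `ν`-almost everywhere. -/
abbrev L2 (ν : Measure M) : Type _ := SeparationQuotient (PreL2 n F E ν)

end L2

section Action

variable {m n : ℕ} {G : Type*} [Group G] [TopologicalSpace G]
  [ChartedSpace (EuclideanSpace ℝ (Fin m)) G]
  {M : Type*} [TopologicalSpace M] [ChartedSpace (EuclideanSpace ℝ (Fin n)) M] [MulAction G M]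
  {F : Type*} [NormedAddCommGroup F] [NormedSpace ℂ F]
  {E : M → Type*} [TopologicalSpace (TotalSpace F E)] [∀ x, NormedAddCommGroup (E x)]
  [∀ x, InnerProductSpace ℂ (E x)] [FiberBundle F E]

variable (n G M) in
/-- `G` acts on `M` by isometries of the Riemannian metric. -/
class IsIsometricAction [RiemannianBundle (fun x : M ↦ TangentSpace (𝓡 n) x)] : Prop where
  inner_mfderiv_smul : ∀ (g : G) (x : M) (v w : TangentSpace (𝓡 n) x),
    inner ℝ (mfderiv (𝓡 n) (𝓡 n) (fun y : M ↦ g • y) x v)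
      (mfderiv (𝓡 n) (𝓡 n) (fun y : M ↦ g • y) x w) = inner ℝ v w

variable (m n G F E) in
/-- The structure of a `G`-equivariant Hermitian vector bundle on `E`: a smooth action of `G` on the
total space of `E`, covering the action of `G` on `M`, by unitary maps between the fibres. -/
structure EquivariantStructure where
  /-- The unitary map `E_x → E_{gx}` given by the action of `g`. -/
  act : ∀ (g : G) (x : M), E x ≃ₗᵢ[ℂ] E (g • x)
  one_act : ∀ (x : M) (v : E x), TotalSpace.mk' F ((1 : G) • x) (act 1 x v) = TotalSpace.mk' F x v
  mul_act : ∀ (g h : G) (x : M) (v : E x), TotalSpace.mk' F ((g * h) • x) (act (g * h) x v) =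
    TotalSpace.mk' F (g • h • x) (act g (h • x) (act h x v))
  contMDiff_act : ContMDiff ((𝓡 m).prod ((𝓡 n).prod 𝓘(ℝ, F))) ((𝓡 n).prod 𝓘(ℝ, F)) ∞
    (fun p : G × TotalSpace F E ↦ TotalSpace.mk' F (p.1 • p.2.1) (act p.1 p.2.1 p.2.2))

namespace EquivariantStructure

/-- The action of `G` on sections of `E`: `(g s)(x) = g (s (g⁻¹ x))`, that is, `(g s)(x)` is the
element of `E_x` which `g⁻¹` maps to `s (g⁻¹ x)`. -/
def translate (a : EquivariantStructure m n G F E) (g : G) (s : ∀ x, E x) : ∀ x, E x :=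
  fun x ↦ (a.act g⁻¹ x).symm (s (g⁻¹ • x))

theorem act_translate (a : EquivariantStructure m n G F E) (g : G) (s : ∀ x, E x) (x : M) :
    a.act g⁻¹ x (a.translate g s x) = s (g⁻¹ • x) :=
  (a.act g⁻¹ x).apply_symm_apply _

set_option linter.unusedSectionVars false in
theorem mk_section_congr (s : ∀ x, E x) {x y : M} (h : x = y) :
    TotalSpace.mk' F x (s x) = TotalSpace.mk' F y (s y) := by
  subst h
  rfl

theorem mk_act_congr (a : EquivariantStructure m n G F E) {g h : G} (e : g = h) (x : M) (v : E x) :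
    TotalSpace.mk' F (g • x) (a.act g x v) = TotalSpace.mk' F (h • x) (a.act h x v) := by
  subst e
  rfl

theorem translate_eq_of_mk (a : EquivariantStructure m n G F E) (g : G) (s : ∀ x, E x) (x : M)
    (v : E x) (h : TotalSpace.mk' F (g⁻¹ • x) (a.act g⁻¹ x v) =
      TotalSpace.mk' F (g⁻¹ • x) (s (g⁻¹ • x))) : a.translate g s x = v := by
  have h' : a.act g⁻¹ x v = s (g⁻¹ • x) := TotalSpace.mk_injective (F := F) _ h
  rw [translate, ← h', LinearIsometryEquiv.symm_apply_apply]

theorem translate_one (a : EquivariantStructure m n G F E) (s : ∀ x, E x) :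
    a.translate 1 s = s := by
  funext x
  refine a.translate_eq_of_mk 1 s x (s x) ?_
  rw [a.mk_act_congr (inv_one : (1 : G)⁻¹ = 1), a.one_act]
  exact mk_section_congr s (by simp)

theorem translate_mul (a : EquivariantStructure m n G F E) (g h : G) (s : ∀ x, E x) :
    a.translate (g * h) s = a.translate g (a.translate h s) := by
  funext x
  refine a.translate_eq_of_mk (g * h) s x _ ?_
  rw [a.mk_act_congr (mul_inv_rev g h), a.mul_act, act_translate, act_translate]
  exact mk_section_congr s (by simp [mul_smul])

theorem translate_add (a : EquivariantStructure m n G F E) (g : G) (s t : ∀ x, E x) :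
    a.translate g (s + t) = a.translate g s + a.translate g t := by
  funext x
  simp [translate]

theorem translate_smul (a : EquivariantStructure m n G F E) (g : G) (c : ℂ) (s : ∀ x, E x) :
    a.translate g (c • s) = c • a.translate g s := by
  funext x
  simp [translate]

theorem norm_translate (a : EquivariantStructure m n G F E) (g : G) (s : ∀ x, E x) (x : M) :
    ‖a.translate g s x‖ = ‖s (g⁻¹ • x)‖ := by
  simp [translate]

theorem continuous_act (a : EquivariantStructure m n G F E) (g : G) :
    Continuous fun p : TotalSpace F E ↦ TotalSpace.mk' F (g • p.1) (a.act g p.1 p.2) :=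
  a.contMDiff_act.continuous.comp (Continuous.prodMk_right g)

theorem mk_translate (a : EquivariantStructure m n G F E) (g : G) (s : ∀ x, E x) (x : M) :
    TotalSpace.mk' F x (a.translate g s x) =
      TotalSpace.mk' F (g • g⁻¹ • x) (a.act g (g⁻¹ • x) (s (g⁻¹ • x))) := by
  rw [← a.act_translate g s x, ← a.mul_act, a.mk_act_congr (mul_inv_cancel g), a.one_act]

section Measure

variable [MeasurableSpace M]

theorem isMeasurableSection_translate [BorelSpace M] (a : EquivariantStructure m n G F E) (g : G)
    {ν : Measure M} (hg : MeasurePreserving (fun x : M ↦ g⁻¹ • x) ν ν) {s : ∀ x, E x}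
    (hs : IsMeasurableSection F ν s) : IsMeasurableSection F ν (a.translate g s) := by
  let _ : MeasurableSpace (TotalSpace F E) := borel _
  have _ : BorelSpace (TotalSpace F E) := ⟨rfl⟩
  have h : AEMeasurable (fun x ↦ TotalSpace.mk' F x (s x)) ν := hs
  have h2 := (a.continuous_act g).measurable.comp_aemeasurable
    (h.comp_quasiMeasurePreserving hg.quasiMeasurePreserving)
  refine h2.congr (Eventually.of_forall fun x ↦ ?_)
  exact (a.mk_translate g s x).symm

theorem eLpNorm_translate [IsSmoothHermitianBundle n F E] (a : EquivariantStructure m n G F E)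
    (g : G) {ν : Measure M} (hg : MeasurePreserving (fun x : M ↦ g⁻¹ • x) ν ν) {s : ∀ x, E x}
    (hs : IsMeasurableSection F ν s) :
    eLpNorm (fun x ↦ ‖a.translate g s x‖) 2 ν = eLpNorm (fun x ↦ ‖s x‖) 2 ν := by
  simp only [norm_translate]
  exact eLpNorm_comp_measurePreserving (g := fun x ↦ ‖s x‖) (f := fun x : M ↦ g⁻¹ • x)
    (hs.aestronglyMeasurable_norm n) hg

variable [BorelSpace M] [CompactSpace M] [FiniteDimensional ℂ F] [VectorBundle ℂ F E]
  [IsSmoothHermitianBundle n F E]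

/-- The action of `g` on square-integrable sections. -/
noncomputable def preL2Map (a : EquivariantStructure m n G F E) {ν : Measure M}
    (hν : ∀ g : G, MeasurePreserving (fun x : M ↦ g • x) ν ν) (g : G) :
    PreL2 n F E ν →ₗᵢ[ℂ] PreL2 n F E ν where
  toFun s := ⟨a.translate g s.1, a.isMeasurableSection_translate g (hν _) s.2.1, by
    rw [a.eLpNorm_translate g (hν _) s.2.1]
    exact s.2.2⟩
  map_add' s t := Subtype.ext (a.translate_add g s.1 t.1)
  map_smul' c s := Subtype.ext (a.translate_smul g c s.1)
  norm_map' s := congrArg ENNReal.toReal (a.eLpNorm_translate g (hν _) s.2.1)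

/-- The action of `g` on `L²(E, ν)`. -/
noncomputable def l2Map (a : EquivariantStructure m n G F E) {ν : Measure M}
    (hν : ∀ g : G, MeasurePreserving (fun x : M ↦ g • x) ν ν) (g : G) :
    L2 n F E ν →L[ℂ] L2 n F E ν :=
  SeparationQuotient.liftCLM
    ((SeparationQuotient.mkCLM ℂ (PreL2 n F E ν)).comp
      (a.preL2Map hν g).toContinuousLinearMap)
    (fun _ _ h ↦ SeparationQuotient.mk_eq_mk.2 (h.map (a.preL2Map hν g).continuous))

theorem l2Map_mk (a : EquivariantStructure m n G F E) {ν : Measure M}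
    (hν : ∀ g : G, MeasurePreserving (fun x : M ↦ g • x) ν ν) (g : G) (s : PreL2 n F E ν) :
    a.l2Map hν g (SeparationQuotient.mk s) = SeparationQuotient.mk (a.preL2Map hν g s) :=
  SeparationQuotient.liftCLM_mk _ _ _

theorem l2Map_one (a : EquivariantStructure m n G F E) {ν : Measure M}
    (hν : ∀ g : G, MeasurePreserving (fun x : M ↦ g • x) ν ν) (s : L2 n F E ν) :
    a.l2Map hν 1 s = s := by
  obtain ⟨s, rfl⟩ := SeparationQuotient.surjective_mk s
  rw [l2Map_mk]
  exact congrArg SeparationQuotient.mk (Subtype.ext (a.translate_one s.1))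

theorem l2Map_mul (a : EquivariantStructure m n G F E) {ν : Measure M}
    (hν : ∀ g : G, MeasurePreserving (fun x : M ↦ g • x) ν ν) (g h : G) (s : L2 n F E ν) :
    a.l2Map hν (g * h) s = a.l2Map hν g (a.l2Map hν h s) := by
  obtain ⟨s, rfl⟩ := SeparationQuotient.surjective_mk s
  rw [l2Map_mk, l2Map_mk, l2Map_mk]
  exact congrArg SeparationQuotient.mk (Subtype.ext (a.translate_mul g h s.1))

/-- The isometric representation of `G` on `L²(E, ν)`, for a `G`-invariant measure `ν`. -/
noncomputable def l2Rep (a : EquivariantStructure m n G F E) {ν : Measure M}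
    (hν : ∀ g : G, MeasurePreserving (fun x : M ↦ g • x) ν ν) :
    G →* (L2 n F E ν ≃ₗᵢ[ℂ] L2 n F E ν) where
  toFun g :=
    { toFun := a.l2Map hν g
      invFun := a.l2Map hν g⁻¹
      map_add' := (a.l2Map hν g).map_add
      map_smul' := (a.l2Map hν g).map_smul
      left_inv := fun s ↦ by rw [← l2Map_mul, inv_mul_cancel, l2Map_one]
      right_inv := fun s ↦ by rw [← l2Map_mul, mul_inv_cancel, l2Map_one]
      norm_map' := fun s ↦ by
        obtain ⟨s, rfl⟩ := SeparationQuotient.surjective_mk s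
        exact (a.preL2Map hν g).norm_map s }
  map_one' := LinearIsometryEquiv.ext fun s ↦ a.l2Map_one hν s
  map_mul' g h := LinearIsometryEquiv.ext fun s ↦ a.l2Map_mul hν g h s

end Measure

end EquivariantStructure

end Action

section Representations

variable {G : Type*} [Group G]

/-- `α` is an irreducible unitary representation of the topological group `G` on the Hilbert
space `V`: it is strongly continuous, `V ≠ 0`, and the only closed invariant subspaces are `0`
and `V`. -/
structure IsIrreducibleUnitaryRep [TopologicalSpace G] {V : Type*} [NormedAddCommGroup V]
    [InnerProductSpace ℂ V] (α : G →* (V ≃ₗᵢ[ℂ] V)) : Prop where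
  continuous : ∀ v : V, Continuous fun g ↦ α g v
  nontrivial : Nontrivial V
  eq_bot_or_eq_top : ∀ S : Submodule ℂ V, IsClosed (S : Set V) →
    (∀ g, ∀ v ∈ S, α g v ∈ S) → S = ⊥ ∨ S = ⊤

/-- The `α`-isotypical component `H_α` of a representation `ρ` of `G` on `H`: the (closed) sum of
all `G`-submodules of `H` which are isomorphic to `α`. -/
def isotypicComponent {H : Type*} [NormedAddCommGroup H] [NormedSpace ℂ H]
    {V : Type*} [NormedAddCommGroup V] [InnerProductSpace ℂ V]
    (ρ : G →* (H ≃ₗᵢ[ℂ] H)) (α : G →* (V ≃ₗᵢ[ℂ] V)) : Submodule ℂ H :=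
  (sSup {S : Submodule ℂ H | (∀ g, ∀ s ∈ S, ρ g s ∈ S) ∧
    ∃ T : V ≃L[ℂ] S, ∀ (g : G) (v : V), (T (α g v) : H) = ρ g (T v)}).topologicalClosure

end Representations

section Tubes

variable {m n : ℕ} {G : Type*} [Group G] [TopologicalSpace G]
  [ChartedSpace (EuclideanSpace ℝ (Fin m)) G]
  {M : Type*} [TopologicalSpace M] [ChartedSpace (EuclideanSpace ℝ (Fin n)) M] [MulAction G M]

variable (m n G) in
/-- A tube around `x`: a `G`-equivariant diffeomorphism `G ×_{G_x} U → W`, `[g, u] ↦ g φ(u)`, onto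
a neighbourhood `W` of the orbit of `x`, with `[1, 0] ↦ x`, where the slice `U` is an open ball
around `0` in an orthogonal representation of the isotropy group `G_x`, and
`G ×_{G_x} U = (G × U) / ((g h, u) ~ (g, h u))`.

That `[g, u] ↦ g φ(u)` is well defined and a diffeomorphism onto its image is expressed on `G × U`:
the smooth map `(g, u) ↦ g φ(u)` is a submersion whose fibres are the `G_x`-orbits
`{(g h⁻¹, h u) | h ∈ G_x}`. -/
structure Tube (x : M) where
  /-- The dimension of the slice. -/
  dim : ℕ
  /-- The orthogonal representation of `G_x` in which the slice `U` is a ball. -/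
  rep : MulAction.stabilizer G x →*
    (EuclideanSpace ℝ (Fin dim) ≃ₗᵢ[ℝ] EuclideanSpace ℝ (Fin dim))
  continuous_rep : ∀ u, Continuous fun h ↦ rep h u
  /-- The radius of the slice. -/
  radius : ℝ
  radius_pos : 0 < radius
  /-- The embedding of the slice in `M` (only its values on `U` matter). -/
  φ : EuclideanSpace ℝ (Fin dim) → M
  map_zero : φ 0 = x
  contMDiffOn : ContMDiffOn (𝓡 dim) (𝓡 n) ∞ φ (Metric.ball 0 radius)
  smul_eq_smul_iff : ∀ (g g' : G), ∀ u ∈ Metric.ball 0 radius, ∀ u' ∈ Metric.ball 0 radius,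
    g • φ u = g' • φ u' ↔
      ∃ h : MulAction.stabilizer G x, g' = g * (h : G)⁻¹ ∧ u' = rep h u
  surjective_mfderiv : ∀ (g : G), ∀ u ∈ Metric.ball 0 radius,
    Function.Surjective (mfderiv ((𝓡 m).prod (𝓡 dim)) (𝓡 n)
      (fun p : G × EuclideanSpace ℝ (Fin dim) ↦ p.1 • φ p.2) (g, u))

namespace Tube

/-- The tube as a subset of `M`. -/
def carrier {x : M} (W : Tube m n G x) : Set M :=
  {y | ∃ g : G, ∃ u ∈ Metric.ball 0 W.radius, y = g • W.φ u}

theorem preimage_carrier {x : M} (W : Tube m n G x) (g : G) :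
    (fun y : M ↦ g • y) ⁻¹' W.carrier = W.carrier := by
  ext y
  constructor
  · rintro ⟨k, u, hu, h⟩
    refine ⟨g⁻¹ * k, u, hu, ?_⟩
    rw [mul_smul, ← h, inv_smul_smul]
  · rintro ⟨k, u, hu, h⟩
    refine ⟨g * k, u, hu, ?_⟩
    rw [mul_smul, ← h]

variable [RiemannianBundle (fun x : M ↦ TangentSpace (𝓡 n) x)]
  [MeasurableSpace M]

/-- The restriction of the Riemannian volume measure to the tube. -/
noncomputable def volume {x : M} (W : Tube m n G x) : Measure M :=
  (riemannianVolume n M).restrict W.carrier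

variable [BorelSpace M] [CompactSpace M] [IsManifold (𝓡 n) ∞ M]
  [ContMDiffSMul (𝓡 m) (𝓡 n) ∞ G M] [IsIsometricAction n G M]

theorem measurePreserving_smul {x : M} (W : Tube m n G x) (g : G) :
    MeasurePreserving (fun y : M ↦ g • y) W.volume W.volume := by
  have hf : ∀ g : G, ContMDiff (𝓡 n) (𝓡 n) ∞ (fun y : M ↦ g • y) := fun g ↦
    (ContMDiffSMul.contMDiff_smul (I := 𝓡 m) (I' := 𝓡 n) (n := ∞) (G := G) (M := M)).comp
      (contMDiff_const.prodMk contMDiff_id)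
  have hinv : SMulInvariantMeasure G M (riemannianVolume n M) :=
    smulInvariantMeasure_riemannianVolume hf IsIsometricAction.inner_mfderiv_smul
  have h0 : MeasurePreserving (fun y : M ↦ g • y) (riemannianVolume n M) (riemannianVolume n M) :=
    ⟨(hf g).continuous.measurable, by
      ext A hA
      rw [Measure.map_apply (hf g).continuous.measurable hA]
      exact hinv.measure_preimage_smul g hA⟩
  refine ⟨(hf g).continuous.measurable, ?_⟩
  ext A hA
  have hmeas : MeasurableSet ((fun y : M ↦ g • y) ⁻¹' A) := (hf g).continuous.measurable hA
  rw [Measure.map_apply (hf g).continuous.measurable hA, volume, Measure.restrict_apply hA,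
    Measure.restrict_apply hmeas]
  conv_lhs => rw [← W.preimage_carrier g, ← preimage_inter]
  have hemb : MeasurableEmbedding (fun y : M ↦ g • y) := by
    refine (Homeomorph.toMeasurableEquiv
      { toFun := fun y : M ↦ g • y
        invFun := fun y : M ↦ g⁻¹ • y
        left_inv := fun y ↦ inv_smul_smul g y
        right_inv := fun y ↦ smul_inv_smul g y
        continuous_toFun := (hf g).continuous
        continuous_invFun := (hf g⁻¹).continuous }).measurableEmbedding
  exact h0.measure_preimage_emb hemb _

variable {F : Type*} [NormedAddCommGroup F] [NormedSpace ℂ F] [FiniteDimensional ℂ F]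
  {E : M → Type*} [TopologicalSpace (TotalSpace F E)] [∀ x, NormedAddCommGroup (E x)]
  [∀ x, InnerProductSpace ℂ (E x)] [FiberBundle F E] [VectorBundle ℂ F E]
  [IsSmoothHermitianBundle n F E]

/-- The representation of `G` on `L²(W, E)`, for a tube `W`. -/
noncomputable def l2Rep {x : M} (W : Tube m n G x) (a : EquivariantStructure m n G F E) :
    G →* (L2 n F E W.volume ≃ₗᵢ[ℂ] L2 n F E W.volume) :=
  a.l2Rep W.measurePreserving_smul

end Tube

variable [RiemannianBundle (fun x : M ↦ TangentSpace (𝓡 n) x)]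
  [MeasurableSpace M] [BorelSpace M] [CompactSpace M] [IsManifold (𝓡 n) ∞ M]
  [ContMDiffSMul (𝓡 m) (𝓡 n) ∞ G M] [IsIsometricAction n G M]
  {F : Type*} [NormedAddCommGroup F] [NormedSpace ℂ F] [FiniteDimensional ℂ F]
  {E : M → Type*} [TopologicalSpace (TotalSpace F E)] [∀ x, NormedAddCommGroup (E x)]
  [∀ x, InnerProductSpace ℂ (E x)] [FiberBundle F E] [VectorBundle ℂ F E]
  [IsSmoothHermitianBundle n F E]

/-- The set `𝒩_α` of the points `x` of `M` for which there is a tube `W` around `x` with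
`L²(W, E)_α = 0`. -/
def nullSet (a : EquivariantStructure m n G F E) {V : Type*} [NormedAddCommGroup V]
    [InnerProductSpace ℂ V] (α : G →* (V ≃ₗᵢ[ℂ] V)) : Set M :=
  {x | ∃ W : Tube m n G x, isotypicComponent (W.l2Rep a) α = ⊥}

end Tubes

end EquivariantL2

/-!
The proof replaces the function spaces by a condition on single points. Say that `α` occurs at `y`
if there is a nonzero `G_y`-equivariant linear map from `V` to the fibre `E_y` (`Occurs`). The set
of these points is `G`-invariant, and the isotypical component of `L²` over a tube vanishes if and
only if `α` occurs at no point of the tube (`Tube.isotypicComponent_l2Rep_eq_bot_iff`):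

* A `G_y`-equivariant map `V → E_y` extends, by averaging over `G`, to an equivariant family of
  continuous sections (`Occurs.exists_family`). It embeds `V` in `L²`, since `V` is irreducible and
  the Riemannian volume charges open sets.
* An irreducible unitary representation of a compact group is finite-dimensional
  (`IsIrreducibleUnitaryRep.finiteDimensional`). An equivariant map `V → L²` is thus given by
  finitely many sections, and Fubini's theorem on `G × M` shows that their values at almost every
  `y` define a `G_y`-equivariant map `V → E_y` (`isotypicComponent_eq_bot`).

The set is open and invariant because a tube without occurrences of `α` contains tubes around all
of its points. This is the slice theorem `exists_tube`, with arbitrarily small slices. The average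
of a chart at `x` over `G_x` is an equivariant chart (`exists_equivariant_chart`), in which the
orthogonal complement of the tangent space of the orbit is a slice. The constant rank theorem,
applied to the orbit map, shows that points of a small slice are identified only by `G_x`
(`LinearSlice.eventually_mem_stabilizer`).

The set is closed because, in a small tube, the points at which `α` occurs are dense unless there
are none (`Tube.exists_occurs_mem_inter`): a tube around a point near `x` meets every tube around
`x`, and if the former contains no occurrences of `α`, then neither does a small tube around `x`.
For the density, `E` is trivialized equivariantly over the slice (`exists_equivariant_extension`),
so that occurrences of `α` become points `u` of the slice representation with a nonzero
`(G_x)_u`-equivariant map `V → E_x`. Such a map at one point `u₁` is extended by averaging to a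
`G_x`-equivariant map from the slice representation to the linear maps `V → E_x`. The cut-off
function in this average can be taken to be polynomial, by the Stone-Weierstrass theorem, and then
the matrix coefficients of the average restrict to polynomials on lines through `u₁`; they are not
identically zero, and hence nonzero close to every point (`exists_equivariant_map_dense`).
-/

namespace EquivariantL2

/-! ### Irreducible unitary representations of compact groups are finite-dimensional -/

section FiniteDimensional

variable {G : Type*} [Group G] [TopologicalSpace G] [IsTopologicalGroup G] [CompactSpace G]

/-- A compact group carries an invariant probability measure which charges every nonempty open
set. -/
theorem exists_invariant_probability [MeasurableSpace G] [BorelSpace G] :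
    ∃ μ : Measure G, μ.IsMulLeftInvariant ∧ IsProbabilityMeasure μ ∧ μ.IsOpenPosMeasure :=
  ⟨Measure.haarMeasure ⊤, inferInstance, ⟨Measure.haarMeasure_self⟩, inferInstance⟩

variable {V : Type*} [NormedAddCommGroup V] [InnerProductSpace ℂ V] [CompleteSpace V]

/-- An irreducible unitary representation of a compact group is finite-dimensional: the average of
the rank one operators `|α(g) v⟩⟨α(g) v|` over the group is a compact, self-adjoint, nonzero
intertwiner, so that one of its eigenspaces for a nonzero eigenvalue is everything. -/
theorem IsIrreducibleUnitaryRep.finiteDimensional {α : G →* (V ≃ₗᵢ[ℂ] V)}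
    (hα : IsIrreducibleUnitaryRep α) : FiniteDimensional ℂ V := by
  borelize G
  have := hα.nontrivial
  obtain ⟨v, hv⟩ := exists_ne (0 : V)
  obtain ⟨μ, hμ1, hμ2, hμ3⟩ := exists_invariant_probability (G := G)
  let R : G → V →L[ℂ] V := fun g ↦ InnerProductSpace.rankOne ℂ (α g v) (α g v)
  have hR : Continuous R := by
    have h2 : Continuous fun g ↦ (innerSL ℂ (α g v) : V →L[ℂ] ℂ) :=
      (innerSL ℂ : V →L⋆[ℂ] V →L[ℂ] ℂ).continuous.comp (hα.continuous v)
    exact ((ContinuousLinearMap.smulRightL ℂ V V).continuous.comp h2).clm_apply (hα.continuous v)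
  have hRi : Integrable R μ :=
    hR.integrable_of_hasCompactSupport (HasCompactSupport.of_compactSpace _)
  set B : V →L[ℂ] V := ∫ g, R g ∂μ with hB
  have hBapp : ∀ w, B w = ∫ g, inner ℂ (α g v) w • α g v ∂μ := fun w ↦ by
    rw [hB, ContinuousLinearMap.integral_apply hRi]
    rfl
  have hint : ∀ w, Integrable (fun g ↦ inner ℂ (α g v) w • α g v) μ := fun w ↦
    (((hα.continuous v).inner continuous_const).smul
      (hα.continuous v)).integrable_of_hasCompactSupport (HasCompactSupport.of_compactSpace _)
  have hinn : ∀ w z, inner ℂ z (B w) = ∫ g, inner ℂ z (α g v) * inner ℂ (α g v) w ∂μ := by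
    intro w z
    rw [hBapp, ← integral_inner (hint w)]
    simp [inner_smul_right, mul_comm]
  have hcomm : ∀ g w, B (α g w) = α g (B w) := by
    intro g w
    rw [hBapp, hBapp, ← integral_mul_left_eq_self _ g]
    have : ∀ z, α g z = (α g).toContinuousLinearEquiv.toContinuousLinearMap z := fun _ ↦ rfl
    rw [this (∫ _, _ ∂μ), ← ContinuousLinearMap.integral_comp_comm _ (hint w)]
    refine integral_congr_ae (Eventually.of_forall fun h ↦ ?_)
    simp [LinearIsometryEquiv.inner_map_map]
  have hsymm : B.IsSymmetric := by
    intro w z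
    change inner ℂ (B w) z = inner ℂ w (B z)
    rw [← inner_conj_symm, hinn, hinn, ← integral_conj]
    refine integral_congr_ae (Eventually.of_forall fun h ↦ ?_)
    simp [mul_comm]
  have hcpt : IsCompactOperator B := by
    -- the compact operators form a closed convex set
    have hc : B ∈ ((compactOperator (RingHom.id ℂ) V V).restrictScalars ℝ : Set (V →L[ℂ] V)) := by
      refine (Submodule.convex _).integral_mem ?_ (Eventually.of_forall fun g ↦ ?_) hRi
      · exact isClosed_setOfPred_isCompactOperator
      · change IsCompactOperator (R g)
        have h1 : IsCompactOperator (ContinuousLinearMap.toSpanSingleton ℂ (α g v)) :=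
          isCompactOperator_of_locallyCompactSpace_rng
            (ContinuousLinearMap.toSpanSingleton ℂ (α g v))
        exact h1.comp_clm (innerSL ℂ (α g v))
    exact hc
  -- `⟨v, B v⟩` is the integral of `|⟨α(g) v, v⟩|²`
  have hB0 : B ≠ 0 := by
    intro h0
    have h1 : ∫ g, ‖inner ℂ (α g v) v‖ ^ 2 ∂μ = 0 := by
      have h2 := hinn v v
      rw [h0, _root_.zero_apply, inner_zero_right] at h2
      have h3 : ∀ g, inner ℂ v (α g v) * inner ℂ (α g v) v = ((‖inner ℂ (α g v) v‖ ^ 2 : ℝ) : ℂ) :=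
        fun g ↦ by rw [← inner_conj_symm v (α g v), Complex.conj_mul']; push_cast; rfl
      simp only [h3] at h2
      rw [integral_complex_ofReal] at h2
      exact_mod_cast h2.symm
    have hc : Continuous fun g ↦ ‖inner ℂ (α g v) v‖ ^ 2 :=
      (((hα.continuous v).inner continuous_const).norm).pow 2
    have h4 := hc.integral_pos_of_hasCompactSupport_nonneg_nonzero (μ := μ) (x := 1)
      (HasCompactSupport.of_compactSpace _) (fun g ↦ by positivity) (by simpa using hv)
    exact h4.ne' h1
  obtain ⟨c, hc, hc0⟩ : ∃ c, Module.End.HasEigenvalue (B : Module.End ℂ V) c ∧ c ≠ 0 := by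
    by_contra! h
    exact hB0 ((ContinuousLinearMap.eq_zero_of_forall_hasEigenvalue_eq_zero hcpt hsymm).1 h)
  have hfin := ContinuousLinearMap.finite_dimensional_eigenspace hcpt c hc0
  have htop : Module.End.eigenspace (B : Module.End ℂ V) c = ⊤ := by
    refine (hα.eq_bot_or_eq_top _ (Submodule.closed_of_finiteDimensional _) ?_).resolve_left hc
    intro g w hw
    rw [Module.End.mem_eigenspace_iff] at hw ⊢
    change B w = _ at hw
    change B _ = _
    rw [hcomm, hw, map_smul]
  have : FiniteDimensional ℂ (⊤ : Submodule ℂ V) := by rwa [← htop]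
  exact Module.finite_def.2 (Module.Finite.iff_fg.1 this)

end FiniteDimensional

/-! ### The Riemannian volume is finite on small sets and charges open sets -/

section RiemannianVolume

variable {n : ℕ} {M : Type*} [TopologicalSpace M] [ChartedSpace (EuclideanSpace ℝ (Fin n)) M]
  [IsManifold (𝓡 n) ∞ M] [RiemannianBundle (fun x : M ↦ TangentSpace (𝓡 n) x)]

theorem continuousOn_det_gramMatrix [IsContMDiffRiemannianBundle (𝓡 n) ∞ (EuclideanSpace ℝ (Fin n))
      (fun x : M ↦ TangentSpace (𝓡 n) x)] (x : M) :
    ContinuousOn (fun u ↦ (gramMatrix x u).det) (chartAt (EuclideanSpace ℝ (Fin n)) x).target := by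
  set e := chartAt (EuclideanSpace ℝ (Fin n)) x
  have hcr : IsContinuousRiemannianBundle (EuclideanSpace ℝ (Fin n))
      (fun x : M ↦ TangentSpace (𝓡 n) x) := by
    obtain ⟨g, hg, hg'⟩ := IsContMDiffRiemannianBundle.exists_contMDiff (IB := 𝓡 n) (n := ∞)
      (F := EuclideanSpace ℝ (Fin n)) (E := fun x : M ↦ TangentSpace (𝓡 n) x)
    exact ⟨g, hg.continuous, hg'⟩
  have hM1 : IsManifold (𝓡 n) 1 M := .of_le (n := ∞) (by simp)
  have hvec : ∀ v : EuclideanSpace ℝ (Fin n), ContinuousOn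
      (fun u ↦ (TotalSpace.mk' (EuclideanSpace ℝ (Fin n)) (e.symm u)
        (mfderiv (𝓡 n) (𝓡 n) e.symm u v) : TangentBundle (𝓡 n) M)) e.target := by
    intro v
    have h1 : ContMDiffOn (𝓡 n) (𝓡 n) 1 e.symm e.target :=
      contMDiffOn_symm_of_mem_maximalAtlas (IsManifold.chart_mem_maximalAtlas x)
    have h2 := h1.continuousOn_tangentMapWithin le_rfl e.open_target.uniqueMDiffOn
    have h3 : Continuous fun u : EuclideanSpace ℝ (Fin n) ↦
        (TotalSpace.mk' (EuclideanSpace ℝ (Fin n)) u v :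
          TangentBundle (𝓡 n) (EuclideanSpace ℝ (Fin n))) :=
      (tangentBundleModelSpaceHomeomorph (𝓡 n)).symm.continuous.comp
        (continuous_id.prodMk continuous_const)
    refine (h2.comp h3.continuousOn fun u hu ↦ hu).congr fun u hu ↦ ?_
    simp only [Function.comp, tangentMapWithin]
    rw [mfderivWithin_of_mem_nhds (e.open_target.mem_nhds hu)]
  have hentry : ∀ i j, ContinuousOn (fun u ↦ gramMatrix x u i j) e.target := fun i j ↦
    ContinuousOn.inner_bundle (hvec _) (hvec _)
  simp only [Matrix.det_apply]
  exact continuousOn_finsetSum _ fun σ _ ↦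
    (continuousOn_finsetProd _ fun i _ ↦ hentry _ _).const_smul _

theorem det_gramMatrix_pos (x : M) {u : EuclideanSpace ℝ (Fin n)}
    (hu : u ∈ (chartAt (EuclideanSpace ℝ (Fin n)) x).target) : 0 < (gramMatrix x u).det := by
  set e := chartAt (EuclideanSpace ℝ (Fin n)) x
  have hM1 : IsManifold (𝓡 n) 1 M := .of_le (n := ∞) (by simp)
  have hinj : LinearMap.ker (mfderiv (𝓡 n) (𝓡 n) e.symm u).toLinearMap = ⊥ := by
    have hd := (mdifferentiable_of_mem_atlas (I := 𝓡 n) (chart_mem_atlas _ x)).symm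
    exact hd.ker_mfderiv_eq_bot hu
  have h := Matrix.posDef_gram_of_linearIndependent (𝕜 := ℝ)
    (((EuclideanSpace.basisFun (Fin n) ℝ).toBasis.linearIndependent).map'
      (mfderiv (𝓡 n) (𝓡 n) e.symm u).toLinearMap hinj)
  refine lt_of_lt_of_eq h.det_pos (congrArg Matrix.det ?_)
  ext i j
  simp [Matrix.gram, gramMatrix, e]
  rfl

variable [MeasurableSpace M] [BorelSpace M]

theorem chartVolume_eq_of_subset (x z : M) {A : Set M} (hA : MeasurableSet A)
    (hAx : A ⊆ (chartAt (EuclideanSpace ℝ (Fin n)) x).source)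
    (hAz : A ⊆ (chartAt (EuclideanSpace ℝ (Fin n)) z).source) :
    chartVolume (n := n) z A = chartVolume (n := n) x A := by
  have := chartVolume_image (n := n) (f := (id : M → M)) contMDiff_id Function.injective_id
    (fun x v w ↦ by simp [mfderiv_id]) x z hA (by simpa using hA) hAx (by simpa using hAz)
  simpa using this

/-- In the domain of a chart the Riemannian volume is given by the density of that chart. -/
theorem riemannianVolume_eq_chartVolume (x : M) {A : Set M} (hA : MeasurableSet A)
    (hAx : A ⊆ (chartAt (EuclideanSpace ℝ (Fin n)) x).source) :
    riemannianVolume n M A = chartVolume (n := n) x A := by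
  refine le_antisymm ?_ ((le_iSup (fun x : M ↦ chartVolume (n := n) x) x) A)
  set S := (chartAt (EuclideanSpace ℝ (Fin n)) x).source with hSdef
  have hS : MeasurableSet S := (chartAt (EuclideanSpace ℝ (Fin n)) x).open_source.measurableSet
  -- on `S` the densities of the other charts agree with that of the chart around `x`
  have hle : riemannianVolume n M ≤
      chartVolume (n := n) x + (riemannianVolume n M).restrict Sᶜ := by
    refine iSup_le fun z ↦ ?_
    rw [Measure.le_iff]
    intro B hB
    set Z := (chartAt (EuclideanSpace ℝ (Fin n)) z).source
    have hZ : MeasurableSet Z := (chartAt (EuclideanSpace ℝ (Fin n)) z).open_source.measurableSet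
    rw [Measure.add_apply, Measure.restrict_apply hB, ← measure_inter_add_sdiff B hS, sdiff_eq]
    refine add_le_add ?_ ((le_iSup (fun x : M ↦ chartVolume (n := n) x) z) _)
    rw [← measure_inter_add_sdiff (B ∩ S) hZ]
    have h0 : chartVolume (n := n) z ((B ∩ S) \ Z) = 0 :=
      measure_mono_null (fun y hy ↦ hy.2) (chartVolume_compl_source z)
    rw [h0, add_zero, chartVolume_eq_of_subset x z ((hB.inter hS).inter hZ)
      (inter_subset_left.trans inter_subset_right) inter_subset_right]
    exact measure_mono (inter_subset_left.trans inter_subset_left)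
  refine (hle A).trans ?_
  rw [Measure.add_apply, Measure.restrict_apply hA]
  have : A ∩ Sᶜ = ∅ := by
    rw [← sdiff_eq, sdiff_eq_empty]; exact hAx
  simp [this]

variable [IsContMDiffRiemannianBundle (𝓡 n) ∞ (EuclideanSpace ℝ (Fin n))
  (fun x : M ↦ TangentSpace (𝓡 n) x)]

instance isLocallyFiniteMeasure_riemannianVolume :
    IsLocallyFiniteMeasure (riemannianVolume n M) := by
  refine ⟨fun x ↦ ?_⟩
  set e := chartAt (EuclideanSpace ℝ (Fin n)) x with he
  have hx : e x ∈ e.target := mem_chart_target _ x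
  have hc : ContinuousAt (fun u ↦ √(gramMatrix x u).det) (e x) :=
    ((continuousOn_det_gramMatrix x).continuousAt (e.open_target.mem_nhds hx)).sqrt
  obtain ⟨r, hr, hball⟩ := Metric.mem_nhds_iff.1 (inter_mem (e.open_target.mem_nhds hx)
    (hc (Iio_mem_nhds (lt_add_one (√(gramMatrix x (e x)).det)))))
  set U := e.source ∩ e ⁻¹' Metric.ball (e x) r
  have hUo : IsOpen U := e.isOpen_inter_preimage Metric.isOpen_ball
  refine ⟨U, hUo.mem_nhds ⟨mem_chart_source _ x, Metric.mem_ball_self hr⟩, ?_⟩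
  rw [riemannianVolume_eq_chartVolume x hUo.measurableSet inter_subset_left,
    chartVolume_apply x hUo.measurableSet inter_subset_left]
  have himg : e '' U ⊆ Metric.ball (e x) r := by
    rintro _ ⟨y, hy, rfl⟩; exact hy.2
  refine (lintegral_mono_set himg).trans_lt ?_
  refine (setLIntegral_mono' Metric.isOpen_ball.measurableSet
    fun u hu ↦ ENNReal.ofReal_le_ofReal (hball hu).2.le).trans_lt ?_
  rw [setLIntegral_const]
  exact ENNReal.mul_lt_top ENNReal.ofReal_lt_top measure_ball_lt_top

instance isOpenPosMeasure_riemannianVolume :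
    (riemannianVolume n M).IsOpenPosMeasure := by
  refine ⟨fun U hU ⟨x, hx⟩ h0 ↦ ?_⟩
  set e := chartAt (EuclideanSpace ℝ (Fin n)) x with he
  have hU' : IsOpen (U ∩ e.source) := hU.inter e.open_source
  have h1 : riemannianVolume n M (U ∩ e.source) = 0 := measure_mono_null inter_subset_left h0
  rw [riemannianVolume_eq_chartVolume x hU'.measurableSet inter_subset_right,
    chartVolume_apply x hU'.measurableSet inter_subset_right] at h1
  have himg : IsOpen (e '' (U ∩ e.source)) :=
    e.isOpen_image_of_subset_source hU' inter_subset_right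
  have hsub : e '' (U ∩ e.source) ⊆ e.target := by
    rintro _ ⟨y, hy, rfl⟩; exact e.map_source hy.2
  have hm : AEMeasurable (fun u ↦ ENNReal.ofReal √(gramMatrix x u).det)
      (volume.restrict (e '' (U ∩ e.source))) :=
    (ENNReal.continuous_ofReal.comp_continuousOn
      ((continuousOn_det_gramMatrix x).mono hsub).sqrt).aemeasurable himg.measurableSet
  rw [lintegral_eq_zero_iff' hm] at h1
  have h2 : ∀ᵐ u ∂(volume.restrict (e '' (U ∩ e.source))), False := by
    filter_upwards [h1, ae_restrict_mem himg.measurableSet] with u hu hu'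
    have := Real.sqrt_pos.2 (det_gramMatrix_pos x (hsub hu'))
    simp only [Pi.zero_apply, ENNReal.ofReal_eq_zero] at hu
    linarith
  rw [eventually_false_iff_eq_bot, ae_eq_bot, Measure.restrict_eq_zero] at h2
  exact himg.measure_ne_zero _ ⟨e x, x, ⟨hx, mem_chart_source _ x⟩, rfl⟩ h2

end RiemannianVolume

/-! ### Integrals over compact spaces -/

section CompactIntegral

variable {K : Type*} [TopologicalSpace K] [CompactSpace K] [MeasurableSpace K] [BorelSpace K]
  (μ : Measure K) [IsFiniteMeasure μ] {E : Type*} [NormedAddCommGroup E]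

theorem integrable_of_continuous {f : K → E} (hf : Continuous f) : Integrable f μ :=
  hf.integrable_of_hasCompactSupport (HasCompactSupport.of_compactSpace _)

variable [NormedSpace ℝ E]

/-- Integration over a compact space is a continuous linear functional for the uniform norm. -/
theorem continuous_integral_continuousMap : Continuous fun f : C(K, E) ↦ ∫ k, f k ∂μ := by
  let I : C(K, E) →ₗ[ℝ] E :=
    { toFun := fun f ↦ ∫ k, f k ∂μ
      map_add' := fun f g ↦ integral_add (integrable_of_continuous μ f.continuous)
        (integrable_of_continuous μ g.continuous)
      map_smul' := fun c f ↦ integral_smul c _ }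
  refine AddMonoidHomClass.continuous_of_bound I (μ.real univ) fun f ↦ ?_
  rw [mul_comm]
  exact norm_integral_le_of_norm_le_const (Eventually.of_forall f.norm_coe_le_norm)

theorem continuousOn_integral_of_compactSpace {X : Type*} [TopologicalSpace X] {f : X → K → E}
    {s : Set X} (hf : ContinuousOn (Function.uncurry f) (s ×ˢ univ)) :
    ContinuousOn (fun x ↦ ∫ k, f x k ∂μ) s := by
  rw [continuousOn_iff_continuous_domRestrict]
  have h : Continuous fun p : s × K ↦ f p.1 p.2 :=
    hf.comp_continuous (f := fun p : s × K ↦ ((p.1 : X), p.2)) (by fun_prop)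
      (fun p ↦ ⟨p.1.2, mem_univ _⟩)
  exact (continuous_integral_continuousMap μ).comp (ContinuousMap.curry ⟨_, h⟩).continuous

end CompactIntegral

/-! ### Sections of vector bundles -/

section Bundles

variable {M : Type*} [TopologicalSpace M]
  {F : Type*} [NormedAddCommGroup F] [NormedSpace ℂ F]
  {E : M → Type*} [TopologicalSpace (TotalSpace F E)] [∀ x, NormedAddCommGroup (E x)]
  [∀ x, InnerProductSpace ℂ (E x)] [FiberBundle F E] [VectorBundle ℂ F E]

variable (F E) in
theorem finiteDimensional_fiber [FiniteDimensional ℂ F] (x : M) : FiniteDimensional ℂ (E x) :=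
  ((trivializationAt F E x).continuousLinearEquivAt ℂ x
    (mem_baseSet_trivializationAt F E x)).toLinearEquiv.symm.finiteDimensional

set_option linter.unusedSectionVars false in
/-- The norm topology of a fibre is the topology induced from the total space. -/
theorem continuous_fiber_iff {X : Type*} [TopologicalSpace X] {x : M} {f : X → E x} :
    Continuous f ↔ Continuous fun t ↦ TotalSpace.mk' F x (f t) :=
  (FiberBundle.totalSpaceMk_isInducing F E x).continuous_iff

/-- The integral over a compact space of a continuous family of sections is a continuous section. -/
theorem continuous_integral_section [FiniteDimensional ℂ F] {K : Type*} [TopologicalSpace K]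
    [CompactSpace K] [MeasurableSpace K] [BorelSpace K] (μ : Measure K) [IsFiniteMeasure μ]
    {τ : K → ∀ z : M, E z}
    (hτ : Continuous fun p : K × M ↦ TotalSpace.mk' F p.2 (τ p.1 p.2)) :
    Continuous fun z ↦ TotalSpace.mk' F z (∫ k, τ k z ∂μ) := by
  have hfin : ∀ z, FiniteDimensional ℂ (E z) := finiteDimensional_fiber F E
  have hcpl : ∀ z, CompleteSpace (E z) := fun z ↦ FiniteDimensional.complete ℂ (E z)
  have : CompleteSpace F := FiniteDimensional.complete ℂ F
  rw [continuous_iff_continuousAt]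
  intro z₀
  rw [FiberBundle.continuousAt_totalSpace]
  refine ⟨continuousAt_id, ?_⟩
  set e := trivializationAt F E z₀
  have hz₀ : e.baseSet ∈ 𝓝 z₀ :=
    e.open_baseSet.mem_nhds (mem_baseSet_trivializationAt F E z₀)
  have h1 : ContinuousOn (fun z ↦ ∫ k, (e ⟨z, τ k z⟩).2 ∂μ) e.baseSet := by
    refine continuousOn_integral_of_compactSpace μ ?_
    have h2 : Continuous fun p : M × K ↦ TotalSpace.mk' F p.1 (τ p.2 p.1) :=
      hτ.comp continuous_swap
    refine (continuous_snd.comp_continuousOn e.continuousOn).comp h2.continuousOn ?_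
    exact fun p hp ↦ e.mem_source.2 hp.1
  refine (h1.continuousAt hz₀).congr ?_
  filter_upwards [hz₀] with z hz
  have hc : Continuous fun k ↦ τ k z :=
    (continuous_fiber_iff (F := F)).2 (hτ.comp (Continuous.prodMk_left z))
  exact ((e.continuousLinearEquivAt ℂ z hz).toContinuousLinearMap.integral_comp_comm
    (integrable_of_continuous μ hc))

/-- A Borel trivialization of the whole bundle, linear on the fibres: such a trivialization is
obtained by using on each part of a countable Borel partition of the base a local
trivialization. -/
theorem exists_measurable_trivialization [Nonempty M] [SecondCountableTopology M]
    [MeasurableSpace M] [BorelSpace M] [MeasurableSpace F] [BorelSpace F]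
    [SecondCountableTopology F] :
    ∃ Φ : ∀ z : M, E z ≃L[ℂ] F,
      Measurable[borel (TotalSpace F E)] (fun p : TotalSpace F E ↦ Φ p.1 p.2) ∧
      @Measurable _ _ _ (borel (TotalSpace F E))
        (fun p : M × F ↦ TotalSpace.mk' F p.1 ((Φ p.1).symm p.2)) := by
  classical
  borelize (TotalSpace F E)
  obtain ⟨s, hs, hsU⟩ := TopologicalSpace.countable_cover_nhds
    (f := fun x : M ↦ (trivializationAt F E x).baseSet)
    (fun x ↦ (trivializationAt F E x).open_baseSet.mem_nhds (mem_baseSet_trivializationAt F E x))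
  obtain ⟨z₀⟩ := ‹Nonempty M›
  have hsne : s.Nonempty := by
    have := hsU.symm ▸ mem_univ z₀
    simp only [mem_iUnion] at this
    obtain ⟨x, hx, -⟩ := this
    exact ⟨x, hx⟩
  -- at `z` the first trivialization of a countable list that is defined at `z` is used
  obtain ⟨c, hc⟩ := hs.exists_eq_range hsne
  have hex : ∀ z : M, ∃ N, z ∈ (trivializationAt F E (c N)).baseSet := by
    intro z
    have := hsU.symm ▸ mem_univ z
    simp only [mem_iUnion] at this
    obtain ⟨x, hx, hz⟩ := this
    obtain ⟨N, rfl⟩ := hc ▸ hx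
    exact ⟨N, hz⟩
  have hN : Measurable fun z ↦ Nat.find (hex z) :=
    measurable_find hex fun k ↦ (trivializationAt F E (c k)).open_baseSet.measurableSet
  refine ⟨fun z ↦ (trivializationAt F E (c (Nat.find (hex z)))).continuousLinearEquivAt ℂ z
    (Nat.find_spec (hex z)), ?_, ?_⟩
  · have h1 : ∀ k : ℕ, Measurable ((trivializationAt F E (c k)).source.piecewise
        (fun p ↦ ((trivializationAt F E (c k)) p).2) (fun _ ↦ (0 : F))) := fun k ↦
      ContinuousOn.measurable_piecewise
        (continuous_snd.comp_continuousOn (trivializationAt F E (c k)).continuousOn)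
        continuousOn_const (trivializationAt F E (c k)).open_source.measurableSet
    have h2 : Measurable fun q : TotalSpace F E × ℕ ↦
        (trivializationAt F E (c q.2)).source.piecewise
        (fun p ↦ ((trivializationAt F E (c q.2)) p).2) (fun _ ↦ (0 : F)) q.1 :=
      measurable_from_prod_countable_left h1
    have h3 : Measurable fun p : TotalSpace F E ↦ (p, Nat.find (hex p.1)) :=
      measurable_id.prodMk (hN.comp (FiberBundle.continuous_proj F E).measurable)
    convert! h2.comp h3 using 1
    funext p
    have : p ∈ (trivializationAt F E (c (Nat.find (hex p.1)))).source :=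
      (trivializationAt F E _).mem_source.2 (Nat.find_spec (hex p.1))
    simp [Function.comp, Set.piecewise, this]
  · have h1 : ∀ k : ℕ, Measurable ((trivializationAt F E (c k)).target.piecewise
        (trivializationAt F E (c k)).toOpenPartialHomeomorph.symm
        (fun _ ↦ TotalSpace.mk' F z₀ 0)) := fun k ↦
      ContinuousOn.measurable_piecewise
        (trivializationAt F E (c k)).toOpenPartialHomeomorph.continuousOn_symm
        continuousOn_const (trivializationAt F E (c k)).open_target.measurableSet
    have h2 : Measurable fun q : (M × F) × ℕ ↦ (trivializationAt F E (c q.2)).target.piecewise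
        (trivializationAt F E (c q.2)).toOpenPartialHomeomorph.symm
        (fun _ ↦ TotalSpace.mk' F z₀ 0) q.1 :=
      measurable_from_prod_countable_left h1
    have h3 : Measurable fun p : M × F ↦ (p, Nat.find (hex p.1)) :=
      measurable_id.prodMk (hN.comp measurable_fst)
    convert! h2.comp h3 using 1
    funext p
    have hb := Nat.find_spec (hex p.1)
    have : p ∈ (trivializationAt F E (c (Nat.find (hex p.1)))).target :=
      (trivializationAt F E _).mem_target.2 hb
    simp only [Function.comp, Set.piecewise, this, if_true]
    exact ((trivializationAt F E _).symm_apply_eq_mk_continuousLinearEquivAt_symm (R := ℂ) p.1 hb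
      p.2).symm

end Bundles

/-! ### The action between fibres -/

section ActTo

variable {m n : ℕ} {G : Type*} [Group G] [TopologicalSpace G]
  [ChartedSpace (EuclideanSpace ℝ (Fin m)) G]
  {M : Type*} [TopologicalSpace M] [ChartedSpace (EuclideanSpace ℝ (Fin n)) M] [MulAction G M]
  {F : Type*} [NormedAddCommGroup F] [NormedSpace ℂ F]
  {E : M → Type*} [TopologicalSpace (TotalSpace F E)] [∀ x, NormedAddCommGroup (E x)]
  [∀ x, InnerProductSpace ℂ (E x)] [FiberBundle F E]

namespace EquivariantStructure

/-- The action of `g` as a map `E_x → E_y`, where `g x = y`. This form avoids dependent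
rewriting along equalities of base points. -/
noncomputable def actTo (a : EquivariantStructure m n G F E) {g : G} {x y : M} (h : g • x = y) :
    E x ≃ₗᵢ[ℂ] E y :=
  h ▸ a.act g x

variable (a : EquivariantStructure m n G F E)

theorem mk_actTo {g : G} {x y : M} (h : g • x = y) (v : E x) :
    TotalSpace.mk' F y (a.actTo h v) = TotalSpace.mk' F (g • x) (a.act g x v) := by
  subst h; rfl

theorem actTo_one {x : M} (h : (1 : G) • x = x) (v : E x) : a.actTo h v = v := by
  apply TotalSpace.mk_injective (F := F)
  exact (a.mk_actTo h v).trans (a.one_act x v)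

theorem actTo_actTo {g g' k : G} {x y z : M} (h : g • x = y) (h' : g' • y = z) (hk : k • x = z)
    (hgk : g' * g = k) (v : E x) : a.actTo h' (a.actTo h v) = a.actTo hk v := by
  subst h h' hgk
  apply TotalSpace.mk_injective (F := F)
  exact ((a.mk_actTo hk v).trans (a.mul_act g' g x v)).symm

/-- The vector `g s(g⁻¹ y)` does not depend on the way in which the base point `g⁻¹ y` is
written. -/
theorem actTo_section {g : G} {x x' y : M} (h : g • x = y) (h' : g • x' = y) (s : ∀ x, E x) :
    a.actTo h (s x) = a.actTo h' (s x') := by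
  obtain rfl : x = x' := MulAction.injective g (h.trans h'.symm)
  rfl

theorem translate_apply (g : G) (s : ∀ x, E x) {x y : M} (h : g • y = x) :
    a.translate g s x = a.actTo h (s y) := by
  refine a.translate_eq_of_mk g s x _ ?_
  have hy : (1 : G) • y = g⁻¹ • x := by rw [one_smul, ← h, inv_smul_smul]
  have h1 : a.act g⁻¹ x (a.actTo h (s y)) = a.actTo (g := g⁻¹) rfl (a.actTo h (s y)) := rfl
  rw [h1, a.actTo_actTo h rfl hy (inv_mul_cancel g), a.actTo_section hy (one_smul _ _), actTo_one]

/-- The action depends continuously on the group element and on the vector. -/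
theorem continuous_actTo {X : Type*} [TopologicalSpace X] {g : X → G} {x y : X → M}
    (h : ∀ t, g t • x t = y t) {v : ∀ t, E (x t)} (hg : Continuous g)
    (hv : Continuous fun t ↦ TotalSpace.mk' F (x t) (v t)) :
    Continuous fun t ↦ TotalSpace.mk' F (y t) (a.actTo (h t) (v t)) := by
  simp only [mk_actTo]
  exact a.contMDiff_act.continuous.comp (hg.prodMk hv)

end EquivariantStructure

end ActTo

/-! ### Cut-off functions with positive integral -/

section Bump

/-- If `f > 0` on the fibre of `c` over `x`, then `f` has a positive integral against some
function `ψ ∘ c`: take for `ψ` a bump at `x` vanishing on the compact set `c {f ≤ 0}`. -/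
theorem exists_continuousMap_integral_pos {K : Type*} [TopologicalSpace K] [CompactSpace K]
    [MeasurableSpace K] [BorelSpace K] (μ : Measure K) [IsFiniteMeasure μ] [μ.IsOpenPosMeasure]
    {X : Type*} [TopologicalSpace X] [T2Space X] [NormalSpace X] {c : K → X} (hc : Continuous c)
    {f : K → ℝ} (hf : Continuous f) {k₀ : K} (hpos : ∀ k, c k = c k₀ → 0 < f k) :
    ∃ ψ : C(X, ℝ), 0 < ∫ k, ψ (c k) * f k ∂μ := by
  have hcpt : IsCompact (c '' {k | f k ≤ 0}) :=
    ((isClosed_le hf continuous_const).isCompact).image hc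
  have hdisj : Disjoint (c '' {k | f k ≤ 0}) {c k₀} := by
    rw [disjoint_singleton_right]
    rintro ⟨k, hk, hk'⟩
    exact absurd (hpos k hk') (not_lt.2 hk)
  obtain ⟨ψ, h0, h1, h01⟩ := exists_continuous_zero_one_of_isClosed hcpt.isClosed
    isClosed_singleton hdisj
  refine ⟨ψ, ?_⟩
  refine Continuous.integral_pos_of_hasCompactSupport_nonneg_nonzero (x := k₀)
    ((ψ.continuous.comp hc).mul hf) (HasCompactSupport.of_compactSpace _) (fun k ↦ ?_) ?_
  · by_cases hk : f k ≤ 0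
    · have : ψ (c k) = 0 := h0 ⟨k, hk, rfl⟩
      simp [this]
    · exact mul_nonneg (h01 _).1 (not_le.1 hk).le
  · have : ψ (c k₀) = 1 := h1 rfl
    simp only [this, one_mul]
    exact (hpos k₀ rfl).ne'

end Bump

/-! ### Extension of vectors to sections -/

section Extension

variable {M : Type*} [TopologicalSpace M] [T2Space M] [NormalSpace M]
  {F : Type*} [NormedAddCommGroup F] [NormedSpace ℂ F]
  {E : M → Type*} [TopologicalSpace (TotalSpace F E)] [∀ x, NormedAddCommGroup (E x)]
  [∀ x, InnerProductSpace ℂ (E x)] [FiberBundle F E] [VectorBundle ℂ F E]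

variable (F E) in
/-- The vectors in one fibre extend, linearly and continuously, to continuous sections. -/
theorem exists_linear_extension (y : M) :
    ∃ ext : E y →ₗ[ℂ] (∀ z, E z), (∀ w, ext w y = w) ∧
      Continuous fun p : E y × M ↦ TotalSpace.mk' F p.2 (ext p.1 p.2) := by
  set e := trivializationAt F E y
  have hy : y ∈ e.baseSet := mem_baseSet_trivializationAt F E y
  obtain ⟨U, hU, hyU, hUe⟩ := normal_exists_closure_subset (s := {y}) isClosed_singleton
    e.open_baseSet (by simpa using hy)
  obtain ⟨χ, h0, h1, -⟩ := exists_continuous_zero_one_of_isClosed hU.isClosed_compl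
    (isClosed_singleton (x := y)) (by simpa [disjoint_singleton_right] using hyU)
  have hχy : χ y = 1 := h1 rfl
  -- constant in a local trivialization, and cut off by `χ`
  let ext : E y →ₗ[ℂ] (∀ z, E z) :=
    { toFun := fun w z ↦ (χ z : ℂ) • e.symmL ℂ z (e.continuousLinearMapAt ℂ y w)
      map_add' := fun w w' ↦ by funext z; simp
      map_smul' := fun c w ↦ by funext z; simp [smul_comm c] }
  refine ⟨ext, fun w ↦ ?_, ?_⟩
  · change (χ y : ℂ) • e.symmL ℂ y (e.continuousLinearMapAt ℂ y w) = w
    rw [e.symmL_continuousLinearMapAt hy, hχy]; simp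
  · rw [continuous_iff_continuousAt]
    rintro ⟨w₀, z₀⟩
    by_cases hz : z₀ ∈ e.baseSet
    · have h2 : ContinuousAt (fun p : E y × M ↦ e.toOpenPartialHomeomorph.symm
          (p.2, (χ p.2 : ℂ) • e.continuousLinearMapAt ℂ y p.1)) (w₀, z₀) := by
        refine ContinuousAt.comp (g := e.toOpenPartialHomeomorph.symm) ?_ ?_
        · exact e.toOpenPartialHomeomorph.continuousAt_symm (e.mem_target.2 hz)
        · refine Continuous.continuousAt ?_
          fun_prop
      refine h2.congr ?_
      filter_upwards [continuousAt_snd.preimage_mem_nhds (e.open_baseSet.mem_nhds hz)] with p hp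
      have hp : p.2 ∈ e.baseSet := hp
      rw [← e.mk_symm hp]
      rw [← e.symmL_apply (R := ℂ) hp, map_smul]
      rfl
    · have hz' : z₀ ∈ (closure U)ᶜ := fun h ↦ hz (hUe h)
      have h2 : Continuous fun p : E y × M ↦ TotalSpace.mk' F p.2 (0 : E p.2) :=
        (Bundle.Trivialization.continuous_zeroSection (F := F) (E := E) ℂ).comp continuous_snd
      refine h2.continuousAt.congr ?_
      filter_upwards [continuousAt_snd.preimage_mem_nhds
        (isClosed_closure.isOpen_compl.mem_nhds hz')] with p hp
      have : χ p.2 = 0 := h0 fun h ↦ hp (subset_closure h)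
      change _ = TotalSpace.mk' F p.2
        ((χ p.2 : ℂ) • e.symmL ℂ p.2 (e.continuousLinearMapAt ℂ y p.1))
      simp [this]

end Extension

/-! ### Unitary representations -/

section Rep

variable {G : Type*} [Group G] {V : Type*} [NormedAddCommGroup V] [InnerProductSpace ℂ V]
  (α : G →* (V ≃ₗᵢ[ℂ] V))

theorem rep_mul_apply (g h : G) (v : V) : α (g * h) v = α g (α h v) := by
  rw [map_mul]; rfl

theorem rep_inv_apply' (g : G) (v : V) : α g (α g⁻¹ v) = v := by
  rw [← rep_mul_apply, mul_inv_cancel, map_one]; rfl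

end Rep

/-! ### Occurrence of a representation in a fibre -/

section Occurrence

variable {m n : ℕ} {G : Type*} [Group G] [TopologicalSpace G]
  [ChartedSpace (EuclideanSpace ℝ (Fin m)) G]
  {M : Type*} [TopologicalSpace M] [ChartedSpace (EuclideanSpace ℝ (Fin n)) M] [MulAction G M]
  {F : Type*} [NormedAddCommGroup F] [NormedSpace ℂ F]
  {E : M → Type*} [TopologicalSpace (TotalSpace F E)] [∀ x, NormedAddCommGroup (E x)]
  [∀ x, InnerProductSpace ℂ (E x)] [FiberBundle F E]
  {V : Type*} [NormedAddCommGroup V] [InnerProductSpace ℂ V]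

/-- The representation `α` of `G` occurs at `y`: there is a nonzero `G_y`-equivariant linear map
from `V` to the fibre `E_y`. -/
def Occurs (a : EquivariantStructure m n G F E) (α : G →* (V ≃ₗᵢ[ℂ] V)) (y : M) : Prop :=
  ∃ L : V →ₗ[ℂ] E y, L ≠ 0 ∧ ∀ (g : G) (h : g • y = y) (v : V), a.actTo h (L v) = L (α g v)

/-- A `G_y`-equivariant map `V → E_y` extends to a continuous `G`-equivariant family of maps
`V → E_z`: extend it arbitrarily and average over `G`. A suitable cut-off function keeps the average
from vanishing at `y`. -/
theorem Occurs.exists_family [IsTopologicalGroup G] [CompactSpace G] [CompactSpace M] [T2Space M]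
    [ContinuousSMul G M] [FiniteDimensional ℂ F] [VectorBundle ℂ F E] [FiniteDimensional ℂ V]
    {a : EquivariantStructure m n G F E} {α : G →* (V ≃ₗᵢ[ℂ] V)}
    (hα : ∀ v, Continuous fun g ↦ α g v) {y : M} (hy : Occurs a α y) :
    ∃ σ : V →ₗ[ℂ] (∀ z, E z), (∀ v, Continuous fun z ↦ TotalSpace.mk' F z (σ v z)) ∧
      (∀ (g : G) (z z' : M) (h : g • z = z') (v : V), a.actTo h (σ v z) = σ (α g v) z') ∧
      ∃ v, σ v y ≠ 0 := by
  borelize G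
  obtain ⟨μ, hμ1, hμ2, hμ3⟩ := exists_invariant_probability (G := G)
  have hfin : ∀ z, FiniteDimensional ℂ (E z) := finiteDimensional_fiber F E
  have hcpl : ∀ z, CompleteSpace (E z) := fun z ↦ FiniteDimensional.complete ℂ (E z)
  obtain ⟨L, hL0, hL⟩ := hy
  obtain ⟨v₀, hv₀⟩ : ∃ v, L v ≠ 0 := by
    by_contra! h
    exact hL0 (LinearMap.ext h)
  obtain ⟨ext, hext, hextc⟩ := exists_linear_extension F E y
  have hLc : Continuous L := L.continuous_of_finiteDimensional
  -- the translates of the extended map, to be averaged over `g`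
  let τ : V → G → ∀ z, E z := fun v g z ↦
    a.actTo (smul_inv_smul g z) (ext (L (α g⁻¹ v)) (g⁻¹ • z))
  have hτ : ∀ v, Continuous fun p : G × M ↦ TotalSpace.mk' F p.2 (τ v p.1 p.2) := fun v ↦ by
    refine a.continuous_actTo (X := G × M) (g := fun p ↦ p.1) (fun p ↦ smul_inv_smul p.1 p.2)
      continuous_fst ?_
    exact hextc.comp ((hLc.comp ((hα v).comp (continuous_inv.comp continuous_fst))).prodMk
      ((continuous_inv.comp continuous_fst).smul continuous_snd))
  let f : G → ℝ := fun g ↦ (inner ℂ (L v₀) (τ v₀ g y)).re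
  have hτy : Continuous fun g ↦ τ v₀ g y :=
    (continuous_fiber_iff (F := F)).2 ((hτ v₀).comp (Continuous.prodMk_left y))
  have hf : Continuous f := Complex.continuous_re.comp (continuous_const.inner hτy)
  obtain ⟨ψ, hψ⟩ := exists_continuousMap_integral_pos μ (c := fun g : G ↦ g⁻¹ • y)
    (by fun_prop) hf (k₀ := 1) (by
      intro g hg
      have hg' : g⁻¹ • y = y := by simpa using hg
      have hg2 : g • y = y := by rw [← hg', smul_inv_smul, hg']
      have : τ v₀ g y = L v₀ := by
        change a.actTo _ (ext (L (α g⁻¹ v₀)) (g⁻¹ • y)) = _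
        rw [a.actTo_section (smul_inv_smul g y) hg2, hext, hL, rep_inv_apply']
      change 0 < (inner ℂ (L v₀) (τ v₀ g y)).re
      rw [this]
      exact (show 0 < ‖L v₀‖ ^ 2 by positivity).trans_eq
        (inner_self_eq_norm_sq (𝕜 := ℂ) (L v₀)).symm)
  have hψτ : ∀ v, Continuous fun p : G × M ↦
      TotalSpace.mk' F p.2 ((ψ (p.1⁻¹ • p.2) : ℂ) • τ v p.1 p.2) := fun v ↦ by
    have hc : Continuous fun p : G × M ↦ (ψ (p.1⁻¹ • p.2) : ℂ) := by fun_prop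
    have h2 := a.continuous_actTo (X := G × M) (g := fun p ↦ p.1) (fun p ↦ smul_inv_smul p.1 p.2)
      (v := fun p ↦ ext ((ψ (p.1⁻¹ • p.2) : ℂ) • L (α p.1⁻¹ v)) (p.1⁻¹ • p.2)) continuous_fst
      (hextc.comp ((hc.smul (hLc.comp ((hα v).comp (continuous_inv.comp continuous_fst)))).prodMk
        ((continuous_inv.comp continuous_fst).smul continuous_snd)))
    simpa only [map_smul, Pi.smul_apply] using h2
  have hψτz : ∀ v z, Continuous fun g ↦ (ψ (g⁻¹ • z) : ℂ) • τ v g z := fun v z ↦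
    (continuous_fiber_iff (F := F)).2 ((hψτ v).comp (Continuous.prodMk_left z))
  let σ : V →ₗ[ℂ] (∀ z, E z) :=
    { toFun := fun v z ↦ ∫ g, (ψ (g⁻¹ • z) : ℂ) • τ v g z ∂μ
      map_add' := fun v w ↦ by
        funext z
        simp only [Pi.add_apply]
        rw [← integral_add (integrable_of_continuous μ (hψτz v z))
          (integrable_of_continuous μ (hψτz w z))]
        simp [τ]
      map_smul' := fun c v ↦ by
        funext z
        simp only [Pi.smul_apply, RingHom.id_apply]
        rw [← integral_smul]
        simp [τ, smul_comm c] }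
  refine ⟨σ, fun v ↦ continuous_integral_section μ (hψτ v), fun g z z' h v ↦ ?_, v₀, fun h0 ↦ ?_⟩
  · change a.actTo h (∫ k, (ψ (k⁻¹ • z) : ℂ) • τ v k z ∂μ) =
      ∫ k, (ψ (k⁻¹ • z') : ℂ) • τ (α g v) k z' ∂μ
    rw [← integral_mul_left_eq_self (fun k ↦ (ψ (k⁻¹ • z') : ℂ) • τ (α g v) k z') g]
    have : ∀ w, a.actTo h w = (a.actTo h).toContinuousLinearEquiv.toContinuousLinearMap w :=
      fun _ ↦ rfl
    rw [this, ← ContinuousLinearMap.integral_comp_comm _ (integrable_of_continuous μ (hψτz v z))]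
    refine integral_congr_ae (Eventually.of_forall fun k ↦ ?_)
    subst h
    have h1 : (g * k)⁻¹ • g • z = k⁻¹ • z := by rw [mul_inv_rev, mul_smul, inv_smul_smul]
    have h2 : α (g * k)⁻¹ (α g v) = α k⁻¹ v := by
      rw [← rep_mul_apply, mul_inv_rev, inv_mul_cancel_right]
    have h3 : τ (α g v) (g * k) (g • z) = a.actTo rfl (τ v k z) := by
      change a.actTo _ (ext (L (α (g * k)⁻¹ (α g v))) ((g * k)⁻¹ • g • z)) =
        a.actTo _ (a.actTo _ (ext (L (α k⁻¹ v)) (k⁻¹ • z)))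
      have h4 : (g * k) • (k⁻¹ • z) = g • z := by rw [mul_smul, smul_inv_smul]
      rw [h2, a.actTo_actTo _ _ h4 rfl]
      exact a.actTo_section _ _ _
    change a.actTo rfl ((ψ (k⁻¹ • z) : ℂ) • τ v k z) =
      (ψ ((g * k)⁻¹ • g • z) : ℂ) • τ (α g v) (g * k) (g • z)
    rw [h1, h3, map_smul]
  · have h1 : (inner ℂ (L v₀) (σ v₀ y)).re = ∫ g, ψ (g⁻¹ • y) * f g ∂μ := by
      change (inner ℂ (L v₀) (∫ g, (ψ (g⁻¹ • y) : ℂ) • τ v₀ g y ∂μ)).re = _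
      rw [← integral_inner (integrable_of_continuous μ (hψτz v₀ y))]
      have h2 := integrable_of_continuous μ
        ((continuous_const (y := L v₀)).inner (𝕜 := ℂ) (hψτz v₀ y))
      refine (integral_re h2).symm.trans ?_
      refine integral_congr_ae (Eventually.of_forall fun g ↦ ?_)
      change (inner ℂ (L v₀) ((ψ (g⁻¹ • y) : ℂ) • τ v₀ g y)).re = _
      rw [inner_smul_right]
      exact Complex.re_ofReal_mul _ _
    rw [h0, inner_zero_right] at h1
    exact hψ.ne h1

end Occurrence

/-! ### Occurrence in the fibres and in the square-integrable sections -/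

section Criterion

variable {m n : ℕ} {G : Type*} [Group G] [TopologicalSpace G]
  [ChartedSpace (EuclideanSpace ℝ (Fin m)) G] [IsTopologicalGroup G] [CompactSpace G]
  {M : Type*} [TopologicalSpace M] [ChartedSpace (EuclideanSpace ℝ (Fin n)) M] [MulAction G M]
  [CompactSpace M] [T2Space M] [ContinuousSMul G M] [MeasurableSpace M] [BorelSpace M]
  {F : Type*} [NormedAddCommGroup F] [NormedSpace ℂ F] [FiniteDimensional ℂ F]
  {E : M → Type*} [TopologicalSpace (TotalSpace F E)] [∀ x, NormedAddCommGroup (E x)]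
  [∀ x, InnerProductSpace ℂ (E x)] [FiberBundle F E] [VectorBundle ℂ F E]
  [IsSmoothHermitianBundle n F E]
  {V : Type*} [NormedAddCommGroup V] [InnerProductSpace ℂ V] [CompleteSpace V]

set_option linter.unusedSectionVars false in
theorem mk_eq_zero_iff {ν : Measure M} (s : PreL2 n F E ν) :
    (SeparationQuotient.mk s : L2 n F E ν) = 0 ↔ ∀ᵐ x ∂ν, s.1 x = 0 := by
  rw [← norm_eq_zero, SeparationQuotient.norm_mk]
  change (eLpNorm (fun x ↦ ‖s.1 x‖) 2 ν).toReal = 0 ↔ _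
  rw [ENNReal.toReal_eq_zero_iff, or_iff_left s.2.2.ne,
    eLpNorm_eq_zero_iff (s.2.1.aestronglyMeasurable_norm n) (by norm_num)]
  simp only [EventuallyEq, Pi.zero_apply, norm_eq_zero]

/-- If `α` occurs at a point of the support of the measure, then it occurs in `L²`. -/
theorem Occurs.isotypicComponent_ne_bot {a : EquivariantStructure m n G F E}
    {α : G →* (V ≃ₗᵢ[ℂ] V)} (hα : IsIrreducibleUnitaryRep α) {ν : Measure M} [IsFiniteMeasure ν]
    (hν : ∀ g : G, MeasurePreserving (fun x : M ↦ g • x) ν ν) {y : M} (hy : Occurs a α y)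
    (hpos : ∀ U, IsOpen U → y ∈ U → ν U ≠ 0) :
    isotypicComponent (a.l2Rep hν) α ≠ ⊥ := by
  have := hα.finiteDimensional
  obtain ⟨σ, hσc, hσ, v₀, hv₀⟩ := hy.exists_family hα.continuous
  have hnorm : ∀ v, Continuous fun z ↦ ‖σ v z‖ := fun v ↦
    (continuous_norm_totalSpace n F E).comp (hσc v)
  let T : V →ₗ[ℂ] L2 n F E ν :=
    (SeparationQuotient.mkCLM ℂ (PreL2 n F E ν)).toLinearMap ∘ₗ
      { toFun := fun v ↦ ⟨σ v, by
          borelize (TotalSpace F E)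
          exact (hσc v).measurable.aemeasurable, by
          obtain ⟨C, hC⟩ := isCompact_univ.exists_bound_of_continuousOn (hnorm v).continuousOn
          exact (MemLp.of_bound (hnorm v).aestronglyMeasurable C
            (Eventually.of_forall fun x ↦ hC x (mem_univ x))).2⟩
        map_add' := fun v w ↦ Subtype.ext (σ.map_add v w)
        map_smul' := fun c v ↦ Subtype.ext (σ.map_smul c v) }
  have hT : ∀ v, T v = 0 ↔ ∀ᵐ x ∂ν, σ v x = 0 := fun v ↦ mk_eq_zero_iff _
  have hTα : ∀ g v, T (α g v) = a.l2Rep hν g (T v) := by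
    intro g v
    change _ = a.l2Map hν g (SeparationQuotient.mk _)
    rw [EquivariantStructure.l2Map_mk]
    refine congrArg SeparationQuotient.mk (Subtype.ext (funext fun x ↦ ?_))
    change σ (α g v) x = a.translate g (σ v) x
    rw [a.translate_apply g _ (smul_inv_smul g x)]
    exact (hσ _ _ _ _ _).symm
  have hTv₀ : T v₀ ≠ 0 := by
    rw [Ne, hT]
    intro h
    refine hpos {x | 0 < ‖σ v₀ x‖} (isOpen_lt continuous_const (hnorm v₀)) (by simpa using hv₀) ?_
    refine measure_mono_null (fun x hx ↦ ?_) h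
    simpa using hx
  -- the kernel is an invariant subspace of the irreducible representation `V`
  have hker : LinearMap.ker T = ⊥ := by
    refine (hα.eq_bot_or_eq_top _ (Submodule.closed_of_finiteDimensional _) ?_).resolve_right ?_
    · intro g v hv
      rw [LinearMap.mem_ker] at hv ⊢
      rw [hTα, hv, map_zero]
    · intro h
      exact hTv₀ (LinearMap.mem_ker.1 (h ▸ Submodule.mem_top))
  let e := (LinearEquiv.ofInjective T (LinearMap.ker_eq_bot.1 hker)).toContinuousLinearEquiv
  intro h
  refine hTv₀ ((Submodule.mem_bot ℂ).1 (h ▸ ?_))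
  refine Submodule.le_topologicalClosure _ (?_ : T v₀ ∈ _)
  have hS : LinearMap.range T ∈ {S : Submodule ℂ (L2 n F E ν) |
      (∀ g, ∀ s ∈ S, a.l2Rep hν g s ∈ S) ∧
      ∃ T : V ≃L[ℂ] S, ∀ (g : G) (v : V), (T (α g v) : L2 n F E ν) = a.l2Rep hν g (T v)} := by
    refine ⟨?_, e, fun g v ↦ hTα g v⟩
    rintro g _ ⟨v, rfl⟩
    exact ⟨α g v, hTα g v⟩
  exact le_sSup hS ⟨v₀, rfl⟩

/-- If `α` occurs almost nowhere, then it does not occur in `L²`: an equivariant map `V → L²` is,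
by Fubini's theorem, given by a `G_y`-equivariant map `V → E_y` for almost every `y`. -/
theorem isotypicComponent_eq_bot {a : EquivariantStructure m n G F E}
    {α : G →* (V ≃ₗᵢ[ℂ] V)} (hα : IsIrreducibleUnitaryRep α) {ν : Measure M} [IsFiniteMeasure ν]
    (hν : ∀ g : G, MeasurePreserving (fun x : M ↦ g • x) ν ν) (hocc : ∀ᵐ y ∂ν, ¬ Occurs a α y) :
    isotypicComponent (a.l2Rep hν) α = ⊥ := by
  have := hα.finiteDimensional
  rcases isEmpty_or_nonempty M with hM | hM
  · refine (Submodule.eq_bot_iff _).2 fun t _ ↦ ?_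
    obtain ⟨t, rfl⟩ := SeparationQuotient.surjective_mk t
    rw [mk_eq_zero_iff]
    exact Eventually.of_forall fun x ↦ hM.elim x
  borelize G
  borelize F
  borelize (TotalSpace F E)
  have : SecondCountableTopology G :=
    ChartedSpace.secondCountable_of_sigmaCompact (EuclideanSpace ℝ (Fin m)) G
  have : SecondCountableTopology M :=
    ChartedSpace.secondCountable_of_sigmaCompact (EuclideanSpace ℝ (Fin n)) M
  have : ProperSpace F := FiniteDimensional.proper ℂ F
  obtain ⟨μ, hμ1, hμ2, hμ3⟩ := exists_invariant_probability (G := G)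
  obtain ⟨Φ, hΦ, hΦ'⟩ := exists_measurable_trivialization (F := F) (E := E)
  suffices h : sSup {S : Submodule ℂ (L2 n F E ν) | (∀ g, ∀ s ∈ S, a.l2Rep hν g s ∈ S) ∧
      ∃ T : V ≃L[ℂ] S, ∀ (g : G) (v : V), (T (α g v) : L2 n F E ν) = a.l2Rep hν g (T v)} = ⊥ by
    have hcl : IsClosed ((⊥ : Submodule ℂ (L2 n F E ν)) : Set (L2 n F E ν)) := by
      simp
    rw [isotypicComponent, h, hcl.submodule_topologicalClosure_eq]
  rw [sSup_eq_bot]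
  rintro S ⟨-, T, hT⟩
  let b := Module.finBasis ℂ V
  -- the matrix coefficients of `α`
  let c : G → Fin _ → Fin _ → ℂ := fun g j i ↦ b.repr (α g (b j)) i
  have hc : ∀ j i, Continuous fun g ↦ c g j i := fun j i ↦
    (b.coord i).continuous_of_finiteDimensional.comp (hα.continuous (b j))
  choose s hs using fun j ↦ SeparationQuotient.surjective_mk (T (b j) : L2 n F E ν)
  -- Borel representatives of the sections `T (b j)`
  have hf : ∀ j, AEMeasurable (fun y ↦ Φ y ((s j).1 y)) ν := fun j ↦
    hΦ.comp_aemeasurable (s j).2.1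
  let f : Fin _ → M → F := fun j ↦ (hf j).mk _
  have hfm : ∀ j, Measurable (f j) := fun j ↦ (hf j).measurable_mk
  let s' : Fin _ → ∀ y, E y := fun j y ↦ (Φ y).symm (f j y)
  have hs'm : ∀ j, Measurable fun y ↦ TotalSpace.mk' F y (s' j y) := fun j ↦
    hΦ'.comp (measurable_id.prodMk (hfm j))
  have hs's : ∀ j, ∀ᵐ y ∂ν, (s j).1 y = s' j y := by
    intro j
    filter_upwards [(hf j).ae_eq_mk] with y hy
    change _ = (Φ y).symm ((hf j).mk _ y)
    rw [← hy, ContinuousLinearEquiv.symm_apply_apply]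
  have hae : ∀ g, ∀ᵐ y ∂ν, ∀ j, a.translate g (s' j) y = ∑ i, c g j i • s' i y := by
    intro g
    rw [ae_all_iff]
    intro j
    have h1 : (SeparationQuotient.mk (a.preL2Map hν g (s j) - ∑ i, c g j i • s i) : L2 n F E ν)
        = 0 := by
      let q := SeparationQuotient.mkCLM ℂ (PreL2 n F E ν)
      have h2 : q (a.preL2Map hν g (s j)) = T (α g (b j)) := by
        rw [hT, ← hs]
        exact (a.l2Map_mk hν g (s j)).symm
      change q _ = 0
      rw [map_sub, map_sum, h2, ← b.sum_repr (α g (b j)), map_sum, Submodule.coe_sum, sub_eq_zero]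
      refine Finset.sum_congr rfl fun i _ ↦ ?_
      rw [map_smul, map_smul, Submodule.coe_smul, ← hs]
      rfl
    rw [mk_eq_zero_iff] at h1
    filter_upwards [h1, ae_all_iff.2 hs's,
      (hν g⁻¹).quasiMeasurePreserving.ae (hs's j)] with y h1 h2 h3
    have h4 : a.translate g (s j).1 y = a.translate g (s' j) y := by
      rw [a.translate_apply g _ (smul_inv_smul g y), a.translate_apply g _ (smul_inv_smul g y), h3]
    let val : PreL2 n F E ν →ₗ[ℂ] (∀ x, E x) := (squareIntegrableSections n F E ν).subtype
    have h5 : val (a.preL2Map hν g (s j) - ∑ i, c g j i • s i) y = 0 := h1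
    rw [map_sub, map_sum, Pi.sub_apply, sub_eq_zero, Finset.sum_apply] at h5
    rw [← h4]
    refine h5.trans (Finset.sum_congr rfl fun i _ ↦ ?_)
    rw [map_smul, Pi.smul_apply, ← h2]
    rfl
  have hmeas : MeasurableSet {p : G × M | ∀ j, a.translate p.1 (s' j) p.2 =
      ∑ i, c p.1 j i • s' i p.2} := by
    have h1 : {p : G × M | ∀ j, a.translate p.1 (s' j) p.2 = ∑ i, c p.1 j i • s' i p.2} =
        ⋂ j, {p : G × M | Φ p.2 (a.translate p.1 (s' j) p.2) = ∑ i, c p.1 j i • f i p.2} := by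
      ext p
      simp only [mem_ofPred_eq, mem_iInter]
      refine forall_congr' fun j ↦ ?_
      rw [← (Φ p.2).injective.eq_iff]
      simp [s']
    rw [h1]
    refine MeasurableSet.iInter fun j ↦ measurableSet_eq_fun ?_ ?_
    · have h2 : Measurable fun p : G × M ↦ (p.1, TotalSpace.mk' F (p.1⁻¹ • p.2)
          (s' j (p.1⁻¹ • p.2))) :=
        measurable_fst.prodMk ((hs'm j).comp
          ((continuous_fst.inv.smul continuous_snd).measurable))
      have h3 := hΦ.comp ((a.contMDiff_act.continuous.measurable).comp h2)
      convert! h3 using 1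
      funext p
      exact congrArg (fun q : TotalSpace F E ↦ Φ q.1 q.2) (a.mk_translate p.1 (s' j) p.2)
    · exact Finset.measurable_sum _ fun i _ ↦
        ((hc j i).measurable.comp measurable_fst).smul ((hfm i).comp measurable_snd)
  -- by Fubini's theorem, almost everywhere on `M` the sections satisfy the equations for almost
  -- every `g`
  have hswap : ∀ᵐ y ∂ν, ∀ᵐ g ∂μ, ∀ j, a.translate g (s' j) y = ∑ i, c g j i • s' i y :=
    (Measure.ae_ae_comm hmeas).1 (Eventually.of_forall hae)
  have hzero : ∀ᵐ y ∂ν, ∀ j, s' j y = 0 := by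
    filter_upwards [hswap, hocc] with y hy hocc
    let L : V →ₗ[ℂ] E y := b.constr ℂ fun j ↦ s' j y
    have hL : ∀ g j, L (α g (b j)) = ∑ i, c g j i • s' i y := by
      intro g j
      conv_lhs => rw [← b.sum_repr (α g (b j))]
      simp [L, c]
    have hL0 : L = 0 := by
      by_contra h0
      refine hocc ⟨L, h0, fun h hh v ↦ ?_⟩
      have h2 : ∀ᵐ g ∂μ, ∀ j, a.translate (h * g) (s' j) y = ∑ i, c (h * g) j i • s' i y :=
        (measurePreserving_mul_left μ h).quasiMeasurePreserving.ae hy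
      -- compare the equations for `g` and `h * g`, where `g` is chosen such that both hold
      obtain ⟨g, hg1, hg2⟩ := (hy.and h2).exists
      have h3 : (a.actTo hh).toLinearEquiv.toLinearMap ∘ₗ L ∘ₗ (α g).toLinearEquiv.toLinearMap =
          L ∘ₗ (α (h * g)).toLinearEquiv.toLinearMap := by
        refine b.ext fun j ↦ ?_
        change a.actTo hh (L (α g (b j))) = L (α (h * g) (b j))
        have h4 : (h * g) • g⁻¹ • y = y := by rw [mul_smul, smul_inv_smul, hh]
        rw [hL, hL, ← hg1, ← hg2, a.translate_apply g _ (smul_inv_smul g y),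
          a.translate_apply _ _ h4, a.actTo_actTo _ _ h4 rfl]
      have h5 := LinearMap.congr_fun h3 (α g⁻¹ v)
      change a.actTo hh (L (α g (α g⁻¹ v))) = L (α (h * g) (α g⁻¹ v)) at h5
      rwa [rep_mul_apply, rep_inv_apply'] at h5
    intro j
    have : L (b j) = s' j y := by simp [L]
    rw [← this, hL0, LinearMap.zero_apply]
  have hTb : ∀ j, (T (b j) : L2 n F E ν) = 0 := by
    intro j
    rw [← hs, mk_eq_zero_iff]
    filter_upwards [hzero, hs's j] with y h1 h2
    rw [h2, h1]
  have hT0 : ∀ v, T v = 0 := by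
    intro v
    rw [← b.sum_repr v, map_sum]
    refine Finset.sum_eq_zero fun j _ ↦ ?_
    rw [map_smul, show T (b j) = 0 from Subtype.ext (hTb j), smul_zero]
  refine (Submodule.eq_bot_iff _).2 fun t ht ↦ ?_
  have := hT0 (T.symm ⟨t, ht⟩)
  rw [T.apply_symm_apply] at this
  exact congrArg Subtype.val this

end Criterion

/-! ### Differentiation under the integral sign -/

section ParametricIntegral

variable {K : Type*} [TopologicalSpace K] {P X : Type} [NormedAddCommGroup P] [NormedSpace ℝ P]
  [NormedAddCommGroup X] [NormedSpace ℝ X]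

/-- A family `f k` of functions on `Ω` depends smoothly on both variables if locally it has the
form `f k z = Fhat (κ k, z)` with `Fhat` smooth and `κ` a map to a normed space `P` which is
continuous at the given point. (In the applications `K` is a closed subgroup of a Lie group, which
carries itself no charts, and `κ` comes from a chart of the Lie group.) -/
def SmoothFamily (P : Type) [NormedAddCommGroup P] [NormedSpace ℝ P] {Y : Type}
    [NormedAddCommGroup Y] [NormedSpace ℝ Y] (f : K → X → Y) (Ω : Set X) : Prop :=
  ∀ k₀ : K, ∀ z₀ ∈ Ω, ∃ (κ : K → P) (Fhat : P × X → Y), ContinuousAt κ k₀ ∧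
    ContDiffAt ℝ ∞ Fhat (κ k₀, z₀) ∧ ∀ᶠ p : K × X in 𝓝 (k₀, z₀), f p.1 p.2 = Fhat (κ p.1, p.2)

variable {Y : Type} [NormedAddCommGroup Y] [NormedSpace ℝ Y] {f : K → X → Y} {Ω : Set X}

theorem SmoothFamily.continuousOn (hf : SmoothFamily P f Ω) :
    ContinuousOn (Function.uncurry f) (univ ×ˢ Ω) := by
  rintro ⟨k₀, z₀⟩ ⟨-, hz⟩
  obtain ⟨κ, Fh, hκ, hF, he⟩ := hf k₀ z₀ hz
  refine ContinuousAt.continuousWithinAt ?_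
  have h1 : ContinuousAt (fun p : K × X ↦ Fh (κ p.1, p.2)) (k₀, z₀) :=
    ContinuousAt.comp (g := Fh) (f := fun p : K × X ↦ (κ p.1, p.2)) hF.continuousAt
      ((hκ.comp continuousAt_fst).prodMk continuousAt_snd)
  exact h1.congr (he.mono fun p hp ↦ hp.symm)

theorem SmoothFamily.contDiffAt (hf : SmoothFamily P f Ω) (k : K) {z : X} (hz : z ∈ Ω) :
    ContDiffAt ℝ ∞ (f k) z := by
  obtain ⟨κ, Fh, hκ, hF, he⟩ := hf k z hz
  have h1 : ContDiffAt ℝ ∞ (fun w ↦ Fh (κ k, w)) z :=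
    ContDiffAt.comp (g := Fh) z hF (contDiffAt_const.prodMk contDiffAt_id)
  refine h1.congr_of_eventuallyEq ?_
  exact (Continuous.prodMk_right k).continuousAt.eventually he

theorem SmoothFamily.fderiv (hf : SmoothFamily P f Ω) :
    SmoothFamily P (fun k z ↦ fderiv ℝ (f k) z) Ω := by
  intro k₀ z₀ hz
  obtain ⟨κ, Fh, hκ, hF, he⟩ := hf k₀ z₀ hz
  refine ⟨κ, fun q ↦ (_root_.fderiv ℝ Fh q).comp (ContinuousLinearMap.inr ℝ P X), hκ, ?_, ?_⟩
  · have h1 : ContDiffAt ℝ ∞ (_root_.fderiv ℝ Fh) (κ k₀, z₀) := hF.fderiv_right (by simp)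
    exact h1.clm_comp contDiffAt_const
  · have hc : ContinuousAt (fun p : K × X ↦ (κ p.1, p.2)) (k₀, z₀) :=
      (hκ.comp continuousAt_fst).prodMk continuousAt_snd
    have hd : ∀ᶠ q in 𝓝 (κ k₀, z₀), DifferentiableAt ℝ Fh q :=
      ((hF.of_le (m := 1) (by simp)).eventually (by simp)).mono fun q hq ↦
        hq.differentiableAt (by simp)
    filter_upwards [he.eventually_nhds, hc.eventually hd] with p hp hdp
    have h2 : f p.1 =ᶠ[𝓝 p.2] fun w ↦ Fh (κ p.1, w) :=
      (Continuous.prodMk_right p.1).continuousAt.eventually hp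
    rw [h2.fderiv_eq]
    have h3 : HasFDerivAt (fun w : X ↦ (κ p.1, w)) (ContinuousLinearMap.inr ℝ P X) p.2 :=
      hasFDerivAt_prodMk_right _ _
    exact (hdp.hasFDerivAt.comp p.2 h3).fderiv

variable [CompactSpace K] [MeasurableSpace K] [BorelSpace K] (μ : Measure K) [IsFiniteMeasure μ]
  [ProperSpace X]

theorem SmoothFamily.hasFDerivAt_integral (hf : SmoothFamily P f Ω) (hΩ : IsOpen Ω)
    {z₀ : X} (hz : z₀ ∈ Ω) :
    HasFDerivAt (fun z ↦ ∫ k, f k z ∂μ) (∫ k, _root_.fderiv ℝ (f k) z₀ ∂μ) z₀ := by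
  obtain ⟨ε, hε, hball⟩ := Metric.nhds_basis_closedBall.mem_iff.1 (hΩ.mem_nhds hz)
  have hcont : ∀ z ∈ Ω, Continuous fun k ↦ f k z := fun z hz ↦
    hf.continuousOn.comp_continuous (f := fun k ↦ (k, z)) (by fun_prop) (fun k ↦ ⟨mem_univ _, hz⟩)
  have hcont' : Continuous fun k ↦ _root_.fderiv ℝ (f k) z₀ :=
    hf.fderiv.continuousOn.comp_continuous (f := fun k ↦ (k, z₀)) (by fun_prop)
      (fun k ↦ ⟨mem_univ _, hz⟩)
  obtain ⟨C, hC⟩ := (isCompact_univ.prod (isCompact_closedBall z₀ ε)).exists_bound_of_continuousOn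
    (hf.fderiv.continuousOn.mono (prod_mono_right hball))
  refine hasFDerivAt_integral_of_dominated_of_fderiv_le (bound := fun _ ↦ C)
    (F' := fun z k ↦ _root_.fderiv ℝ (f k) z)
    (Metric.ball_mem_nhds z₀ hε) ?_ (integrable_of_continuous μ (hcont z₀ hz))
    (integrable_of_continuous μ hcont').aestronglyMeasurable ?_ (integrable_const C) ?_
  · filter_upwards [hΩ.mem_nhds hz] with z hz
    exact (integrable_of_continuous μ (hcont z hz)).aestronglyMeasurable
  · exact Eventually.of_forall fun k z hz ↦
      hC (k, z) ⟨mem_univ _, Metric.ball_subset_closedBall hz⟩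
  · exact Eventually.of_forall fun k z hz ↦
      ((hf.contDiffAt k (hball (Metric.ball_subset_closedBall hz))).differentiableAt
        (by simp)).hasFDerivAt

/-- Differentiation under the integral sign: the integral over a compact space of a smooth family
is smooth. -/
theorem SmoothFamily.contDiffOn_integral (hf : SmoothFamily P f Ω) (hΩ : IsOpen Ω) :
    ContDiffOn ℝ ∞ (fun z ↦ ∫ k, f k z ∂μ) Ω := by
  rw [contDiffOn_infty]
  intro N
  induction N generalizing Y with
  | zero =>
    rw [CharP.cast_eq_zero, contDiffOn_zero]
    exact fun z hz ↦ (hf.hasFDerivAt_integral μ hΩ hz).continuousAt.continuousWithinAt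
  | succ N ih =>
    rw [Nat.cast_add, Nat.cast_one, contDiffOn_succ_iff_fderiv_of_isOpen hΩ]
    refine ⟨fun z hz ↦ (hf.hasFDerivAt_integral μ hΩ hz).differentiableAt.differentiableWithinAt,
      by simp, ?_⟩
    exact (ih hf.fderiv).congr fun z hz ↦ (hf.hasFDerivAt_integral μ hΩ hz).fderiv

end ParametricIntegral

/-! ### The constant rank theorem -/

section ConstantRank

variable {X Y : Type*} [NormedAddCommGroup X] [NormedSpace ℝ X] [FiniteDimensional ℝ X]
  [NormedAddCommGroup Y] [NormedSpace ℝ Y] [FiniteDimensional ℝ Y]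

/-- The constant rank theorem, in the form that near `y₀` the values of `θ` are attained on a slice
`S` transverse to the fibre of `θ`: if the rank of `θ` does not increase near `y₀`, then
`θ y = θ (S (c y))` for a map `S` on the range of `dθ_{y₀}`, whose derivative at `0` is a right
inverse of `dθ_{y₀}`, and a map `c` which is continuous at `y₀`. -/
theorem exists_slice_of_finrank_le {θ : Y → X} {y₀ : Y} (hθ : ContDiffAt ℝ ∞ θ y₀)
    (hrank : ∀ᶠ y in 𝓝 y₀, Module.finrank ℝ (fderiv ℝ θ y).range ≤
      Module.finrank ℝ (fderiv ℝ θ y₀).range) :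
    ∃ (S : (fderiv ℝ θ y₀).range → Y)
      (S' : (fderiv ℝ θ y₀).range →L[ℝ] Y) (c : Y → (fderiv ℝ θ y₀).range),
      S 0 = y₀ ∧ HasStrictFDerivAt S S' 0 ∧ (∀ w, fderiv ℝ θ y₀ (S' w) = w) ∧
      c y₀ = 0 ∧ ContinuousAt c y₀ ∧ ∀ᶠ y in 𝓝 y₀, θ y = θ (S (c y)) := by
  set θ' := fderiv ℝ θ y₀ with hθ'
  set W := θ'.range with hW
  obtain ⟨q₀, hq₀⟩ := W.subtype.exists_leftInverse_of_injective W.ker_subtype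
  let pr : X →L[ℝ] W := q₀.toContinuousLinearMap
  have hpr : ∀ w : W, pr w = w := fun w ↦ LinearMap.congr_fun hq₀ w
  obtain ⟨p₀, hp₀⟩ := (θ'.ker).subtype.exists_leftInverse_of_injective (Submodule.ker_subtype _)
  let p : Y →L[ℝ] θ'.ker := p₀.toContinuousLinearMap
  have hp : ∀ w : θ'.ker, p w = w := fun w ↦ LinearMap.congr_fun hp₀ w
  -- `Θ` straightens `θ`: its first component is `θ` projected to the range of `dθ_{y₀}`
  let Θ : Y → W × θ'.ker := fun y ↦ (pr (θ y - θ y₀), p (y - y₀))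
  have hΘ₀ : Θ y₀ = 0 := by simp [Θ]
  have hΘ : ContDiffAt ℝ ∞ Θ y₀ :=
    (pr.contDiff.contDiffAt.comp y₀ (hθ.sub contDiffAt_const)).prodMk
      (p.contDiff.contDiffAt.comp y₀ (contDiffAt_id.sub contDiffAt_const))
  let Θ' : Y →L[ℝ] W × θ'.ker := (pr.comp θ').prod p
  have hinj : Function.Injective Θ' := by
    rw [injective_iff_map_eq_zero]
    intro v hv
    have h1 : pr (θ' v) = 0 := congrArg Prod.fst hv
    have h2 : p v = 0 := congrArg Prod.snd hv
    have h3 : θ' v = 0 := by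
      have := hpr ⟨θ' v, v, rfl⟩
      rw [h1] at this
      exact (congrArg Subtype.val this).symm
    have h4 := hp ⟨v, h3⟩
    rw [h2] at h4
    exact (congrArg Subtype.val h4).symm
  let e : Y ≃L[ℝ] W × θ'.ker := (LinearEquiv.ofInjectiveOfFinrankEq Θ'.toLinearMap hinj (by
    rw [Module.finrank_prod]
    exact (LinearMap.finrank_range_add_finrank_ker _).symm)).toContinuousLinearEquiv
  have he : (e : Y →L[ℝ] W × θ'.ker) = Θ' := rfl
  have hΘ' : HasFDerivAt Θ (e : Y →L[ℝ] W × θ'.ker) y₀ := by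
    rw [he]
    exact (pr.hasFDerivAt.comp y₀ ((hθ.differentiableAt (by simp)).hasFDerivAt.sub_const _)).prodMk
      (p.hasFDerivAt.comp y₀ ((hasFDerivAt_id y₀).sub_const _))
  have hΘs : HasStrictFDerivAt Θ (e : Y →L[ℝ] W × θ'.ker) y₀ :=
    hΘ.hasStrictFDerivAt' hΘ' (by simp)
  let Sg : W × θ'.ker → Y := hΘ.localInverse hΘ' (by simp)
  have hSg : ContDiffAt ℝ ∞ Sg 0 := hΘ₀ ▸ hΘ.to_localInverse hΘ' (by simp)
  have hSg0 : Sg 0 = y₀ := hΘ₀ ▸ hΘ.localInverse_apply_image hΘ' (by simp)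
  have hSg' : HasStrictFDerivAt Sg (e.symm : W × θ'.ker →L[ℝ] Y) 0 := hΘ₀ ▸ hΘs.to_localInverse
  have hleft : ∀ᶠ y in 𝓝 y₀, Sg (Θ y) = y := hΘs.eventually_left_inverse
  have hright : ∀ᶠ q in 𝓝 (0 : W × θ'.ker), Θ (Sg q) = q := hΘ₀ ▸ hΘs.eventually_right_inverse
  have hSgc : Tendsto Sg (𝓝 0) (𝓝 y₀) := hSg0 ▸ hSg.continuousAt
  have hSgd : ∀ᶠ q in 𝓝 (0 : W × θ'.ker), DifferentiableAt ℝ Sg q :=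
    ((hSg.of_le (m := 1) (by simp)).eventually (by simp)).mono fun q hq ↦
      hq.differentiableAt (by simp)
  have hθd : ∀ᶠ y in 𝓝 y₀, DifferentiableAt ℝ θ y :=
    ((hθ.of_le (m := 1) (by simp)).eventually (by simp)).mono fun q hq ↦
      hq.differentiableAt (by simp)
  obtain ⟨δ, hδ, hball⟩ := Metric.eventually_nhds_iff_ball.1
    (((hright.and hSgd).and (hSgc.eventually hθd)).and (hSgc.eventually hrank))
  have hder : ∀ q ∈ Metric.ball (0 : W × θ'.ker) δ, ∃ C : W × θ'.ker →L[ℝ] X,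
      HasFDerivAt (fun q ↦ θ (Sg q)) C q ∧ ∀ b, C (0, b) = 0 := by
    intro q hq
    obtain ⟨⟨⟨-, h2⟩, h3⟩, h4⟩ := hball q hq
    set A := fderiv ℝ θ (Sg q)
    set B := fderiv ℝ Sg q
    have hC : HasFDerivAt (fun q ↦ θ (Sg q)) (A.comp B) q :=
      h3.hasFDerivAt.comp q h2.hasFDerivAt
    have hfst : ∀ v, pr (A (B v)) = v.1 := by
      have h5 : HasFDerivAt (fun q ↦ pr (θ (Sg q) - θ y₀)) (pr.comp (A.comp B)) q :=
        pr.hasFDerivAt.comp q (hC.sub_const _)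
      have h6 : (fun q ↦ pr (θ (Sg q) - θ y₀)) =ᶠ[𝓝 q] Prod.fst := by
        filter_upwards [Metric.isOpen_ball.mem_nhds hq] with q' hq'
        exact congrArg Prod.fst (hball q' hq').1.1.1
      have h7 := (h5.congr_of_eventuallyEq h6.symm).unique hasFDerivAt_fst
      exact fun v ↦ DFunLike.congr_fun h7 v
    refine ⟨A.comp B, hC, fun b ↦ ?_⟩
    -- the projection is injective on the range of `dθ`, because it maps it onto a space of at least
    -- the same dimension
    let R : A.range →ₗ[ℝ] W := pr.toLinearMap.domRestrict _
    have hRs : Function.Surjective R := fun w ↦ ⟨⟨A (B (w, 0)), _, rfl⟩, hfst (w, 0)⟩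
    have hRi : Function.Injective R :=
      (LinearMap.injective_iff_surjective_of_finrank_eq_finrank
        (le_antisymm h4 (LinearMap.finrank_le_finrank_of_surjective hRs))).2 hRs
    have h8 : (⟨A (B (0, b)), _, rfl⟩ : A.range) = 0 := hRi ((hfst (0, b)).trans (map_zero R).symm)
    exact congrArg Subtype.val h8
  -- `θ ∘ Sg` does not depend on the second coordinate, since its derivative in this direction is
  -- zero
  have hconst : ∀ q ∈ Metric.ball (0 : W × θ'.ker) δ, θ (Sg q) = θ (Sg (q.1, 0)) := by
    rintro ⟨w, b⟩ hq
    have hmem : ∀ b' ∈ Metric.ball (0 : θ'.ker) δ, (w, b') ∈ Metric.ball (0 : W × θ'.ker) δ := by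
      intro b' hb'
      rw [mem_ball_zero_iff, Prod.norm_mk, max_lt_iff] at hq ⊢
      exact ⟨hq.1, mem_ball_zero_iff.1 hb'⟩
    have hder' : ∀ b' ∈ Metric.ball (0 : θ'.ker) δ,
        HasFDerivAt (fun b' ↦ θ (Sg (w, b'))) (0 : θ'.ker →L[ℝ] X) b' := by
      intro b' hb'
      obtain ⟨C, hC, hC0⟩ := hder _ (hmem b' hb')
      have h1 := hC.comp b' (hasFDerivAt_prodMk_right w b')
      convert! h1 using 1
      ext v
      exact (hC0 v).symm
    refine Metric.isOpen_ball.is_const_of_fderiv_eq_zero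
      (convex_ball (0 : θ'.ker) δ).isPreconnected
      (f := fun b' ↦ θ (Sg (w, b')))
      (fun b' hb' ↦ (hder' b' hb').differentiableAt.differentiableWithinAt)
      (fun b' hb' ↦ (hder' b' hb').fderiv) ?_ (Metric.mem_ball_self hδ)
    rw [mem_ball_zero_iff, Prod.norm_mk, max_lt_iff] at hq
    exact mem_ball_zero_iff.2 hq.2
  refine ⟨fun w ↦ Sg (w, 0),
    (e.symm : W × θ'.ker →L[ℝ] Y).comp (ContinuousLinearMap.inl ℝ W θ'.ker),
    fun y ↦ (Θ y).1, hSg0, ?_, fun w ↦ ?_, ?_, ?_, ?_⟩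
  · exact HasStrictFDerivAt.comp (g := Sg) 0 hSg'
      (ContinuousLinearMap.inl ℝ W θ'.ker).hasStrictFDerivAt
  · have h1 : Θ' (e.symm (w, 0)) = (w, 0) := e.apply_symm_apply _
    have h2 : pr (θ' (e.symm (w, 0))) = w := congrArg Prod.fst h1
    have h3 := hpr ⟨θ' (e.symm (w, 0)), _, rfl⟩
    rw [h2] at h3
    exact (congrArg Subtype.val h3).symm
  · exact congrArg Prod.fst hΘ₀
  · exact continuousAt_fst.comp hΘ.continuousAt
  · have h1 : ∀ᶠ y in 𝓝 y₀, Θ y ∈ Metric.ball (0 : W × θ'.ker) δ :=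
      hΘ.continuousAt.eventually (by rw [hΘ₀]; exact Metric.ball_mem_nhds _ hδ)
    filter_upwards [hleft, h1] with y hy hy'
    rw [← hconst _ hy', hy]

end ConstantRank

/-! ### Invariant neighbourhoods -/

section InvariantNeighbourhoods

/-- The largest invariant subset of an open set is open, for the action of a compact monoid. -/
theorem isOpen_forall_smul_mem (K : Type*) [Monoid K] [TopologicalSpace K] [CompactSpace K]
    {M : Type*} [TopologicalSpace M] [MulAction K M] [ContinuousSMul K M] {O : Set M}
    (hO : IsOpen O) : IsOpen {y | ∀ k : K, k • y ∈ O} := by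
  rw [isOpen_iff_mem_nhds]
  intro y hy
  have := isCompact_univ.eventually_forall_of_forall_eventually (x₀ := y) (K := (univ : Set K))
    (P := fun y k ↦ k • y ∈ O) (fun k _ ↦
      (continuous_snd.smul continuous_fst).continuousAt.eventually (hO.mem_nhds (hy k)))
  exact this.mono fun z hz k ↦ hz k (mem_univ _)

end InvariantNeighbourhoods

/-! ### The isotropy group in a chart -/

section LocalAction

set_option linter.unusedSectionVars false

variable {m n : ℕ} {G : Type*} [Group G] [TopologicalSpace G]
  [ChartedSpace (EuclideanSpace ℝ (Fin m)) G] [IsManifold (𝓡 m) ∞ G]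
  {M : Type*} [TopologicalSpace M] [ChartedSpace (EuclideanSpace ℝ (Fin n)) M]
  [IsManifold (𝓡 n) ∞ M] [MulAction G M] [ContMDiffSMul (𝓡 m) (𝓡 n) ∞ G M]

/-- The action `G × M → M` in charts is smooth. -/
theorem contDiffAt_chart_smul (g₀ : G) (x x' : M)
    {p : EuclideanSpace ℝ (Fin m) × EuclideanSpace ℝ (Fin n)}
    (hp1 : p.1 ∈ (chartAt (EuclideanSpace ℝ (Fin m)) g₀).target)
    (hp2 : p.2 ∈ (chartAt (EuclideanSpace ℝ (Fin n)) x).target)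
    (hp : (chartAt (EuclideanSpace ℝ (Fin m)) g₀).symm p.1 •
      (chartAt (EuclideanSpace ℝ (Fin n)) x).symm p.2 ∈
        (chartAt (EuclideanSpace ℝ (Fin n)) x').source) :
    ContDiffAt ℝ ∞ (fun p : EuclideanSpace ℝ (Fin m) × EuclideanSpace ℝ (Fin n) ↦
      chartAt (EuclideanSpace ℝ (Fin n)) x' ((chartAt (EuclideanSpace ℝ (Fin m)) g₀).symm p.1 •
        (chartAt (EuclideanSpace ℝ (Fin n)) x).symm p.2)) p := by
  rw [← contMDiffAt_iff_contDiffAt]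
  have h1 := (contMDiffOn_chart_symm (I := 𝓡 m) (n := ∞) (x := g₀)).contMDiffAt
    ((chartAt (EuclideanSpace ℝ (Fin m)) g₀).open_target.mem_nhds hp1)
  have h2 := (contMDiffOn_chart_symm (I := 𝓡 n) (n := ∞) (x := x)).contMDiffAt
    ((chartAt (EuclideanSpace ℝ (Fin n)) x).open_target.mem_nhds hp2)
  have h3 := (contMDiffOn_chart (I := 𝓡 n) (n := ∞) (x := x')).contMDiffAt
    ((chartAt (EuclideanSpace ℝ (Fin n)) x').open_source.mem_nhds hp)
  have h4 := ContMDiffSMul.contMDiff_smul (I := 𝓡 m) (I' := 𝓡 n) (n := ∞) (G := G) (M := M)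
  have h5 := (h1.comp p (contDiff_fst.contMDiff.contMDiffAt)).prodMk
    (h2.comp p (contDiff_snd.contMDiff.contMDiffAt))
  exact h3.comp p (h4.contMDiffAt.comp p h5)

/-- The domain, in the chart around `x`, on which the isotropy group of `x` acts. -/
def isotropyDomain (n : ℕ) (G : Type*) [Group G] {M : Type*} [TopologicalSpace M]
    [ChartedSpace (EuclideanSpace ℝ (Fin n)) M] [MulAction G M] (x : M) :
    Set (EuclideanSpace ℝ (Fin n)) :=
  {z ∈ (chartAt (EuclideanSpace ℝ (Fin n)) x).target | ∀ h : MulAction.stabilizer G x,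
    h • (chartAt (EuclideanSpace ℝ (Fin n)) x).symm z ∈
      (chartAt (EuclideanSpace ℝ (Fin n)) x).source}

/-- The action of the isotropy group of `x` in the chart around `x`. -/
noncomputable def isotropyMap (n : ℕ) {G : Type*} [Group G] {M : Type*} [TopologicalSpace M]
    [ChartedSpace (EuclideanSpace ℝ (Fin n)) M] [MulAction G M] (x : M)
    (h : MulAction.stabilizer G x) (z : EuclideanSpace ℝ (Fin n)) : EuclideanSpace ℝ (Fin n) :=
  chartAt (EuclideanSpace ℝ (Fin n)) x (h • (chartAt (EuclideanSpace ℝ (Fin n)) x).symm z)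

section

variable [IsTopologicalGroup G] [CompactSpace G] [T2Space M] [ContinuousSMul G M] (x : M)

theorem isCompact_stabilizer : CompactSpace (MulAction.stabilizer G x) := by
  have : IsClosed ((MulAction.stabilizer G x : Subgroup G) : Set G) :=
    isClosed_eq (f := fun g : G ↦ g • x) (g := fun _ ↦ x) (by fun_prop) continuous_const
  exact isCompact_iff_compactSpace.1 this.isCompact

theorem isOpen_isotropyDomain : IsOpen (isotropyDomain n G x) := by
  have := isCompact_stabilizer (G := G) x
  exact (chartAt (EuclideanSpace ℝ (Fin n)) x).isOpen_inter_preimage_symm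
    (isOpen_forall_smul_mem _ (chartAt (EuclideanSpace ℝ (Fin n)) x).open_source)

theorem mem_isotropyDomain : chartAt (EuclideanSpace ℝ (Fin n)) x x ∈ isotropyDomain n G x := by
  refine ⟨mem_chart_target _ _, fun h ↦ ?_⟩
  rw [(chartAt (EuclideanSpace ℝ (Fin n)) x).left_inv (mem_chart_source _ _),
    show h • x = x from h.2]
  exact mem_chart_source _ _

theorem symm_isotropyMap {z : EuclideanSpace ℝ (Fin n)} (hz : z ∈ isotropyDomain n G x)
    (h : MulAction.stabilizer G x) :
    (chartAt (EuclideanSpace ℝ (Fin n)) x).symm (isotropyMap n x h z) =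
      h • (chartAt (EuclideanSpace ℝ (Fin n)) x).symm z :=
  (chartAt (EuclideanSpace ℝ (Fin n)) x).left_inv (hz.2 h)

theorem isotropyMap_mul {z : EuclideanSpace ℝ (Fin n)} (hz : z ∈ isotropyDomain n G x)
    (h k : MulAction.stabilizer G x) :
    isotropyMap n x (h * k) z = isotropyMap n x h (isotropyMap n x k z) := by
  conv_rhs => rw [isotropyMap, symm_isotropyMap x hz, ← mul_smul]
  rfl

theorem isotropyMap_self (h : MulAction.stabilizer G x) :
    isotropyMap n x h (chartAt (EuclideanSpace ℝ (Fin n)) x x) =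
      chartAt (EuclideanSpace ℝ (Fin n)) x x := by
  rw [isotropyMap, (chartAt (EuclideanSpace ℝ (Fin n)) x).left_inv (mem_chart_source _ _),
    show h • x = x from h.2]

theorem smoothFamily_isotropyMap : SmoothFamily (EuclideanSpace ℝ (Fin m))
    (isotropyMap n (G := G) x) (isotropyDomain n G x) := by
  intro h₀ z₀ hz₀
  set κ := chartAt (EuclideanSpace ℝ (Fin m)) (h₀ : G)
  have hκ : ContinuousAt (fun h : MulAction.stabilizer G x ↦ κ (h : G)) h₀ :=
    (κ.continuousAt (mem_chart_source _ _)).comp continuous_subtype_val.continuousAt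
  refine ⟨fun h ↦ κ h, fun p ↦ chartAt (EuclideanSpace ℝ (Fin n)) x (κ.symm p.1 •
        (chartAt (EuclideanSpace ℝ (Fin n)) x).symm p.2), hκ, ?_, ?_⟩
  · refine contDiffAt_chart_smul (h₀ : G) x x (mem_chart_target _ _) hz₀.1 ?_
    change κ.symm (κ h₀) • _ ∈ _
    rw [κ.left_inv (mem_chart_source _ _)]
    exact hz₀.2 h₀
  · have : ∀ᶠ p : MulAction.stabilizer G x × EuclideanSpace ℝ (Fin n) in 𝓝 (h₀, z₀),
        (p.1 : G) ∈ κ.source :=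
      (continuous_subtype_val.comp continuous_fst).continuousAt.eventually
        (κ.open_source.mem_nhds (mem_chart_source _ (h₀ : G)))
    filter_upwards [this] with p hp
    rw [κ.left_inv hp]
    rfl

/-- The isotropy representation, in the chart around `x`. -/
noncomputable def isotropyDeriv (n : ℕ) {G : Type*} [Group G] {M : Type*} [TopologicalSpace M]
    [ChartedSpace (EuclideanSpace ℝ (Fin n)) M] [MulAction G M] (x : M)
    (h : MulAction.stabilizer G x) : EuclideanSpace ℝ (Fin n) →L[ℝ] EuclideanSpace ℝ (Fin n) :=
  fderiv ℝ (isotropyMap n x h) (chartAt (EuclideanSpace ℝ (Fin n)) x x)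

theorem hasFDerivAt_isotropyMap {P : Type} [NormedAddCommGroup P] [NormedSpace ℝ P]
    (hs : SmoothFamily P (isotropyMap n (G := G) x) (isotropyDomain n G x))
    (h : MulAction.stabilizer G x) :
    HasFDerivAt (isotropyMap n x h) (isotropyDeriv n x h)
      (chartAt (EuclideanSpace ℝ (Fin n)) x x) :=
  ((hs.contDiffAt h
    (mem_isotropyDomain x)).differentiableAt (by simp)).hasFDerivAt

theorem isotropyDeriv_mul {P : Type} [NormedAddCommGroup P] [NormedSpace ℝ P]
    (hs : SmoothFamily P (isotropyMap n (G := G) x) (isotropyDomain n G x))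
    (h k : MulAction.stabilizer G x) :
    isotropyDeriv n x (h * k) = (isotropyDeriv n x h).comp (isotropyDeriv n x k) := by
  have h1 := hasFDerivAt_isotropyMap x hs k
  have h2 := hasFDerivAt_isotropyMap x hs h
  rw [← isotropyMap_self x k] at h2
  refine HasFDerivAt.fderiv ((h2.comp _ h1).congr_of_eventuallyEq ?_)
  filter_upwards [(isOpen_isotropyDomain (n := n) (G := G) x).mem_nhds (mem_isotropyDomain x)]
    with z hz
  exact isotropyMap_mul x hz h k

theorem isotropyDeriv_one : isotropyDeriv n (G := G) x 1 = ContinuousLinearMap.id ℝ _ := by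
  refine HasFDerivAt.fderiv ((hasFDerivAt_id _).congr_of_eventuallyEq ?_)
  filter_upwards [(isOpen_isotropyDomain (n := n) (G := G) x).mem_nhds (mem_isotropyDomain x)]
    with z hz
  simp only [isotropyMap, one_smul, id]
  exact (chartAt (EuclideanSpace ℝ (Fin n)) x).right_inv hz.1

theorem continuous_isotropyDeriv {P : Type} [NormedAddCommGroup P] [NormedSpace ℝ P]
    (hs : SmoothFamily P (isotropyMap n (G := G) x) (isotropyDomain n G x)) :
    Continuous (isotropyDeriv n (G := G) x) :=
  hs.fderiv.continuousOn.comp_continuous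
    (f := fun h ↦ (h, chartAt (EuclideanSpace ℝ (Fin n)) x x)) (by fun_prop)
    (fun h ↦ ⟨mem_univ _, mem_isotropyDomain x⟩)

/-- The isotropy group of `x` acts orthogonally on the tangent space at `x`. Here `T` is the tangent
space, with the inner product of the Riemannian metric, and `ι` identifies it with the model space
of the chart around `x`. -/
theorem exists_isotropyRep {P : Type} [NormedAddCommGroup P] [NormedSpace ℝ P]
    (hs : SmoothFamily P (isotropyMap n (G := G) x) (isotropyDomain n G x))
    [RiemannianBundle (fun x : M ↦ TangentSpace (𝓡 n) x)] [IsIsometricAction n G M]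
    (hd : ∀ g : G, MDifferentiableAt (𝓡 n) (𝓡 n) (fun y : M ↦ g • y) x) :
    ∃ (T : Type) (_ : NormedAddCommGroup T) (_ : InnerProductSpace ℝ T)
      (ι : EuclideanSpace ℝ (Fin n) ≃L[ℝ] T)
      (D : MulAction.stabilizer G x →* (T ≃ₗᵢ[ℝ] T)),
      ∀ h v, D h (ι v) = ι (isotropyDeriv n x h v) := by
  let ι : EuclideanSpace ℝ (Fin n) ≃ₗ[ℝ] TangentSpace (𝓡 n) x := LinearEquiv.refl ℝ _
  have hfin : FiniteDimensional ℝ (TangentSpace (𝓡 n) x) := ι.finiteDimensional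
  have hinner : ∀ (h : MulAction.stabilizer G x) (v w : EuclideanSpace ℝ (Fin n)),
      inner ℝ (ι (isotropyDeriv n x h v)) (ι (isotropyDeriv n x h w)) = inner ℝ (ι v) (ι w) := by
    intro h v w
    have hx : (h : G) • x = x := h.2
    have h1 : ∀ (y y' : M) (_ : y = y') (a b : EuclideanSpace ℝ (Fin n)),
        inner ℝ (show TangentSpace (𝓡 n) y from a) (show TangentSpace (𝓡 n) y from b) =
        inner ℝ (show TangentSpace (𝓡 n) y' from a) (show TangentSpace (𝓡 n) y' from b) := by
      rintro y _ rfl a b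
      rfl
    have hmd : MDifferentiableAt (𝓡 n) (𝓡 n) (fun y : M ↦ (h : G) • y) x := hd h
    have hm : (mfderiv (𝓡 n) (𝓡 n) (fun y : M ↦ (h : G) • y) x :
        EuclideanSpace ℝ (Fin n) →L[ℝ] EuclideanSpace ℝ (Fin n)) = isotropyDeriv n x h := by
      have h2 : writtenInExtChartAt (𝓡 n) (𝓡 n) x (fun y : M ↦ (h : G) • y) =
          isotropyMap n x h := by
        funext z
        simp only [writtenInExtChartAt, hx, Function.comp, isotropyMap]
        simp only [mfld_simps]
        rfl
      refine hmd.mfderiv.trans ?_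
      rw [h2, isotropyDeriv]
      simp only [mfld_simps]
      exact congrFun (fderivWithin_univ (𝕜 := ℝ) (f := isotropyMap n x h)) _
    have h3 := IsIsometricAction.inner_mfderiv_smul (n := n) (h : G) x v w
    have h4 := h1 x ((h : G) • x) hx.symm (isotropyDeriv n x h v) (isotropyDeriv n x h w)
    refine h4.trans ?_
    rw [← hm]
    exact h3
  let A : MulAction.stabilizer G x → TangentSpace (𝓡 n) x →ₗ[ℝ] TangentSpace (𝓡 n) x := fun h ↦
    ι.toLinearMap ∘ₗ (isotropyDeriv n x h).toLinearMap ∘ₗ ι.symm.toLinearMap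
  have hA : ∀ h k, A (h * k) = A h ∘ₗ A k := by
    intro h k
    refine LinearMap.ext fun v ↦ ?_
    change ι (isotropyDeriv n x (h * k) v) = ι (isotropyDeriv n x h (isotropyDeriv n x k v))
    rw [isotropyDeriv_mul x hs]
    rfl
  have hA1 : A 1 = LinearMap.id := by
    refine LinearMap.ext fun v ↦ ?_
    change ι (isotropyDeriv n x 1 v) = _
    rw [isotropyDeriv_one]
    rfl
  let D : MulAction.stabilizer G x →* (TangentSpace (𝓡 n) x ≃ₗᵢ[ℝ] TangentSpace (𝓡 n) x) :=
    { toFun := fun h ↦ (LinearEquiv.ofLinearMap (A h) (A h⁻¹) (by rw [← hA, mul_inv_cancel, hA1])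
        (by rw [← hA, inv_mul_cancel, hA1])).isometryOfInner (fun v w ↦ hinner h v w)
      map_one' := LinearIsometryEquiv.ext fun v ↦ LinearMap.congr_fun hA1 v
      map_mul' := fun h k ↦ LinearIsometryEquiv.ext fun v ↦ LinearMap.congr_fun (hA h k) v }
  exact ⟨TangentSpace (𝓡 n) x, inferInstance, inferInstance, ι.toContinuousLinearEquiv, D,
    fun h v ↦ rfl⟩

end

end LocalAction

/-! ### Equivariant charts -/

section EquivariantChart

set_option linter.unusedSectionVars false

variable {n : ℕ} {G : Type*} [Group G] [TopologicalSpace G] [IsTopologicalGroup G] [CompactSpace G]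
  {M : Type*} [TopologicalSpace M] [ChartedSpace (EuclideanSpace ℝ (Fin n)) M]
  [IsManifold (𝓡 n) ∞ M] [T2Space M] [MulAction G M] [ContinuousSMul G M]

/-- The family whose average over the isotropy group is an equivariant chart. -/
theorem smoothFamily_linearization (x : M) {P : Type} [NormedAddCommGroup P] [NormedSpace ℝ P]
    (hs : SmoothFamily P (isotropyMap n (G := G) x) (isotropyDomain n G x)) :
    SmoothFamily (P × (EuclideanSpace ℝ (Fin n) →L[ℝ] EuclideanSpace ℝ (Fin n)))
      (fun (k : MulAction.stabilizer G x) z ↦ isotropyDeriv n x k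
        (isotropyMap n x k⁻¹ z - chartAt (EuclideanSpace ℝ (Fin n)) x x))
      (isotropyDomain n G x) := by
  intro k₀ z₀ hz₀
  obtain ⟨κ, Fh, hκ, hF, he⟩ := hs k₀⁻¹ z₀ hz₀
  have hκ' : ContinuousAt (fun k : MulAction.stabilizer G x ↦ κ k⁻¹) k₀ :=
    ContinuousAt.comp (g := κ) hκ continuous_inv.continuousAt
  refine ⟨fun k ↦ (κ k⁻¹, isotropyDeriv n x k), fun p ↦ p.1.2
    (Fh (p.1.1, p.2) - chartAt (EuclideanSpace ℝ (Fin n)) x x),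
    hκ'.prodMk (continuous_isotropyDeriv x hs).continuousAt, ?_, ?_⟩
  · refine ContDiffAt.clm_apply ?_ (ContDiffAt.sub ?_ contDiffAt_const)
    · exact (contDiff_snd.comp contDiff_fst).contDiffAt
    · exact ContDiffAt.comp (g := Fh) _ hF
        ((contDiff_fst.comp contDiff_fst).prodMk contDiff_snd).contDiffAt
  · have hc : ContinuousAt (fun p : MulAction.stabilizer G x × EuclideanSpace ℝ (Fin n) ↦
        (p.1⁻¹, p.2)) (k₀, z₀) :=
      (continuous_fst.inv.prodMk continuous_snd).continuousAt
    filter_upwards [hc.eventually he] with p hp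
    rw [hp]

/-- An equivariant chart around `x` by the tangent space: the chart `ψ` around `x` is replaced by
its average `z ↦ ∫ D(h) (ψ (h⁻¹ z) - ψ x) dh` over the isotropy group, which is equivariant and has
the same derivative at `x`, and the inverse function theorem is applied. -/
theorem exists_equivariant_chart (x : M) {P : Type} [NormedAddCommGroup P] [NormedSpace ℝ P]
    (hs : SmoothFamily P (isotropyMap n (G := G) x) (isotropyDomain n G x))
    {T : Type} [NormedAddCommGroup T] [InnerProductSpace ℝ T] (ι : EuclideanSpace ℝ (Fin n) ≃L[ℝ] T)
    (D : MulAction.stabilizer G x →* (T ≃ₗᵢ[ℝ] T))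
    (hD : ∀ h v, D h (ι v) = ι (isotropyDeriv n x h v)) {O : Set M} (hO : O ∈ 𝓝 x) :
    ∃ (φ : T → EuclideanSpace ℝ (Fin n)) (r : ℝ), 0 < r ∧
      φ 0 = chartAt (EuclideanSpace ℝ (Fin n)) x x ∧
      HasStrictFDerivAt φ (ι.symm : T →L[ℝ] EuclideanSpace ℝ (Fin n)) 0 ∧
      ∀ u ∈ Metric.ball (0 : T) r, ContDiffAt ℝ ∞ φ u ∧ φ u ∈ isotropyDomain n G x ∧
        (chartAt (EuclideanSpace ℝ (Fin n)) x).symm (φ u) ∈ O ∧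
        ∀ h, φ (D h u) = isotropyMap n x h (φ u) := by
  set ψ := chartAt (EuclideanSpace ℝ (Fin n)) x with hψ
  have hcpt := isCompact_stabilizer (G := G) x
  borelize ↥(MulAction.stabilizer G x)
  obtain ⟨μ, hμ1, hμ2, -⟩ := exists_invariant_probability (G := MulAction.stabilizer G x)
  have hΩ := isOpen_isotropyDomain (n := n) (G := G) x
  have hx := mem_isotropyDomain (n := n) (G := G) x
  have hf := smoothFamily_linearization x hs
  set f : MulAction.stabilizer G x → EuclideanSpace ℝ (Fin n) → EuclideanSpace ℝ (Fin n) :=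
    fun k z ↦ isotropyDeriv n x k (isotropyMap n x k⁻¹ z - ψ x) with hfdef
  set Q : EuclideanSpace ℝ (Fin n) → EuclideanSpace ℝ (Fin n) := fun z ↦ ∫ k, f k z ∂μ with hQdef
  have hQs : ∀ z ∈ isotropyDomain n G x, ContDiffAt ℝ ∞ Q z := fun z hz ↦
    (hf.contDiffOn_integral μ hΩ).contDiffAt (hΩ.mem_nhds hz)
  have hQ0 : Q (ψ x) = 0 := by
    simp only [hQdef, hfdef, hψ, isotropyMap_self, sub_self, map_zero, integral_zero]
  have hfd : ∀ k, fderiv ℝ (f k) (ψ x) = ContinuousLinearMap.id ℝ _ := by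
    intro k
    have h1 := (hasFDerivAt_isotropyMap x hs k⁻¹).sub_const (ψ x)
    have h2 := ((isotropyDeriv n x k).hasFDerivAt.comp _ h1).fderiv
    rw [← isotropyDeriv_mul x hs, mul_inv_cancel, isotropyDeriv_one] at h2
    exact h2
  have hQd : HasFDerivAt Q ((ContinuousLinearEquiv.refl ℝ (EuclideanSpace ℝ (Fin n)) :
      EuclideanSpace ℝ (Fin n) ≃L[ℝ] EuclideanSpace ℝ (Fin n)) :
      EuclideanSpace ℝ (Fin n) →L[ℝ] EuclideanSpace ℝ (Fin n)) (ψ x) := by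
    have h1 := hf.hasFDerivAt_integral μ hΩ hx
    have h2 : ∫ k, fderiv ℝ (f k) (ψ x) ∂μ = ContinuousLinearMap.id ℝ _ := by
      simp only [hfd, integral_const, probReal_univ, one_smul]
    rw [h2] at h1
    exact h1
  have hQe : ∀ z ∈ isotropyDomain n G x, ∀ h : MulAction.stabilizer G x,
      Q (isotropyMap n x h z) = isotropyDeriv n x h (Q z) := by
    intro z hz h
    have h1 : ∀ k, f (h * k) (isotropyMap n x h z) = isotropyDeriv n x h (f k z) := by
      intro k
      simp only [hfdef]
      rw [← isotropyMap_mul x hz, mul_inv_rev, inv_mul_cancel_right, isotropyDeriv_mul x hs]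
      rfl
    have h2 : Continuous fun k ↦ f k z :=
      hf.continuousOn.comp_continuous (f := fun k ↦ (k, z)) (by fun_prop)
        (fun k ↦ ⟨mem_univ _, hz⟩)
    simp only [hQdef]
    rw [← integral_mul_left_eq_self _ h]
    simp only [h1]
    exact ContinuousLinearMap.integral_comp_comm _ (integrable_of_continuous μ h2)
  have hQx := hQs _ hx
  set e := hQx.toOpenPartialHomeomorph Q hQd (by simp) with he
  have hex : ψ x ∈ e.source := hQx.mem_toOpenPartialHomeomorph_source hQd (by simp)
  have hecoe : ∀ z, e z = Q z := fun z ↦ rfl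
  have he0 : e.symm 0 = ψ x := by
    rw [← hQ0, ← hecoe]
    exact e.left_inv hex
  have h0t : (0 : EuclideanSpace ℝ (Fin n)) ∈ e.target := by
    rw [← hQ0, ← hecoe]
    exact e.map_source hex
  have hes : HasStrictFDerivAt e.symm (ContinuousLinearMap.id ℝ (EuclideanSpace ℝ (Fin n)))
      0 := by
    have := (hQx.hasStrictFDerivAt' hQd (by simp)).to_localInverse
    rw [hQ0] at this
    exact this
  have hec : Tendsto (fun u : T ↦ e.symm (ι.symm u)) (𝓝 0) (𝓝 (ψ x)) := by
    have h1 : ContinuousAt e.symm (ι.symm 0) := by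
      rw [map_zero]
      exact hes.continuousAt
    have h2 : ContinuousAt (fun u : T ↦ e.symm (ι.symm u)) 0 :=
      ContinuousAt.comp (g := e.symm) h1 ι.symm.continuous.continuousAt
    have h3 : e.symm (ι.symm 0) = ψ x := by rw [map_zero, he0]
    rw [ContinuousAt, h3] at h2
    exact h2
  have hψx : ψ.symm (ψ x) = x := ψ.left_inv (mem_chart_source _ _)
  have hψc : ContinuousAt ψ.symm (ψ x) := ψ.continuousAt_symm (mem_chart_target _ _)
  have hgood : ∀ᶠ z in 𝓝 (ψ x), z ∈ isotropyDomain n G x ∧ ψ.symm z ∈ O ∧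
      (∀ h : MulAction.stabilizer G x, isotropyMap n x h z ∈ e.source) ∧
      ∃ A : EuclideanSpace ℝ (Fin n) ≃L[ℝ] EuclideanSpace ℝ (Fin n),
        (A : EuclideanSpace ℝ (Fin n) →L[ℝ] EuclideanSpace ℝ (Fin n)) = fderiv ℝ Q z := by
    have h1 : ∀ᶠ z in 𝓝 (ψ x), ψ.symm z ∈ O := hψc.eventually (by rw [hψx]; exact hO)
    have h2 : ∀ᶠ z in 𝓝 (ψ x), ψ.symm z ∈ {y : M | ∀ h : MulAction.stabilizer G x, h • y ∈
        ψ.source ∩ ψ ⁻¹' e.source} := by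
      refine hψc.eventually
        ((isOpen_forall_smul_mem _ (ψ.isOpen_inter_preimage e.open_source)).mem_nhds
        fun h ↦ ?_)
      rw [hψx, show h • x = x from h.2]
      exact ⟨mem_chart_source _ _, hex⟩
    have h3 : ∀ᶠ z in 𝓝 (ψ x), fderiv ℝ Q z ∈ range ((↑) :
        (EuclideanSpace ℝ (Fin n) ≃L[ℝ] EuclideanSpace ℝ (Fin n)) →
        EuclideanSpace ℝ (Fin n) →L[ℝ] EuclideanSpace ℝ (Fin n)) := by
      have hc : ContinuousAt (fderiv ℝ Q) (ψ x) :=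
        (hQx.fderiv_right (m := 0) (by simp)).continuousAt
      refine hc.eventually ?_
      rw [hQd.fderiv]
      exact ContinuousLinearEquiv.nhds _
    filter_upwards [hΩ.mem_nhds hx, h1, h2, h3] with z hz1 hz2 hz3 hz4
    exact ⟨hz1, hz2, fun h ↦ (hz3 h).2, hz4⟩
  have htgt : ∀ᶠ u : T in 𝓝 0, ι.symm u ∈ e.target :=
    ι.symm.continuous.continuousAt.eventually (by
      rw [map_zero]; exact e.open_target.mem_nhds h0t)
  obtain ⟨r, hr, hball⟩ := Metric.nhds_basis_ball.mem_iff.1 ((hec.eventually hgood).and htgt)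
  refine ⟨fun u ↦ e.symm (ι.symm u), r, hr, by simp only [map_zero, he0], ?_, fun u hu ↦ ?_⟩
  · have h1 : HasStrictFDerivAt e.symm (ContinuousLinearMap.id ℝ (EuclideanSpace ℝ (Fin n)))
        (ι.symm 0) := by
      rw [map_zero]
      exact hes
    exact h1.comp 0 ι.symm.hasStrictFDerivAt
  · obtain ⟨⟨hu1, hu2, hu3, A, hA⟩, hu4⟩ := hball hu
    refine ⟨?_, hu1, hu2, fun h ↦ ?_⟩
    · have h1 : HasFDerivAt e (A : EuclideanSpace ℝ (Fin n) →L[ℝ] EuclideanSpace ℝ (Fin n))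
          (e.symm (ι.symm u)) := by
        rw [hA]
        exact ((hQs _ hu1).differentiableAt (by simp)).hasFDerivAt
      exact ContDiffAt.comp (g := e.symm) u (e.contDiffAt_symm hu4 h1 (hQs _ hu1))
        ι.symm.contDiff.contDiffAt
    · have h1 : Q (isotropyMap n x h (e.symm (ι.symm u))) = ι.symm (D h u) := by
        rw [hQe _ hu1, ← hecoe, e.right_inv hu4, ContinuousLinearEquiv.eq_symm_apply, ← hD,
          ContinuousLinearEquiv.apply_symm_apply]
      change e.symm (ι.symm (D h u)) = _
      rw [← h1, ← hecoe]
      exact e.left_inv (hu3 h)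

end EquivariantChart

/-! ### The orbit map in charts -/

section LinearSlice

theorem differentiableAt_chart_comp {k : ℕ} {N : Type*} [TopologicalSpace N]
    [ChartedSpace (EuclideanSpace ℝ (Fin k)) N] [IsManifold (𝓡 k) ∞ N] {f : N → N}
    (hf : ContMDiff (𝓡 k) (𝓡 k) ∞ f) (x x' : N) {y : EuclideanSpace ℝ (Fin k)}
    (hy : y ∈ (chartAt (EuclideanSpace ℝ (Fin k)) x).target)
    (hy' : f ((chartAt (EuclideanSpace ℝ (Fin k)) x).symm y) ∈
      (chartAt (EuclideanSpace ℝ (Fin k)) x').source) :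
    DifferentiableAt ℝ (fun y ↦ chartAt (EuclideanSpace ℝ (Fin k)) x'
      (f ((chartAt (EuclideanSpace ℝ (Fin k)) x).symm y))) y := by
  rw [← mdifferentiableAt_iff_differentiableAt]
  exact (mdifferentiableAt_atlas (chart_mem_atlas _ x') hy').comp y
    (((hf _).mdifferentiableAt (by simp)).comp y
      (mdifferentiableAt_atlas_symm (chart_mem_atlas _ x) hy))

/-- An orthogonal representation restricts to an invariant subspace, which is identified with a
Euclidean space by an orthonormal basis. -/
theorem exists_restricted_rep {H : Type*} [Group H] {T : Type*} [NormedAddCommGroup T]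
    [InnerProductSpace ℝ T] [FiniteDimensional ℝ T] (D : H →* (T ≃ₗᵢ[ℝ] T)) (N : Submodule ℝ T)
    (hN : ∀ h, ∀ v ∈ N, D h v ∈ N) :
    ∃ (d : ℕ) (D' : H →* (EuclideanSpace ℝ (Fin d) ≃ₗᵢ[ℝ] EuclideanSpace ℝ (Fin d)))
      (j : EuclideanSpace ℝ (Fin d) →ₗᵢ[ℝ] T), LinearMap.range j.toLinearMap = N ∧
      ∀ h u, j (D' h u) = D h (j u) := by
  let b := (stdOrthonormalBasis ℝ N).repr
  let A : H → N →ₗ[ℝ] N := fun h ↦ (D h).toLinearEquiv.toLinearMap.restrict (hN h)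
  have hA : ∀ h k, A (h * k) = A h ∘ₗ A k := fun h k ↦ LinearMap.ext fun v ↦ Subtype.ext (by
    change D (h * k) v = D h (D k v)
    rw [map_mul]
    rfl)
  have hA1 : A 1 = LinearMap.id := LinearMap.ext fun v ↦ Subtype.ext (by
    change D 1 v = v
    rw [map_one]
    rfl)
  let DN : H →* (N ≃ₗᵢ[ℝ] N) :=
    { toFun := fun h ↦
        { toLinearEquiv := LinearEquiv.ofLinearMap (A h) (A h⁻¹)
            (by rw [← hA, mul_inv_cancel, hA1]) (by rw [← hA, inv_mul_cancel, hA1])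
          norm_map' := fun v ↦ (D h).norm_map v }
      map_one' := LinearIsometryEquiv.ext fun v ↦ LinearMap.congr_fun hA1 v
      map_mul' := fun h k ↦ LinearIsometryEquiv.ext fun v ↦ LinearMap.congr_fun (hA h k) v }
  refine ⟨_, ⟨⟨fun h ↦ (b.symm.trans (DN h)).trans b, ?_⟩, ?_⟩,
    N.subtypeₗᵢ.comp b.symm.toLinearIsometry, ?_, ?_⟩
  · refine LinearIsometryEquiv.ext fun v ↦ ?_
    change b (DN 1 (b.symm v)) = v
    rw [map_one]
    exact b.apply_symm_apply v
  · intro h k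
    refine LinearIsometryEquiv.ext fun v ↦ ?_
    change b (DN (h * k) (b.symm v)) = b (DN h (b.symm (b (DN k (b.symm v)))))
    rw [map_mul, b.symm_apply_apply]
    rfl
  · ext v
    constructor
    · rintro ⟨u, rfl⟩
      exact (b.symm u).2
    · intro hv
      exact ⟨b ⟨v, hv⟩, congrArg Subtype.val (b.symm_apply_apply ⟨v, hv⟩)⟩
  · intro h u
    change ((b.symm (b (DN h (b.symm u))) : N) : T) = D h (b.symm u : N)
    rw [b.symm_apply_apply]
    rfl

set_option linter.unusedSectionVars false

variable {m n : ℕ} {G : Type*} [Group G] [TopologicalSpace G] [IsTopologicalGroup G]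
  [CompactSpace G] [ChartedSpace (EuclideanSpace ℝ (Fin m)) G] [LieGroup (𝓡 m) ∞ G]
  {M : Type*} [TopologicalSpace M] [ChartedSpace (EuclideanSpace ℝ (Fin n)) M]
  [IsManifold (𝓡 n) ∞ M] [T2Space M] [MulAction G M] [ContinuousSMul G M]
  [ContMDiffSMul (𝓡 m) (𝓡 n) ∞ G M]

theorem contMDiff_smul_const (m : ℕ) {n : ℕ} {G : Type*} [Group G] [TopologicalSpace G]
    [ChartedSpace (EuclideanSpace ℝ (Fin m)) G]
    {M : Type*} [TopologicalSpace M] [ChartedSpace (EuclideanSpace ℝ (Fin n)) M]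
    [MulAction G M] [ContMDiffSMul (𝓡 m) (𝓡 n) ∞ G M] (g : G) :
    ContMDiff (𝓡 n) (𝓡 n) ∞ (fun y : M ↦ g • y) :=
  (ContMDiffSMul.contMDiff_smul (I := 𝓡 m) (I' := 𝓡 n) (n := ∞) (G := G) (M := M)).comp
    (contMDiff_const.prodMk contMDiff_id)

variable (m n G) in
/-- The action near `(1, x)`, in the charts around `1` and `x`. -/
noncomputable def chartAction (x : M)
    (p : EuclideanSpace ℝ (Fin m) × EuclideanSpace ℝ (Fin n)) : EuclideanSpace ℝ (Fin n) :=
  chartAt (EuclideanSpace ℝ (Fin n)) x ((chartAt (EuclideanSpace ℝ (Fin m)) (1 : G)).symm p.1 •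
    (chartAt (EuclideanSpace ℝ (Fin n)) x).symm p.2)

variable (m n G) in
/-- The orbit map `g ↦ g x` near `1`, in the charts around `1` and `x`. -/
noncomputable def chartOrbit (x : M) (y : EuclideanSpace ℝ (Fin m)) : EuclideanSpace ℝ (Fin n) :=
  chartAt (EuclideanSpace ℝ (Fin n)) x ((chartAt (EuclideanSpace ℝ (Fin m)) (1 : G)).symm y • x)

variable (x : M)

local notation "κ₁" => chartAt (EuclideanSpace ℝ (Fin m)) (1 : G)
local notation "ψ₁" => chartAt (EuclideanSpace ℝ (Fin n)) x

theorem chartAction_self (y : EuclideanSpace ℝ (Fin m)) :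
    chartAction m n G x (y, ψ₁ x) = chartOrbit m n G x y := by
  rw [chartAction, (ψ₁).left_inv (mem_chart_source _ _), chartOrbit]

theorem chartAction_one {z : EuclideanSpace ℝ (Fin n)} (hz : z ∈ (ψ₁).target) :
    chartAction m n G x (κ₁ 1, z) = z := by
  rw [chartAction, (κ₁).left_inv (mem_chart_source _ _), one_smul, (ψ₁).right_inv hz]

theorem contDiffAt_chartAction {z : EuclideanSpace ℝ (Fin n)} (hz : z ∈ (ψ₁).target) :
    ContDiffAt ℝ ∞ (chartAction m n G x) (κ₁ 1, z) := by
  refine contDiffAt_chart_smul (1 : G) x x (mem_chart_target _ _) hz ?_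
  rw [(κ₁).left_inv (mem_chart_source _ _), one_smul]
  exact (ψ₁).map_target hz

theorem contDiffAt_chartOrbit : ContDiffAt ℝ ∞ (chartOrbit m n G x) (κ₁ 1) := by
  have h1 := contDiffAt_chartAction (m := m) (n := n) (G := G) x (mem_chart_target _ x)
  have h2 : ContDiffAt ℝ ∞ (fun y ↦ chartAction m n G x (y, ψ₁ x)) (κ₁ 1) :=
    ContDiffAt.comp (g := chartAction m n G x) _ h1 (contDiffAt_id.prodMk contDiffAt_const)
  simpa only [chartAction_self] using h2

theorem fderiv_chartAction (v : EuclideanSpace ℝ (Fin m)) (w : EuclideanSpace ℝ (Fin n)) :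
    fderiv ℝ (chartAction m n G x) (κ₁ 1, ψ₁ x) (v, w) =
      fderiv ℝ (chartOrbit m n G x) (κ₁ 1) v + w := by
  have h := ((contDiffAt_chartAction (m := m) (n := n) (G := G) x
    (mem_chart_target _ x)).differentiableAt (by simp)).hasFDerivAt
  have h1 : HasFDerivAt (fun y ↦ chartAction m n G x (y, ψ₁ x)) _ (κ₁ 1) :=
    HasFDerivAt.comp (g := chartAction m n G x) (κ₁ 1) h (hasFDerivAt_prodMk_left (κ₁ 1) (ψ₁ x))
  have h2 : HasFDerivAt (fun z ↦ chartAction m n G x (κ₁ 1, z)) _ (ψ₁ x) :=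
    HasFDerivAt.comp (g := chartAction m n G x) (ψ₁ x) h (hasFDerivAt_prodMk_right (κ₁ 1) (ψ₁ x))
  simp only [chartAction_self] at h1
  have h3 : HasFDerivAt (fun z ↦ chartAction m n G x (κ₁ 1, z)) (ContinuousLinearMap.id ℝ _)
      (ψ₁ x) := by
    refine (hasFDerivAt_id _).congr_of_eventuallyEq ?_
    filter_upwards [(ψ₁).open_target.mem_nhds (mem_chart_target _ x)] with z hz
    exact chartAction_one x hz
  have h4 := DFunLike.congr_fun (h2.unique h3) w
  have h5 := DFunLike.congr_fun h1.fderiv v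
  have h6 : ((v, w) : EuclideanSpace ℝ (Fin m) × EuclideanSpace ℝ (Fin n)) = (v, 0) + (0, w) := by
    simp
  rw [h6, map_add, h5]
  exact congrArg₂ (· + ·) rfl h4

/-- By homogeneity, the rank of the orbit map does not exceed its rank at `1`. -/
theorem finrank_fderiv_chartOrbit_le : ∀ᶠ y in 𝓝 (κ₁ 1),
    Module.finrank ℝ (fderiv ℝ (chartOrbit m n G x) y).range ≤
      Module.finrank ℝ (fderiv ℝ (chartOrbit m n G x) (κ₁ 1)).range := by
  have hκ : Tendsto (κ₁).symm (𝓝 (κ₁ 1)) (𝓝 1) := by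
    have := (κ₁).continuousAt_symm (mem_chart_target _ (1 : G))
    rwa [ContinuousAt, (κ₁).left_inv (mem_chart_source _ _)] at this
  have h1 : ∀ᶠ y in 𝓝 (κ₁ 1), (κ₁).symm y • x ∈ (ψ₁).source := by
    have h2 : Tendsto (fun g : G ↦ g • x) (𝓝 1) (𝓝 x) := by
      have : ContinuousAt (fun g : G ↦ g • x) 1 := by fun_prop
      rwa [ContinuousAt, one_smul] at this
    exact (h2.comp hκ).eventually ((ψ₁).open_source.mem_nhds (mem_chart_source _ x))
  filter_upwards [h1, (κ₁).open_target.mem_nhds (mem_chart_target _ 1)] with y hy hyt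
  set g := (κ₁).symm y with hg
  set A : EuclideanSpace ℝ (Fin n) → EuclideanSpace ℝ (Fin n) := fun z ↦ ψ₁ (g • (ψ₁).symm z)
  set B : EuclideanSpace ℝ (Fin m) → EuclideanSpace ℝ (Fin m) := fun y' ↦
    κ₁ (g⁻¹ * (κ₁).symm y')
  have hψx : (ψ₁).symm (ψ₁ x) = x := (ψ₁).left_inv (mem_chart_source _ _)
  have hBy : B y = κ₁ 1 := by simp only [B, ← hg, inv_mul_cancel]
  have hθ1 : chartOrbit m n G x (κ₁ 1) = ψ₁ x := by
    rw [chartOrbit, (κ₁).left_inv (mem_chart_source _ _), one_smul]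
  have hA : DifferentiableAt ℝ A (chartOrbit m n G x (B y)) := by
    rw [hBy, hθ1]
    exact differentiableAt_chart_comp (contMDiff_smul_const m g) x x (mem_chart_target _ x)
      (by rw [hψx]; exact hy)
  have hB : DifferentiableAt ℝ B y :=
    differentiableAt_chart_comp (contMDiff_mul_left (I := 𝓡 m) (n := ∞) (a := g⁻¹)) 1 1 hyt
      (by rw [← hg, inv_mul_cancel]; exact mem_chart_source _ _)
  have hθ : DifferentiableAt ℝ (chartOrbit m n G x) (B y) := by
    rw [hBy]
    exact (contDiffAt_chartOrbit x).differentiableAt (by simp)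
  have hev : chartOrbit m n G x =ᶠ[𝓝 y] fun y' ↦ A (chartOrbit m n G x (B y')) := by
    have hc : Tendsto (fun y' ↦ g⁻¹ * (κ₁).symm y') (𝓝 y) (𝓝 1) := by
      have : ContinuousAt (fun y' ↦ g⁻¹ * (κ₁).symm y') y :=
        continuousAt_const.mul ((κ₁).continuousAt_symm hyt)
      rwa [ContinuousAt, ← hg, inv_mul_cancel] at this
    have hc2 : Tendsto (fun y' ↦ (g⁻¹ * (κ₁).symm y') • x) (𝓝 y) (𝓝 x) := by
      have h2 : Tendsto (fun g : G ↦ g • x) (𝓝 1) (𝓝 x) := by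
        have : ContinuousAt (fun g : G ↦ g • x) 1 := by fun_prop
        rwa [ContinuousAt, one_smul] at this
      exact h2.comp hc
    filter_upwards [hc.eventually ((κ₁).open_source.mem_nhds (mem_chart_source _ 1)),
      hc2.eventually ((ψ₁).open_source.mem_nhds (mem_chart_source _ x))] with y' h3 h4
    simp only [A, B, chartOrbit]
    rw [(κ₁).left_inv h3, (ψ₁).left_inv h4, smul_smul, mul_inv_cancel_left]
  have hchain := (HasFDerivAt.comp (g := A) y hA.hasFDerivAt
    (HasFDerivAt.comp (g := chartOrbit m n G x) y hθ.hasFDerivAt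
      hB.hasFDerivAt)).congr_of_eventuallyEq hev
  rw [hchain.fderiv, hBy]
  have e1 : ((fderiv ℝ A (chartOrbit m n G x (κ₁ 1))).comp
      ((fderiv ℝ (chartOrbit m n G x) (κ₁ 1)).comp (fderiv ℝ B y))).range ≤
      ((fderiv ℝ (chartOrbit m n G x) (κ₁ 1)).range).map
        (fderiv ℝ A (chartOrbit m n G x (κ₁ 1))).toLinearMap := by
    rintro _ ⟨v, rfl⟩
    exact ⟨_, ⟨_, rfl⟩, rfl⟩
  exact (Submodule.finrank_mono e1).trans (Submodule.finrank_map_le _ _)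

/-- The tangent space of the orbit is invariant under the isotropy group. -/
theorem isotropyDeriv_mem_range {P : Type} [NormedAddCommGroup P] [NormedSpace ℝ P]
    (hs : SmoothFamily P (isotropyMap n (G := G) x) (isotropyDomain n G x))
    (h : MulAction.stabilizer G x) {w : EuclideanSpace ℝ (Fin n)}
    (hw : w ∈ (fderiv ℝ (chartOrbit m n G x) (κ₁ 1)).range) :
    isotropyDeriv n x h w ∈ (fderiv ℝ (chartOrbit m n G x) (κ₁ 1)).range := by
  obtain ⟨v, rfl⟩ := hw
  have hκ : Tendsto (κ₁).symm (𝓝 (κ₁ 1)) (𝓝 1) := by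
    have := (κ₁).continuousAt_symm (mem_chart_target _ (1 : G))
    rwa [ContinuousAt, (κ₁).left_inv (mem_chart_source _ _)] at this
  set C : EuclideanSpace ℝ (Fin m) → EuclideanSpace ℝ (Fin m) := fun y ↦
    κ₁ ((h : G) * (κ₁).symm y * (h : G)⁻¹)
  have hC1 : C (κ₁ 1) = κ₁ 1 := by
    simp only [C]
    rw [(κ₁).left_inv (mem_chart_source _ _), mul_one, mul_inv_cancel]
  have hC : DifferentiableAt ℝ C (κ₁ 1) := by
    refine differentiableAt_chart_comp (f := fun g : G ↦ (h : G) * g * (h : G)⁻¹)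
      ((contMDiff_mul_right (I := 𝓡 m) (n := ∞) (a := (h : G)⁻¹)).comp
        (contMDiff_mul_left (I := 𝓡 m) (n := ∞) (a := (h : G)))) 1 1 (mem_chart_target _ _) ?_
    rw [(κ₁).left_inv (mem_chart_source _ _), mul_one, mul_inv_cancel]
    exact mem_chart_source _ _
  have hθ : DifferentiableAt ℝ (chartOrbit m n G x) (κ₁ 1) :=
    (contDiffAt_chartOrbit x).differentiableAt (by simp)
  have hθ1 : chartOrbit m n G x (κ₁ 1) = ψ₁ x := by
    rw [chartOrbit, (κ₁).left_inv (mem_chart_source _ _), one_smul]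
  have hev : (fun y ↦ isotropyMap n x h (chartOrbit m n G x y)) =ᶠ[𝓝 (κ₁ 1)]
      fun y ↦ chartOrbit m n G x (C y) := by
    have hc : Tendsto (fun y ↦ (h : G) * (κ₁).symm y * (h : G)⁻¹) (𝓝 (κ₁ 1)) (𝓝 1) := by
      have := (tendsto_const_nhds (x := (h : G))).mul hκ |>.mul
        (tendsto_const_nhds (x := (h : G)⁻¹))
      simpa using this
    have h2 : Tendsto (fun g : G ↦ g • x) (𝓝 1) (𝓝 x) := by
      have : ContinuousAt (fun g : G ↦ g • x) 1 := by fun_prop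
      rwa [ContinuousAt, one_smul] at this
    filter_upwards [hc.eventually ((κ₁).open_source.mem_nhds (mem_chart_source _ 1)),
      (h2.comp hκ).eventually ((ψ₁).open_source.mem_nhds (mem_chart_source _ x))] with y h3 h4
    replace h4 : (κ₁).symm y • x ∈ (ψ₁).source := h4
    simp only [isotropyMap, C, chartOrbit]
    rw [(κ₁).left_inv h3, (ψ₁).left_inv h4, mul_smul, mul_smul,
      show (h : G)⁻¹ • x = x from inv_smul_eq_iff.2 h.2.symm]
    rfl
  have hi := hasFDerivAt_isotropyMap x hs h
  rw [← hθ1] at hi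
  have h1 : HasFDerivAt (fun y ↦ isotropyMap n x h (chartOrbit m n G x y)) _ (κ₁ 1) :=
    HasFDerivAt.comp (g := isotropyMap n x h) _ hi hθ.hasFDerivAt
  rw [← hC1] at hθ
  have h2 : HasFDerivAt (fun y ↦ chartOrbit m n G x (C y)) _ (κ₁ 1) :=
    HasFDerivAt.comp (g := chartOrbit m n G x) _ hθ.hasFDerivAt hC.hasFDerivAt
  have h3 := h1.unique (h2.congr_of_eventuallyEq hev)
  rw [hC1] at h3
  exact ⟨_, (DFunLike.congr_fun h3 v).symm⟩

end LinearSlice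

/-! ### Linear slices -/

section Slice

set_option linter.unusedSectionVars false

/-- A slice at `x`, in the chart around `x`: a smooth map `φ` from a ball in an orthogonal
representation of the isotropy group of `x` to the chart, which is equivariant and whose derivative
at `0` is an isomorphism onto a complement of the tangent space of the orbit. -/
structure LinearSlice (m n : ℕ) (G : Type*) [Group G] [TopologicalSpace G]
    [ChartedSpace (EuclideanSpace ℝ (Fin m)) G] {M : Type*} [TopologicalSpace M]
    [ChartedSpace (EuclideanSpace ℝ (Fin n)) M] [MulAction G M] (x : M) where
  /-- The dimension of the slice. -/
  dim : ℕ
  /-- The slice representation. -/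
  rep : MulAction.stabilizer G x →*
    (EuclideanSpace ℝ (Fin dim) ≃ₗᵢ[ℝ] EuclideanSpace ℝ (Fin dim))
  continuous_rep : ∀ u, Continuous fun h ↦ rep h u
  /-- The radius of the slice. -/
  radius : ℝ
  radius_pos : 0 < radius
  /-- The slice, in the chart around `x`. -/
  φ : EuclideanSpace ℝ (Fin dim) → EuclideanSpace ℝ (Fin n)
  map_zero : φ 0 = chartAt (EuclideanSpace ℝ (Fin n)) x x
  /-- The derivative of the slice at `0`. -/
  deriv : EuclideanSpace ℝ (Fin dim) →L[ℝ] EuclideanSpace ℝ (Fin n)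
  hasStrictFDerivAt : HasStrictFDerivAt φ deriv 0
  eq_zero_of_add_eq_zero : ∀ v u, fderiv ℝ (chartOrbit m n G x)
    (chartAt (EuclideanSpace ℝ (Fin m)) (1 : G) 1) v + deriv u = 0 → u = 0
  exists_add_eq : ∀ z, ∃ v u, fderiv ℝ (chartOrbit m n G x)
    (chartAt (EuclideanSpace ℝ (Fin m)) (1 : G) 1) v + deriv u = z
  contDiffAt : ∀ u ∈ Metric.ball 0 radius, ContDiffAt ℝ ∞ φ u
  mem_isotropyDomain : ∀ u ∈ Metric.ball 0 radius, φ u ∈ isotropyDomain n G x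
  map_rep : ∀ u ∈ Metric.ball 0 radius, ∀ h, φ (rep h u) = isotropyMap n x h (φ u)

variable {m n : ℕ} {G : Type*} [Group G] [TopologicalSpace G] [IsTopologicalGroup G]
  [CompactSpace G] [ChartedSpace (EuclideanSpace ℝ (Fin m)) G] [LieGroup (𝓡 m) ∞ G]
  {M : Type*} [TopologicalSpace M] [ChartedSpace (EuclideanSpace ℝ (Fin n)) M]
  [IsManifold (𝓡 n) ∞ M] [T2Space M] [MulAction G M] [ContinuousSMul G M]
  [ContMDiffSMul (𝓡 m) (𝓡 n) ∞ G M]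

/-- Linear slices exist: restrict an equivariant chart to the orthogonal complement of the tangent
space of the orbit. -/
theorem exists_linearSlice [RiemannianBundle (fun x : M ↦ TangentSpace (𝓡 n) x)]
    [IsIsometricAction n G M] (x : M) {O : Set M} (hO : O ∈ 𝓝 x) :
    ∃ L : LinearSlice m n G x, ∀ u ∈ Metric.ball 0 L.radius,
      (chartAt (EuclideanSpace ℝ (Fin n)) x).symm (L.φ u) ∈ O := by
  have hs := smoothFamily_isotropyMap (m := m) (n := n) (G := G) x
  obtain ⟨T, i1, i2, ι, D, hD⟩ := exists_isotropyRep (n := n) x hs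
    (fun g ↦ (contMDiff_smul_const m g x).mdifferentiableAt (by simp))
  obtain ⟨φ, r, hr, hφ0, hφd, hφ⟩ := exists_equivariant_chart x hs ι D hD hO
  have : FiniteDimensional ℝ T := ι.toLinearEquiv.finiteDimensional
  set θ' := fderiv ℝ (chartOrbit m n G x) (chartAt (EuclideanSpace ℝ (Fin m)) (1 : G) 1) with hθ'
  set W : Submodule ℝ T := θ'.range.map ι.toLinearEquiv.toLinearMap with hW
  have hWD : ∀ h, ∀ w ∈ W, D h w ∈ W := by
    rintro h _ ⟨w, hw, rfl⟩
    exact ⟨isotropyDeriv n x h w, isotropyDeriv_mem_range x hs h hw, (hD h w).symm⟩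
  have hND : ∀ h, ∀ v ∈ Wᗮ, D h v ∈ Wᗮ := by
    intro h v hv
    rw [Submodule.mem_orthogonal] at hv ⊢
    intro w hw
    have h1 : D h⁻¹ (D h v) = v := by
      change (D h⁻¹ * D h) v = v
      rw [← map_mul, inv_mul_cancel, map_one]
      rfl
    rw [← hv _ (hWD h⁻¹ w hw), ← (D h⁻¹).inner_map_map, h1]
  obtain ⟨d, D', j, hj, hjD⟩ := exists_restricted_rep D Wᗮ hND
  have hjN : ∀ u, j u ∈ Wᗮ := fun u ↦ by rw [← hj]; exact ⟨u, rfl⟩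
  have hjball : ∀ u ∈ Metric.ball (0 : EuclideanSpace ℝ (Fin d)) r,
      j u ∈ Metric.ball (0 : T) r := by
    intro u hu
    rwa [mem_ball_zero_iff, j.norm_map, ← mem_ball_zero_iff]
  have hDc : ∀ u, Continuous fun h ↦ D' h u := by
    intro u
    rw [j.isometry.isEmbedding.isInducing.continuous_iff]
    have : (j ∘ fun h ↦ D' h u) = fun h ↦ ι (isotropyDeriv n x h (ι.symm (j u))) := by
      funext h
      rw [← hD, ι.apply_symm_apply, ← hjD]
      rfl
    rw [this]
    exact ι.continuous.comp ((continuous_isotropyDeriv x hs).clm_apply continuous_const)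
  refine ⟨⟨d, D', hDc, r, hr, fun u ↦ φ (j u), by rw [map_zero, hφ0],
    (ι.symm : T →L[ℝ] EuclideanSpace ℝ (Fin n)).comp j.toContinuousLinearMap, ?_, ?_, ?_,
    fun u hu ↦ ?_, fun u hu ↦ ?_, fun u hu h ↦ ?_⟩, fun u hu ↦ (hφ _ (hjball u hu)).2.2.1⟩
  · have h1 : HasStrictFDerivAt φ (ι.symm : T →L[ℝ] EuclideanSpace ℝ (Fin n))
        (j.toContinuousLinearMap 0) := by
      rw [map_zero]
      exact hφd
    exact h1.comp 0 j.toContinuousLinearMap.hasStrictFDerivAt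
  · intro v u h
    have h1 : ι (θ' v) + j u = 0 := by
      have := congrArg ι h
      rw [map_add, map_zero] at this
      rw [← this]
      exact congrArg _ (ι.apply_symm_apply _).symm
    have h2 : ι (θ' v) ∈ W := ⟨θ' v, ⟨v, rfl⟩, rfl⟩
    have h3 := Submodule.inner_right_of_mem_orthogonal h2 (hjN u)
    rw [eq_neg_of_add_eq_zero_left h1, inner_neg_left, neg_eq_zero, inner_self_eq_zero] at h3
    exact j.injective (by rw [h3, map_zero])
  · intro z
    have h1 : ι z ∈ W ⊔ Wᗮ := by
      rw [Submodule.sup_orthogonal_of_hasOrthogonalProjection]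
      trivial
    obtain ⟨_, ⟨_, ⟨v, rfl⟩, rfl⟩, w', hw', h2⟩ := Submodule.mem_sup.1 h1
    rw [← hj] at hw'
    obtain ⟨u, rfl⟩ := hw'
    refine ⟨v, u, ι.injective ?_⟩
    rw [map_add, ← h2]
    exact congrArg _ (ι.apply_symm_apply _)
  · exact ContDiffAt.comp (g := φ) u (hφ _ (hjball u hu)).1 j.contDiff.contDiffAt
  · exact (hφ _ (hjball u hu)).2.1
  · rw [hjD]
    exact (hφ _ (hjball u hu)).2.2.2 h

namespace LinearSlice

variable {x : M} (L : LinearSlice m n G x)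

local notation "θ₁" => fderiv ℝ (chartOrbit m n G x) (chartAt (EuclideanSpace ℝ (Fin m)) (1 : G) 1)

/-- The slice in `M`. -/
noncomputable def embed (u : EuclideanSpace ℝ (Fin L.dim)) : M :=
  (chartAt (EuclideanSpace ℝ (Fin n)) x).symm (L.φ u)

theorem embed_zero : L.embed 0 = x := by
  rw [embed, L.map_zero, (chartAt (EuclideanSpace ℝ (Fin n)) x).left_inv (mem_chart_source _ _)]

theorem zero_mem_ball : (0 : EuclideanSpace ℝ (Fin L.dim)) ∈ Metric.ball 0 L.radius :=
  Metric.mem_ball_self L.radius_pos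

theorem rep_mem_ball {r : ℝ} (h : MulAction.stabilizer G x) {u : EuclideanSpace ℝ (Fin L.dim)}
    (hu : u ∈ Metric.ball 0 r) : L.rep h u ∈ Metric.ball 0 r := by
  rwa [mem_ball_zero_iff, LinearIsometryEquiv.norm_map, ← mem_ball_zero_iff]

theorem mem_target {u : EuclideanSpace ℝ (Fin L.dim)} (hu : u ∈ Metric.ball 0 L.radius) :
    L.φ u ∈ (chartAt (EuclideanSpace ℝ (Fin n)) x).target := (L.mem_isotropyDomain u hu).1

theorem embed_mem_source {u : EuclideanSpace ℝ (Fin L.dim)} (hu : u ∈ Metric.ball 0 L.radius) :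
    L.embed u ∈ (chartAt (EuclideanSpace ℝ (Fin n)) x).source :=
  (chartAt (EuclideanSpace ℝ (Fin n)) x).map_target (L.mem_target hu)

theorem chart_embed {u : EuclideanSpace ℝ (Fin L.dim)} (hu : u ∈ Metric.ball 0 L.radius) :
    chartAt (EuclideanSpace ℝ (Fin n)) x (L.embed u) = L.φ u :=
  (chartAt (EuclideanSpace ℝ (Fin n)) x).right_inv (L.mem_target hu)

theorem smul_embed {u : EuclideanSpace ℝ (Fin L.dim)} (hu : u ∈ Metric.ball 0 L.radius)
    (h : MulAction.stabilizer G x) : (h : G) • L.embed u = L.embed (L.rep h u) := by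
  rw [embed, embed, L.map_rep u hu, symm_isotropyMap x (L.mem_isotropyDomain u hu)]
  rfl

theorem continuousAt_embed {u : EuclideanSpace ℝ (Fin L.dim)}
    (hu : u ∈ Metric.ball 0 L.radius) : ContinuousAt L.embed u :=
  ContinuousAt.comp (g := (chartAt (EuclideanSpace ℝ (Fin n)) x).symm)
    ((chartAt (EuclideanSpace ℝ (Fin n)) x).continuousAt_symm (L.mem_target hu))
    (L.contDiffAt u hu).continuousAt

theorem contMDiffAt_embed {u : EuclideanSpace ℝ (Fin L.dim)}
    (hu : u ∈ Metric.ball 0 L.radius) : ContMDiffAt (𝓡 L.dim) (𝓡 n) ∞ L.embed u :=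
  ((contMDiffOn_chart_symm (I := 𝓡 n) (n := ∞) (x := x)).contMDiffAt
    ((chartAt (EuclideanSpace ℝ (Fin n)) x).open_target.mem_nhds (L.mem_target hu))).comp u
    (L.contDiffAt u hu).contMDiffAt

/-- The map `(g, u) ↦ g φ(u)` is, restricted to a slice of the orbit map, injective near
`(1, 0)`. -/
theorem exists_injOn {S : (θ₁).range → EuclideanSpace ℝ (Fin m)}
    {S' : (θ₁).range →L[ℝ] EuclideanSpace ℝ (Fin m)}
    (hS0 : S 0 = chartAt (EuclideanSpace ℝ (Fin m)) (1 : G) 1) (hS : HasStrictFDerivAt S S' 0)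
    (hS' : ∀ w, θ₁ (S' w) = w) :
    ∃ U ∈ 𝓝 (0 : (θ₁).range × EuclideanSpace ℝ (Fin L.dim)),
      InjOn (fun p ↦ chartAction m n G x (S p.1, L.φ p.2)) U := by
  let B : (θ₁).range × EuclideanSpace ℝ (Fin L.dim) →L[ℝ] EuclideanSpace ℝ (Fin n) :=
    (θ₁).range.subtypeL.comp (ContinuousLinearMap.fst ℝ _ _) +
      L.deriv.comp (ContinuousLinearMap.snd ℝ _ _)
  have hB : ∀ w u, B (w, u) = w + L.deriv u := fun w u ↦ rfl
  have hBinj : Function.Injective B := by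
    rw [injective_iff_map_eq_zero]
    rintro ⟨⟨_, v, rfl⟩, u⟩ h
    rw [hB] at h
    have hu := L.eq_zero_of_add_eq_zero v u h
    subst hu
    rw [_root_.map_zero, add_zero] at h
    exact Prod.ext (Subtype.ext h) rfl
  have hBsurj : Function.Surjective B := by
    intro z
    obtain ⟨v, u, h⟩ := L.exists_add_eq z
    exact ⟨(⟨_, v, rfl⟩, u), h⟩
  let e := (LinearEquiv.ofBijective B.toLinearMap ⟨hBinj, hBsurj⟩).toContinuousLinearEquiv
  have he : (e : (θ₁).range × EuclideanSpace ℝ (Fin L.dim) →L[ℝ] EuclideanSpace ℝ (Fin n)) = B :=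
    ContinuousLinearMap.ext fun _ ↦ rfl
  have hd : HasStrictFDerivAt (fun p : (θ₁).range × EuclideanSpace ℝ (Fin L.dim) ↦
      chartAction m n G x (S p.1, L.φ p.2))
      (e : (θ₁).range × EuclideanSpace ℝ (Fin L.dim) →L[ℝ] EuclideanSpace ℝ (Fin n)) 0 := by
    have h1 : HasStrictFDerivAt (fun p : (θ₁).range × EuclideanSpace ℝ (Fin L.dim) ↦
        (S p.1, L.φ p.2)) _ 0 :=
      (HasStrictFDerivAt.comp (g := S) (f := Prod.fst)
        (0 : (θ₁).range × EuclideanSpace ℝ (Fin L.dim))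
        hS hasStrictFDerivAt_fst).prodMk
      (HasStrictFDerivAt.comp (g := L.φ) (f := Prod.snd)
        (0 : (θ₁).range × EuclideanSpace ℝ (Fin L.dim)) L.hasStrictFDerivAt hasStrictFDerivAt_snd)
    have h2 := (contDiffAt_chartAction (m := m) (n := n) (G := G) x
      (mem_chart_target _ x)).hasStrictFDerivAt (by simp)
    have h3 : (S (0 : (θ₁).range × EuclideanSpace ℝ (Fin L.dim)).1,
        L.φ (0 : (θ₁).range × EuclideanSpace ℝ (Fin L.dim)).2) =
        (chartAt (EuclideanSpace ℝ (Fin m)) (1 : G) 1, chartAt (EuclideanSpace ℝ (Fin n)) x x) :=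
      Prod.ext hS0 L.map_zero
    rw [← h3] at h2
    refine (HasStrictFDerivAt.comp (g := chartAction m n G x)
      (0 : (θ₁).range × EuclideanSpace ℝ (Fin L.dim)) h2 h1).congr_fderiv ?_
    rw [he, h3]
    refine ContinuousLinearMap.ext fun p ↦ ?_
    change fderiv ℝ (chartAction m n G x) _ (S' p.1, L.deriv p.2) = _
    rw [fderiv_chartAction, hS']
    rfl
  refine ⟨(hd.toOpenPartialHomeomorph _).source, (hd.toOpenPartialHomeomorph _).open_source.mem_nhds
    hd.mem_toOpenPartialHomeomorph_source, ?_⟩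
  exact (hd.toOpenPartialHomeomorph _).injOn

/-- The slice is embedded near `0`, and an element `g` of `G` close to `1` which maps a point of a
small slice to the slice fixes `x`: by the constant rank theorem `g x = s x` for an element `s` of a
slice of the orbit map, so that `h = s⁻¹ g` fixes `x`. Then `s` maps a point of the slice to the
slice, and `s = 1` by injectivity. -/
theorem eventually_mem_stabilizer_of_near_one :
    (∃ U ∈ 𝓝 (0 : EuclideanSpace ℝ (Fin L.dim)), InjOn L.embed U) ∧
    ∀ᶠ p : G × EuclideanSpace ℝ (Fin L.dim) × EuclideanSpace ℝ (Fin L.dim) in 𝓝 (1, 0, 0),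
      p.1 • L.embed p.2.1 = L.embed p.2.2 → p.1 ∈ MulAction.stabilizer G x := by
  set κ := chartAt (EuclideanSpace ℝ (Fin m)) (1 : G) with hκdef
  set ψ := chartAt (EuclideanSpace ℝ (Fin n)) x with hψdef
  obtain ⟨S, S', q, hS0, hS, hS', hq0, hqc, hq⟩ := exists_slice_of_finrank_le
    (contDiffAt_chartOrbit (m := m) (n := n) (G := G) x) (finrank_fderiv_chartOrbit_le x)
  obtain ⟨U, hU, hinj⟩ := L.exists_injOn hS0 hS hS'
  obtain ⟨ε, hε, hball⟩ := Metric.nhds_basis_ball.mem_iff.1 hU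
  have hκ1 : κ.symm (κ 1) = 1 := κ.left_inv (mem_chart_source _ _)
  have hball' : ∀ w u, ‖w‖ < ε → ‖u‖ < ε → (w, u) ∈ U := fun w u hw hu ↦ hball (by
    rw [mem_ball_zero_iff, Prod.norm_mk, max_lt_iff]
    exact ⟨hw, hu⟩)
  have hact : ∀ u ∈ Metric.ball 0 L.radius, chartAction m n G x (S 0, L.φ u) = L.φ u := by
    intro u hu
    rw [hS0]
    exact chartAction_one x (L.mem_target hu)
  refine ⟨⟨Metric.ball 0 (min ε L.radius), Metric.ball_mem_nhds _ (lt_min hε L.radius_pos), ?_⟩, ?_⟩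
  · intro u hu u' hu' h
    rw [mem_ball_zero_iff, lt_min_iff] at hu hu'
    have h0 : ‖(0 : (fderiv ℝ (chartOrbit m n G x) (κ 1)).range)‖ < ε := by rwa [norm_zero]
    have h1 := hinj (hball' 0 u h0 hu.1) (hball' 0 u' h0 hu'.1) (by
      change chartAction m n G x (S 0, L.φ u) = chartAction m n G x (S 0, L.φ u')
      rw [hact u (mem_ball_zero_iff.2 hu.2), hact u' (mem_ball_zero_iff.2 hu'.2),
        ← L.chart_embed (mem_ball_zero_iff.2 hu.2), ← L.chart_embed (mem_ball_zero_iff.2 hu'.2), h])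
    exact congrArg Prod.snd h1
  · have hκc : Tendsto κ (𝓝 1) (𝓝 (κ 1)) := κ.continuousAt (mem_chart_source _ _)
    have hsc : Tendsto (fun g ↦ κ.symm (S (q (κ g)))) (𝓝 1) (𝓝 1) := by
      have h1 : Tendsto (fun g ↦ q (κ g)) (𝓝 1) (𝓝 0) := by
        have := hqc.tendsto.comp hκc
        rwa [hq0] at this
      have h2 := hS.continuousAt.tendsto.comp h1
      rw [hS0] at h2
      have h3 := (κ.continuousAt_symm (mem_chart_target _ (1 : G))).tendsto.comp h2
      rwa [hκ1] at h3
    have hqc' : Tendsto (fun g ↦ q (κ g)) (𝓝 1) (𝓝 0) := by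
      have := hqc.tendsto.comp hκc
      rwa [hq0] at this
    have hx : Tendsto (fun g : G ↦ g • x) (𝓝 1) (𝓝 x) := by
      have : ContinuousAt (fun g : G ↦ g • x) 1 := by fun_prop
      rwa [ContinuousAt, one_smul] at this
    have hψs : ψ.source ∈ 𝓝 x := ψ.open_source.mem_nhds (mem_chart_source _ x)
    have hg : ∀ᶠ g in 𝓝 (1 : G), g ∈ κ.source ∧ g • x ∈ ψ.source ∧
        chartOrbit m n G x (κ g) = chartOrbit m n G x (S (q (κ g))) ∧
        κ.symm (S (q (κ g))) • x ∈ ψ.source ∧ ‖q (κ g)‖ < ε := by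
      filter_upwards [κ.open_source.mem_nhds (mem_chart_source _ 1), hx.eventually hψs,
        hκc.eventually hq, (hx.comp hsc).eventually hψs,
        hqc'.eventually (Metric.ball_mem_nhds _ hε)] with g h1 h2 h3 h4 h5
      exact ⟨h1, h2, h3, h4, mem_ball_zero_iff.1 h5⟩
    have hu : ∀ᶠ p : EuclideanSpace ℝ (Fin L.dim) × EuclideanSpace ℝ (Fin L.dim) in 𝓝 (0, 0),
        p.1 ∈ Metric.ball 0 (min ε L.radius) ∧ p.2 ∈ Metric.ball 0 (min ε L.radius) := by
      have h1 := Metric.ball_mem_nhds (0 : EuclideanSpace ℝ (Fin L.dim)) (lt_min hε L.radius_pos)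
      rw [nhds_prod_eq]
      exact Filter.prod_mem_prod h1 h1
    rw [nhds_prod_eq]
    filter_upwards [hg.prod_mk hu] with p hp heq
    obtain ⟨⟨hp1, hp2, hp3, hp4, hp5⟩, hp6, hp7⟩ := hp
    obtain ⟨g, u, u'⟩ := p
    simp only at *
    rw [mem_ball_zero_iff, lt_min_iff] at hp6 hp7
    have hu6 := mem_ball_zero_iff.2 hp6.2
    have hu7 := mem_ball_zero_iff.2 hp7.2
    set s := κ.symm (S (q (κ g))) with hs
    have hgs : g • x = s • x := by
      have h1 : ψ (κ.symm (κ g) • x) = ψ (s • x) := hp3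
      rw [κ.left_inv hp1] at h1
      exact ψ.injOn hp2 hp4 h1
    have hmem : s⁻¹ * g ∈ MulAction.stabilizer G x := by
      rw [MulAction.mem_stabilizer_iff, mul_smul, hgs, inv_smul_smul]
    set h : MulAction.stabilizer G x := ⟨s⁻¹ * g, hmem⟩ with hh
    have hgh : g = s * (h : G) := by simp [hh]
    have h2 : s • L.embed (L.rep h u) = L.embed u' := by
      rw [← L.smul_embed hu6, ← heq, smul_smul, ← hgh]
    have h3 := hinj (hball' (q (κ g)) (L.rep h u) hp5
      (by rw [LinearIsometryEquiv.norm_map]; exact hp6.1))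
      (hball' 0 u' (by rwa [norm_zero]) hp7.1) (by
      change chartAction m n G x (S (q (κ g)), L.φ (L.rep h u)) = chartAction m n G x (S 0, L.φ u')
      rw [hact u' hu7, ← L.chart_embed hu7, ← h2]
      rfl)
    have h4 : q (κ g) = 0 := congrArg Prod.fst h3
    rw [h4, hS0] at hs
    rw [hgh, hs]
    have : κ.symm (κ 1) * (h : G) = h := by rw [hκ1, one_mul]
    rw [this]
    exact h.2

end LinearSlice

end Slice

/-! ### The slice theorem -/

section Submersion

/-- Surjectivity is an open condition on the linear maps to a finite-dimensional space. -/
theorem eventually_surjective {E F : Type*} [NormedAddCommGroup E] [NormedSpace ℝ E]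
    [NormedAddCommGroup F] [NormedSpace ℝ F] [FiniteDimensional ℝ F] {A : E →L[ℝ] F}
    (hA : Function.Surjective A) : ∀ᶠ B : E →L[ℝ] F in 𝓝 A, Function.Surjective B := by
  obtain ⟨R, hR⟩ := A.toLinearMap.exists_rightInverse_of_surjective (LinearMap.range_eq_top.2 hA)
  let R' : F →L[ℝ] E := LinearMap.toContinuousLinearMap R
  have h1 : A.comp R' = ((ContinuousLinearEquiv.refl ℝ F : F ≃L[ℝ] F) : F →L[ℝ] F) :=
    ContinuousLinearMap.ext fun v ↦ LinearMap.congr_fun hR v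
  have h2 : Continuous fun B : E →L[ℝ] F ↦ B.comp R' := continuous_id.clm_comp continuous_const
  have h3 : ∀ᶠ B : E →L[ℝ] F in 𝓝 A, B.comp R' ∈ range ((↑) : (F ≃L[ℝ] F) → F →L[ℝ] F) := by
    refine h2.continuousAt.eventually ?_
    change range _ ∈ 𝓝 (A.comp R')
    rw [h1]
    exact ContinuousLinearEquiv.nhds _
  filter_upwards [h3] with B hB
  obtain ⟨e, he⟩ := hB
  intro z
  refine ⟨R' (e.symm z), ?_⟩
  have := DFunLike.congr_fun he (e.symm z)
  exact this.symm.trans (e.apply_symm_apply z)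

theorem surjective_mfderiv_smul (m : ℕ) {n : ℕ} {G : Type*} [Group G] [TopologicalSpace G]
    [ChartedSpace (EuclideanSpace ℝ (Fin m)) G]
    {M : Type*} [TopologicalSpace M] [ChartedSpace (EuclideanSpace ℝ (Fin n)) M]
    [MulAction G M] [ContMDiffSMul (𝓡 m) (𝓡 n) ∞ G M] (g : G) (x : M) :
    Function.Surjective (mfderiv (𝓡 n) (𝓡 n) (fun y : M ↦ g • y) x) := by
  have hd : ∀ (g : G) (y : M), MDifferentiableAt (𝓡 n) (𝓡 n) (fun y : M ↦ g • y) y := fun g y ↦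
    (contMDiff_smul_const m g).mdifferentiableAt (by simp)
  have h1 := mfderiv_comp (g • x) (f := fun y : M ↦ g⁻¹ • y) (g := fun y : M ↦ g • y)
    (hd g _) (hd g⁻¹ _)
  have h2 : ((fun y : M ↦ g • y) ∘ fun y : M ↦ g⁻¹ • y) = id := by
    funext y
    simp
  rw [h2, mfderiv_id] at h1
  have h3 : ∀ (y : M) (_ : y = x) (f' : EuclideanSpace ℝ (Fin n) →L[ℝ] EuclideanSpace ℝ (Fin n)),
      ((mfderiv (𝓡 n) (𝓡 n) (fun y : M ↦ g • y) y :
        EuclideanSpace ℝ (Fin n) →L[ℝ] EuclideanSpace ℝ (Fin n)).comp f' =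
        ContinuousLinearMap.id ℝ _) → Function.Surjective (mfderiv (𝓡 n) (𝓡 n)
          (fun y : M ↦ g • y) x) := by
    rintro y rfl f' h z
    exact ⟨f' z, DFunLike.congr_fun h z⟩
  exact h3 (g⁻¹ • g • x) (inv_smul_smul g x) _ h1.symm

set_option linter.unusedSectionVars false

variable {m n : ℕ} {G : Type*} [Group G] [TopologicalSpace G] [IsTopologicalGroup G]
  [CompactSpace G] [ChartedSpace (EuclideanSpace ℝ (Fin m)) G] [LieGroup (𝓡 m) ∞ G]
  {M : Type*} [TopologicalSpace M] [ChartedSpace (EuclideanSpace ℝ (Fin n)) M]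
  [IsManifold (𝓡 n) ∞ M] [T2Space M] [MulAction G M] [ContinuousSMul G M]
  [ContMDiffSMul (𝓡 m) (𝓡 n) ∞ G M]

namespace LinearSlice

variable {x : M} (L : LinearSlice m n G x)

local notation "κ₁" => chartAt (EuclideanSpace ℝ (Fin m)) (1 : G)
local notation "ψ₁" => chartAt (EuclideanSpace ℝ (Fin n)) x

theorem contDiffAt_chartAction_φ {u : EuclideanSpace ℝ (Fin L.dim)}
    (hu : u ∈ Metric.ball 0 L.radius) :
    ContDiffAt ℝ ∞ (fun p : EuclideanSpace ℝ (Fin m) × EuclideanSpace ℝ (Fin L.dim) ↦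
      chartAction m n G x (p.1, L.φ p.2)) (κ₁ 1, u) :=
  ContDiffAt.comp (g := chartAction m n G x) _ (contDiffAt_chartAction x (L.mem_target hu))
    (contDiffAt_fst.prodMk (ContDiffAt.comp (g := L.φ) _ (L.contDiffAt u hu) contDiffAt_snd))

theorem eventually_surjective_fderiv : ∀ᶠ u in 𝓝 (0 : EuclideanSpace ℝ (Fin L.dim)),
    Function.Surjective (fderiv ℝ
      (fun p : EuclideanSpace ℝ (Fin m) × EuclideanSpace ℝ (Fin L.dim) ↦
        chartAction m n G x (p.1, L.φ p.2)) (κ₁ 1, u)) := by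
  set b := fun p : EuclideanSpace ℝ (Fin m) × EuclideanSpace ℝ (Fin L.dim) ↦
        chartAction m n G x (p.1, L.φ p.2) with hb
  have hc : ContinuousAt (fun u ↦ fderiv ℝ b (κ₁ 1, u)) 0 := by
    have h1 : ContinuousAt (fderiv ℝ b) (κ₁ 1, 0) :=
      ((L.contDiffAt_chartAction_φ L.zero_mem_ball).fderiv_right (m := 0) (by simp)).continuousAt
    exact ContinuousAt.comp (g := fderiv ℝ b) h1 (continuousAt_const.prodMk continuousAt_id)
  refine hc.eventually (eventually_surjective fun z ↦ ?_)
  obtain ⟨v, u, h⟩ := L.exists_add_eq z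
  refine ⟨(v, u), ?_⟩
  have h2 := ((contDiffAt_chartAction (m := m) (n := n) (G := G) x
      (mem_chart_target _ x)).differentiableAt (by simp)).hasFDerivAt
  rw [← L.map_zero] at h2
  have h3 : HasFDerivAt (fun p : EuclideanSpace ℝ (Fin m) × EuclideanSpace ℝ (Fin L.dim) ↦
      (p.1, L.φ p.2)) _ (κ₁ 1, 0) :=
    hasFDerivAt_fst.prodMk (HasFDerivAt.comp (g := L.φ) (f := Prod.snd)
      ((κ₁ 1, 0) : EuclideanSpace ℝ (Fin m) × EuclideanSpace ℝ (Fin L.dim))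
      L.hasStrictFDerivAt.hasFDerivAt hasFDerivAt_snd)
  have h4 := (HasFDerivAt.comp (g := chartAction m n G x)
    ((κ₁ 1, 0) : EuclideanSpace ℝ (Fin m) × EuclideanSpace ℝ (Fin L.dim)) h2 h3).fderiv
  have h5 := DFunLike.congr_fun h4 (v, u)
  refine h5.trans ?_
  rw [L.map_zero]
  exact (fderiv_chartAction x v (L.deriv u)).trans h

/-- Close to `x`, the map `(g, u) ↦ g φ(u)` is a submersion. -/
theorem surjective_mfderiv {u : EuclideanSpace ℝ (Fin L.dim)} (hu : u ∈ Metric.ball 0 L.radius)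
    (hsurj : Function.Surjective (fderiv ℝ
      (fun p : EuclideanSpace ℝ (Fin m) × EuclideanSpace ℝ (Fin L.dim) ↦
        chartAction m n G x (p.1, L.φ p.2)) (κ₁ 1, u))) (g : G) :
    Function.Surjective (mfderiv ((𝓡 m).prod (𝓡 L.dim)) (𝓡 n)
      (fun p : G × EuclideanSpace ℝ (Fin L.dim) ↦ p.1 • L.embed p.2) (g, u)) := by
  set b := fun p : EuclideanSpace ℝ (Fin m) × EuclideanSpace ℝ (Fin L.dim) ↦
        chartAction m n G x (p.1, L.φ p.2) with hb
  set F := fun p : G × EuclideanSpace ℝ (Fin L.dim) ↦ p.1 • L.embed p.2 with hF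
  let Z := EuclideanSpace ℝ (Fin m) × EuclideanSpace ℝ (Fin L.dim)
  set j : Z → G × EuclideanSpace ℝ (Fin L.dim) := fun p ↦ (g * (κ₁).symm p.1, p.2) with hj
  have hκ1 : (κ₁).symm (κ₁ 1) = 1 := (κ₁).left_inv (mem_chart_source _ _)
  have hjq : j (κ₁ 1, u) = (g, u) := by simp only [hj, hκ1, mul_one]
  have hbq : b (κ₁ 1, u) = L.φ u := chartAction_one x (L.mem_target hu)
  have hFd : MDifferentiableAt ((𝓡 m).prod (𝓡 L.dim)) (𝓡 n) F (j (κ₁ 1, u)) := by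
    rw [hjq]
    have h1 := ContMDiffSMul.contMDiff_smul (I := 𝓡 m) (I' := 𝓡 n) (n := ∞) (G := G) (M := M)
    have h2 : ContMDiffAt ((𝓡 m).prod (𝓡 L.dim)) ((𝓡 m).prod (𝓡 n)) ∞
        (fun p : G × EuclideanSpace ℝ (Fin L.dim) ↦ (p.1, L.embed p.2)) (g, u) :=
      contMDiffAt_fst.prodMk (ContMDiffAt.comp (g := L.embed) (g, u) (L.contMDiffAt_embed hu)
        contMDiffAt_snd)
    exact (h1.contMDiffAt.comp (g, u) h2).mdifferentiableAt (by simp)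
  have hjd : MDifferentiableAt 𝓘(ℝ, Z) ((𝓡 m).prod (𝓡 L.dim)) j (κ₁ 1, u) := by
    refine MDifferentiableAt.prodMk ?_ ?_
    · have h1 : MDifferentiableAt (𝓡 m) (𝓡 m) (fun y ↦ g * (κ₁).symm y) (κ₁ 1) :=
        ((contMDiff_mul_left (I := 𝓡 m) (n := ∞) (a := g)).mdifferentiableAt (by simp)).comp
          (κ₁ 1) (mdifferentiableAt_atlas_symm (chart_mem_atlas _ (1 : G)) (mem_chart_target _ _))
      exact MDifferentiableAt.comp (g := fun y ↦ g * (κ₁).symm y) (f := Prod.fst)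
        ((κ₁ 1, u) : Z) h1 (contDiff_fst.contMDiff.mdifferentiableAt one_ne_zero)
    · exact contDiff_snd.contMDiff.mdifferentiableAt one_ne_zero
  have hbd : MDifferentiableAt 𝓘(ℝ, Z) (𝓡 n) b (κ₁ 1, u) :=
    ((L.contDiffAt_chartAction_φ hu).differentiableAt (by simp)).mdifferentiableAt
  have hψd : MDifferentiableAt (𝓡 n) (𝓡 n) (ψ₁).symm (b (κ₁ 1, u)) := by
    rw [hbq]
    exact mdifferentiableAt_atlas_symm (chart_mem_atlas _ x) (L.mem_target hu)
  have hgd : MDifferentiableAt (𝓡 n) (𝓡 n) (fun y : M ↦ g • y) ((ψ₁).symm (b (κ₁ 1, u))) :=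
    (contMDiff_smul_const m g).mdifferentiableAt (by simp)
  have hev : F ∘ j =ᶠ[𝓝 (κ₁ 1, u)] (fun y : M ↦ g • y) ∘ (ψ₁).symm ∘ b := by
    have hc : ContinuousAt (fun p : Z ↦ (κ₁).symm p.1 • L.embed p.2) (κ₁ 1, u) :=
      (ContinuousAt.comp (g := (κ₁).symm) (f := Prod.fst) (x := ((κ₁ 1, u) : Z))
        ((κ₁).continuousAt_symm (mem_chart_target _ _)) continuousAt_fst).smul
          (ContinuousAt.comp (g := L.embed) (f := Prod.snd) (x := ((κ₁ 1, u) : Z))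
            (L.continuousAt_embed hu) continuousAt_snd)
    have h1 := hc.eventually ((ψ₁).open_source.mem_nhds (by
      change (κ₁).symm (κ₁ 1) • L.embed u ∈ _
      rw [hκ1, one_smul]
      exact L.embed_mem_source hu))
    filter_upwards [h1] with p hp
    change (g * (κ₁).symm p.1) • L.embed p.2 =
      g • (ψ₁).symm (ψ₁ ((κ₁).symm p.1 • L.embed p.2))
    rw [(ψ₁).left_inv hp, mul_smul]
  have h1 : mfderiv 𝓘(ℝ, Z) (𝓡 n) (F ∘ j) (κ₁ 1, u) = _ := mfderiv_comp (κ₁ 1, u) hFd hjd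
  have h2 : mfderiv 𝓘(ℝ, Z) (𝓡 n) ((fun y : M ↦ g • y) ∘ (ψ₁).symm ∘ b) (κ₁ 1, u) = _ :=
    mfderiv_comp (κ₁ 1, u) hgd (hψd.comp (κ₁ 1, u) hbd)
  have h3 : mfderiv 𝓘(ℝ, Z) (𝓡 n) ((ψ₁).symm ∘ b) (κ₁ 1, u) = _ :=
    mfderiv_comp (κ₁ 1, u) hψd hbd
  have hs1 : Function.Surjective (mfderiv (𝓡 n) (𝓡 n) (ψ₁).symm (b (κ₁ 1, u))) :=
    (mdifferentiable_chart (I := 𝓡 n) x).symm.mfderiv_surjective (by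
      rw [hbq]
      exact L.mem_target hu)
  have hs2 : Function.Surjective (mfderiv 𝓘(ℝ, Z) (𝓡 n) b (κ₁ 1, u)) := by
    rw [mfderiv_eq_fderiv]
    exact hsurj
  have hs3 : Function.Surjective (mfderiv 𝓘(ℝ, Z) (𝓡 n) (F ∘ j) (κ₁ 1, u)) := by
    have h4 : Function.Surjective (mfderiv 𝓘(ℝ, Z) (𝓡 n)
        ((fun y : M ↦ g • y) ∘ (ψ₁).symm ∘ b) (κ₁ 1, u)) := by
      rw [h2, h3]
      exact (surjective_mfderiv_smul m g _).comp (hs1.comp hs2)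
    have h5 : (mfderiv 𝓘(ℝ, Z) (𝓡 n) (F ∘ j) (κ₁ 1, u) : Z →L[ℝ] EuclideanSpace ℝ (Fin n)) =
      mfderiv 𝓘(ℝ, Z) (𝓡 n) ((fun y : M ↦ g • y) ∘ (ψ₁).symm ∘ b) (κ₁ 1, u) := hev.mfderiv_eq
    change Function.Surjective (mfderiv 𝓘(ℝ, Z) (𝓡 n) (F ∘ j) (κ₁ 1, u) :
      Z →L[ℝ] EuclideanSpace ℝ (Fin n))
    rw [h5]
    exact h4
  rw [h1] at hs3
  have hs4 : Function.Surjective (mfderiv ((𝓡 m).prod (𝓡 L.dim)) (𝓡 n) F (j (κ₁ 1, u))) :=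
    Function.Surjective.of_comp hs3
  rw [hjq] at hs4
  exact hs4

/-- In a small slice, the points of one orbit are related by the isotropy group of `x`. By
compactness of `G`, it is enough to consider the elements of `G` close to a given `g`. If `g` fixes
`x`, they are reduced to elements close to `1` by multiplication with `g⁻¹`; otherwise they move
the point `x` away from itself. -/
theorem eventually_mem_stabilizer :
    ∀ᶠ p : EuclideanSpace ℝ (Fin L.dim) × EuclideanSpace ℝ (Fin L.dim) in 𝓝 (0, 0),
      ∀ g : G, g • L.embed p.1 = L.embed p.2 → g ∈ MulAction.stabilizer G x := by
  have := isCompact_univ.eventually_forall_of_forall_eventually (K := (univ : Set G))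
    (x₀ := ((0, 0) : EuclideanSpace ℝ (Fin L.dim) × EuclideanSpace ℝ (Fin L.dim)))
    (P := fun p g ↦ g • L.embed p.1 = L.embed p.2 → g ∈ MulAction.stabilizer G x) ?_
  · exact this.mono fun p hp g ↦ hp g (mem_univ g)
  intro g _
  by_cases hg : g ∈ MulAction.stabilizer G x
  · have hN := L.eventually_mem_stabilizer_of_near_one.2
    have hc : Tendsto (fun q : (EuclideanSpace ℝ (Fin L.dim) × EuclideanSpace ℝ (Fin L.dim)) × G ↦
        (q.2 * g⁻¹, L.rep ⟨g, hg⟩ q.1.1, q.1.2)) (𝓝 ((0, 0), g)) (𝓝 (1, 0, 0)) := by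
      have : Continuous (fun q : (EuclideanSpace ℝ (Fin L.dim) × EuclideanSpace ℝ (Fin L.dim)) × G ↦
        (q.2 * g⁻¹, L.rep ⟨g, hg⟩ q.1.1, q.1.2)) :=
        (continuous_snd.mul continuous_const).prodMk
          (((L.rep ⟨g, hg⟩).continuous.comp (continuous_fst.comp continuous_fst)).prodMk
            (continuous_snd.comp continuous_fst))
      have h2 := this.tendsto ((0, 0), g)
      simpa using h2
    have hb : ∀ᶠ q : (EuclideanSpace ℝ (Fin L.dim) × EuclideanSpace ℝ (Fin L.dim)) × G in
        𝓝 ((0, 0), g), q.1.1 ∈ Metric.ball 0 L.radius :=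
      (continuous_fst.comp continuous_fst).continuousAt.eventually
        (Metric.ball_mem_nhds _ L.radius_pos)
    filter_upwards [hc.eventually hN, hb] with q hq hqb heq
    have h3 := hq (by
      rw [← L.smul_embed hqb, ← heq, smul_smul, inv_mul_cancel_right])
    have h4 := mul_mem h3 hg
    simpa using h4
  · have hne : g • L.embed 0 ≠ L.embed 0 := by
      rw [L.embed_zero]
      exact fun h ↦ hg h
    have hc0 : ContinuousAt L.embed 0 := L.continuousAt_embed L.zero_mem_ball
    have h1 : ContinuousAt (fun q : (EuclideanSpace ℝ (Fin L.dim) ×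
        EuclideanSpace ℝ (Fin L.dim)) × G ↦ q.2 • L.embed q.1.1) ((0, 0), g) :=
      continuousAt_snd.smul (ContinuousAt.comp (g := L.embed) hc0
        (continuous_fst.comp continuous_fst).continuousAt)
    have h2 : ContinuousAt (fun q : (EuclideanSpace ℝ (Fin L.dim) ×
        EuclideanSpace ℝ (Fin L.dim)) × G ↦ L.embed q.1.2) ((0, 0), g) :=
      ContinuousAt.comp (g := L.embed) hc0 (continuous_snd.comp continuous_fst).continuousAt
    filter_upwards [(h1.ne_iff_eventually_ne h2).1 hne] with q hq heq
    exact absurd heq hq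

end LinearSlice

/-- The slice theorem: there are arbitrarily small tubes around every point, in the sense that their
slices are arbitrarily small. -/
theorem exists_tube [RiemannianBundle (fun x : M ↦ TangentSpace (𝓡 n) x)]
    [IsIsometricAction n G M] (x : M) {O : Set M} (hO : O ∈ 𝓝 x) :
    ∃ W : Tube m n G x, ∀ u ∈ Metric.ball 0 W.radius, W.φ u ∈ O := by
  obtain ⟨L, hL⟩ := exists_linearSlice (m := m) (n := n) (G := G) x hO
  obtain ⟨U, hU, hinj⟩ := L.eventually_mem_stabilizer_of_near_one.1
  have hstab := L.eventually_mem_stabilizer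
  rw [nhds_prod_eq] at hstab
  obtain ⟨V, hV, hV'⟩ := Filter.eventually_prod_self_iff'.1 hstab
  obtain ⟨r, hr, hball⟩ := Metric.nhds_basis_ball.mem_iff.1
    (((show ∀ᶠ u in 𝓝 0, u ∈ U ∩ V from Filter.inter_mem hU hV).and
      L.eventually_surjective_fderiv).and
      (show ∀ᶠ u in 𝓝 0, u ∈ Metric.ball 0 L.radius from Metric.ball_mem_nhds _ L.radius_pos))
  refine ⟨⟨L.dim, L.rep, L.continuous_rep, r, hr, L.embed, L.embed_zero, fun u hu ↦ ?_, ?_, ?_⟩,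
    fun u hu ↦ hL u (hball hu).2⟩
  · exact (L.contMDiffAt_embed (hball hu).2).contMDiffWithinAt
  · intro g g' u hu u' hu'
    constructor
    · intro h
      have h1 : (g'⁻¹ * g) • L.embed u = L.embed u' := by rw [mul_smul, h, inv_smul_smul]
      have h2 := hV' u (hball hu).1.1.2 u' (hball hu').1.1.2 _ h1
      refine ⟨⟨_, h2⟩, by simp, ?_⟩
      have h3 := L.smul_embed (hball hu).2 ⟨_, h2⟩
      exact (hinj (hball (L.rep_mem_ball ⟨_, h2⟩ hu)).1.1.1 (hball hu').1.1.1
        (h3.symm.trans h1)).symm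
    · rintro ⟨h, rfl, rfl⟩
      rw [← L.smul_embed (hball hu).2, smul_smul, inv_mul_cancel_right]
  · intro g u hu
    exact L.surjective_mfderiv (hball hu).2 (hball hu).1.2 g

end Submersion

/-! ### Tubes -/

section TubeFacts

/-- A submersion is open. -/
theorem nhds_le_map_of_surjective_mfderiv {E₁ H₁ N : Type*} [NormedAddCommGroup E₁]
    [NormedSpace ℝ E₁] [FiniteDimensional ℝ E₁] [TopologicalSpace H₁] {I : ModelWithCorners ℝ E₁ H₁}
    [I.Boundaryless] [TopologicalSpace N] [ChartedSpace H₁ N] {n : ℕ} {M : Type*}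
    [TopologicalSpace M] [ChartedSpace (EuclideanSpace ℝ (Fin n)) M] {f : N → M} {p : N}
    (hf : ContMDiffAt I (𝓡 n) ∞ f p) (hsurj : Function.Surjective (mfderiv I (𝓡 n) f p)) :
    𝓝 (f p) ≤ map f (𝓝 p) := by
  have hd : MDifferentiableAt I (𝓡 n) f p := hf.mdifferentiableAt (by simp)
  rw [contMDiffAt_iff] at hf
  obtain ⟨hc, hs⟩ := hf
  rw [I.range_eq_univ, contDiffWithinAt_univ] at hs
  set ft := extChartAt (𝓡 n) (f p) ∘ f ∘ (extChartAt I p).symm with hft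
  have hm : (mfderiv I (𝓡 n) f p : E₁ →L[ℝ] EuclideanSpace ℝ (Fin n)) =
      fderiv ℝ ft (extChartAt I p p) := by
    refine hd.mfderiv.trans ?_
    rw [I.range_eq_univ, fderivWithin_univ]
    rfl
  have hr : (fderiv ℝ ft (extChartAt I p p)).range = ⊤ := by
    rw [← hm]
    exact LinearMap.range_eq_top.2 hsurj
  have h1 := (hs.hasStrictFDerivAt (by simp)).map_nhds_eq_of_surj hr
  have h2 : ft (extChartAt I p p) = extChartAt (𝓡 n) (f p) (f p) := by
    simp only [hft, Function.comp, extChartAt_to_inv]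
  rw [h2, ← map_extChartAt_nhds_of_boundaryless, Filter.map_map] at h1
  have h3 := congrArg (map (extChartAt (𝓡 n) (f p)).symm) h1
  rw [Filter.map_map, ← map_extChartAt_nhds_of_boundaryless, Filter.map_map] at h3
  have h4 : ((extChartAt (𝓡 n) (f p)).symm ∘ extChartAt (𝓡 n) (f p)) =ᶠ[𝓝 (f p)] id := by
    filter_upwards [extChartAt_source_mem_nhds (I := 𝓡 n) (f p)] with y hy
    exact (extChartAt (𝓡 n) (f p)).left_inv hy
  have h5 : ((extChartAt (𝓡 n) (f p)).symm ∘ ft ∘ extChartAt I p) =ᶠ[𝓝 p] f := by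
    filter_upwards [extChartAt_source_mem_nhds (I := I) p,
      hc.eventually (extChartAt_source_mem_nhds (I := 𝓡 n) (f p))] with y hy hy'
    simp only [hft, Function.comp]
    rw [(extChartAt I p).left_inv hy]
    exact (extChartAt (𝓡 n) (f p)).left_inv hy'
  rw [Filter.map_congr h4, Filter.map_id] at h3
  rw [← h3]
  exact (Filter.map_congr h5).le

set_option linter.unusedSectionVars false

variable {m n : ℕ} {G : Type*} [Group G] [TopologicalSpace G]
  [ChartedSpace (EuclideanSpace ℝ (Fin m)) G]
  {M : Type*} [TopologicalSpace M] [ChartedSpace (EuclideanSpace ℝ (Fin n)) M] [MulAction G M]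

namespace Tube

variable {x : M} (W : Tube m n G x)

theorem zero_mem_ball : (0 : EuclideanSpace ℝ (Fin W.dim)) ∈ Metric.ball 0 W.radius :=
  Metric.mem_ball_self W.radius_pos

theorem rep_mem_ball {r : ℝ} (h : MulAction.stabilizer G x) {u : EuclideanSpace ℝ (Fin W.dim)}
    (hu : u ∈ Metric.ball 0 r) : W.rep h u ∈ Metric.ball 0 r := by
  rwa [mem_ball_zero_iff, LinearIsometryEquiv.norm_map, ← mem_ball_zero_iff]

theorem smul_φ (h : MulAction.stabilizer G x) {u : EuclideanSpace ℝ (Fin W.dim)}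
    (hu : u ∈ Metric.ball 0 W.radius) : (h : G) • W.φ u = W.φ (W.rep h u) := by
  have := (W.smul_eq_smul_iff h 1 u hu (W.rep h u) (W.rep_mem_ball h hu)).2
    ⟨h, (mul_inv_cancel _).symm, rfl⟩
  rwa [one_smul] at this

theorem exists_of_smul_φ_eq {g : G} {u u' : EuclideanSpace ℝ (Fin W.dim)}
    (hu : u ∈ Metric.ball 0 W.radius) (hu' : u' ∈ Metric.ball 0 W.radius)
    (h : g • W.φ u = W.φ u') : ∃ k : MulAction.stabilizer G x, (k : G) = g ∧ W.rep k u = u' := by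
  obtain ⟨k, hk, hk'⟩ := (W.smul_eq_smul_iff g 1 u hu u' hu').1 (by rwa [one_smul])
  exact ⟨k, (mul_inv_eq_one.1 hk.symm).symm, hk'.symm⟩

theorem smul_mem_carrier (g : G) {y : M} (hy : y ∈ W.carrier) : g • y ∈ W.carrier := by
  rw [← W.preimage_carrier g] at hy
  exact hy

theorem φ_mem_carrier {u : EuclideanSpace ℝ (Fin W.dim)} (hu : u ∈ Metric.ball 0 W.radius) :
    W.φ u ∈ W.carrier := ⟨1, u, hu, (one_smul _ _).symm⟩

theorem self_mem_carrier : x ∈ W.carrier := by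
  have := W.φ_mem_carrier W.zero_mem_ball
  rwa [W.map_zero] at this

theorem continuousAt_φ {u : EuclideanSpace ℝ (Fin W.dim)} (hu : u ∈ Metric.ball 0 W.radius) :
    ContinuousAt W.φ u :=
  (W.contMDiffOn.contMDiffAt (Metric.isOpen_ball.mem_nhds hu)).continuousAt

/-- The map `(g, u) ↦ g φ(u)` of a tube is open. -/
theorem nhds_smul_φ_le [ContMDiffSMul (𝓡 m) (𝓡 n) ∞ G M] (g : G)
    {u : EuclideanSpace ℝ (Fin W.dim)} (hu : u ∈ Metric.ball 0 W.radius) :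
    𝓝 (g • W.φ u) ≤ map (fun p : G × EuclideanSpace ℝ (Fin W.dim) ↦ p.1 • W.φ p.2) (𝓝 (g, u)) := by
  refine nhds_le_map_of_surjective_mfderiv
    (f := fun p : G × EuclideanSpace ℝ (Fin W.dim) ↦ p.1 • W.φ p.2) (p := (g, u)) ?_
    (W.surjective_mfderiv g u hu)
  have h1 := ContMDiffSMul.contMDiff_smul (I := 𝓡 m) (I' := 𝓡 n) (n := ∞) (G := G) (M := M)
  have h2 : ContMDiffAt ((𝓡 m).prod (𝓡 W.dim)) ((𝓡 m).prod (𝓡 n)) ∞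
      (fun p : G × EuclideanSpace ℝ (Fin W.dim) ↦ (p.1, W.φ p.2)) (g, u) :=
    contMDiffAt_fst.prodMk (ContMDiffAt.comp (g := W.φ) (g, u)
      (W.contMDiffOn.contMDiffAt (Metric.isOpen_ball.mem_nhds hu)) contMDiffAt_snd)
  exact h1.contMDiffAt.comp (g, u) h2

theorem isOpen_carrier [ContMDiffSMul (𝓡 m) (𝓡 n) ∞ G M] : IsOpen W.carrier := by
  rw [isOpen_iff_mem_nhds]
  rintro _ ⟨g, u, hu, rfl⟩
  refine W.nhds_smul_φ_le g hu ?_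
  rw [Filter.mem_map]
  have : ∀ᶠ p : G × EuclideanSpace ℝ (Fin W.dim) in 𝓝 (g, u), p.2 ∈ Metric.ball 0 W.radius :=
    continuousAt_snd.eventually (Metric.isOpen_ball.mem_nhds hu)
  filter_upwards [this] with p hp
  exact ⟨p.1, p.2, hp, rfl⟩

end Tube

variable {F : Type*} [NormedAddCommGroup F] [NormedSpace ℂ F]
  {E : M → Type*} [TopologicalSpace (TotalSpace F E)] [∀ x, NormedAddCommGroup (E x)]
  [∀ x, InnerProductSpace ℂ (E x)] [FiberBundle F E]
  {V : Type*} [NormedAddCommGroup V] [InnerProductSpace ℂ V]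

theorem Occurs.smul {a : EquivariantStructure m n G F E} {α : G →* (V ≃ₗᵢ[ℂ] V)} {y : M}
    (hy : Occurs a α y) (g : G) : Occurs a α (g • y) := by
  obtain ⟨L, hL0, hL⟩ := hy
  have hg : g • y = g • y := rfl
  refine ⟨(a.actTo hg).toLinearEquiv.toLinearMap ∘ₗ L ∘ₗ (α g⁻¹).toLinearEquiv.toLinearMap, ?_, ?_⟩
  · obtain ⟨v, hv⟩ : ∃ v, L v ≠ 0 := by
      by_contra! h
      exact hL0 (LinearMap.ext h)
    intro h0
    have h1 : a.actTo hg (L (α g⁻¹ (α g v))) = 0 := LinearMap.congr_fun h0 (α g v)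
    have h2 : α g⁻¹ (α g v) = v := by
      have := rep_inv_apply' α g⁻¹ v
      rwa [inv_inv] at this
    rw [h2] at h1
    exact hv ((a.actTo hg).injective (by rw [h1, map_zero]))
  · intro k hk v
    change a.actTo hk (a.actTo hg (L (α g⁻¹ v))) = a.actTo hg (L (α g⁻¹ (α k v)))
    have h1 : (g⁻¹ * k * g) • y = y := by
      rw [mul_smul, mul_smul, hk, inv_smul_smul]
    have h2 : α g⁻¹ (α k v) = α (g⁻¹ * k * g) (α g⁻¹ v) := by
      rw [← rep_mul_apply, ← rep_mul_apply]
      congr 2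
      group
    have h3 : (k * g) • y = g • y := by rw [mul_smul, hk]
    rw [h2, ← hL _ h1, a.actTo_actTo hg hk h3 rfl, a.actTo_actTo h1 hg h3 (by group)]

theorem occurs_smul_iff {a : EquivariantStructure m n G F E} {α : G →* (V ≃ₗᵢ[ℂ] V)} {y : M}
    (g : G) : Occurs a α (g • y) ↔ Occurs a α y :=
  ⟨fun h ↦ by simpa using h.smul g⁻¹, fun h ↦ h.smul g⟩

/-- The isotypical component of the sections over a tube vanishes if and only if the representation
occurs at no point of the tube. -/
theorem Tube.isotypicComponent_l2Rep_eq_bot_iff [IsTopologicalGroup G] [CompactSpace G]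
    [IsManifold (𝓡 n) ∞ M] [RiemannianBundle (fun x : M ↦ TangentSpace (𝓡 n) x)]
    [IsContMDiffRiemannianBundle (𝓡 n) ∞ (EuclideanSpace ℝ (Fin n))
      (fun x : M ↦ TangentSpace (𝓡 n) x)]
    [MeasurableSpace M] [BorelSpace M] [CompactSpace M] [T2Space M]
    [ContinuousSMul G M] [ContMDiffSMul (𝓡 m) (𝓡 n) ∞ G M] [IsIsometricAction n G M]
    [FiniteDimensional ℂ F] [VectorBundle ℂ F E] [IsSmoothHermitianBundle n F E] [CompleteSpace V]
    {x : M} (W : Tube m n G x) (a : EquivariantStructure m n G F E) {α : G →* (V ≃ₗᵢ[ℂ] V)}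
    (hα : IsIrreducibleUnitaryRep α) :
    isotypicComponent (W.l2Rep a) α = ⊥ ↔ ∀ y ∈ W.carrier, ¬ Occurs a α y := by
  have : IsFiniteMeasure W.volume := by
    rw [Tube.volume]
    infer_instance
  have hW := W.isOpen_carrier
  constructor
  · intro h y hy hocc
    refine hocc.isotypicComponent_ne_bot hα W.measurePreserving_smul (fun U hU hyU ↦ ?_) h
    rw [Tube.volume, Measure.restrict_apply hU.measurableSet]
    exact ((hU.inter hW).measure_pos _ ⟨y, hyU, hy⟩).ne'
  · intro h
    refine isotypicComponent_eq_bot hα W.measurePreserving_smul ?_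
    rw [Tube.volume]
    exact (ae_restrict_mem hW.measurableSet).mono h

end TubeFacts

/-! ### Functions which are polynomial on lines -/

section LinePolynomial

variable {H : Type*} [TopologicalSpace H]
  {X : Type*} [NormedAddCommGroup X] [InnerProductSpace ℝ X]

variable (H) in
/-- A function on `X` is polynomial on lines if it restricts to polynomials on the lines
`t ↦ a + t b`, with coefficients which are continuous in parameters `h` on which `a` and `b`
depend. Polynomials have this property. -/
def PolynomialOnLines (p : X → ℝ) : Prop :=
  Continuous p ∧ ∀ a b : C(H, X), ∃ q : Polynomial C(H, ℝ), ∀ (t : ℝ) (h : H),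
    p (a h + t • b h) = q.eval (algebraMap ℝ C(H, ℝ) t) h

theorem polynomialOnLines_const (r : ℝ) : PolynomialOnLines H (fun _ : X ↦ r) :=
  ⟨continuous_const, fun _ _ ↦ ⟨Polynomial.C (algebraMap ℝ C(H, ℝ) r), fun t h ↦ by simp⟩⟩

theorem polynomialOnLines_inner (e : X) : PolynomialOnLines H (fun z : X ↦ inner ℝ e z) := by
  refine ⟨by fun_prop, fun a b ↦ ⟨Polynomial.C ⟨fun h ↦ inner ℝ e (a h), by fun_prop⟩ +
    Polynomial.X * Polynomial.C ⟨fun h ↦ inner ℝ e (b h), by fun_prop⟩, fun t h ↦ ?_⟩⟩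
  simp [inner_add_right, inner_smul_right, mul_comm t]

theorem PolynomialOnLines.add {p q : X → ℝ} (hp : PolynomialOnLines H p)
    (hq : PolynomialOnLines H q) : PolynomialOnLines H (fun z ↦ p z + q z) := by
  refine ⟨hp.1.add hq.1, fun a b ↦ ?_⟩
  obtain ⟨P, hP⟩ := hp.2 a b
  obtain ⟨Q, hQ⟩ := hq.2 a b
  exact ⟨P + Q, fun t h ↦ by
    change p _ + q _ = _
    rw [hP, hQ, Polynomial.eval_add]
    rfl⟩

theorem PolynomialOnLines.mul {p q : X → ℝ} (hp : PolynomialOnLines H p)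
    (hq : PolynomialOnLines H q) : PolynomialOnLines H (fun z ↦ p z * q z) := by
  refine ⟨hp.1.mul hq.1, fun a b ↦ ?_⟩
  obtain ⟨P, hP⟩ := hp.2 a b
  obtain ⟨Q, hQ⟩ := hq.2 a b
  exact ⟨P * Q, fun t h ↦ by
    change p _ * q _ = _
    rw [hP, hQ, Polynomial.eval_mul]
    rfl⟩

variable [CompactSpace H] [MeasurableSpace H] [BorelSpace H] (μ : Measure H) [IsFiniteMeasure μ]

theorem PolynomialOnLines.exists_eval_eq_integral {p : X → ℝ} (hp : PolynomialOnLines H p)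
    (a b : C(H, X)) {f : H → ℝ} (hf : Continuous f) :
    ∃ Q : Polynomial ℝ, ∀ t, ∫ h, p (a h + t • b h) * f h ∂μ = Q.eval t := by
  obtain ⟨q, hq⟩ := hp.2 a b
  refine ⟨∑ i ∈ q.support, Polynomial.monomial i (∫ h, q.coeff i h * f h ∂μ), fun t ↦ ?_⟩
  rw [Polynomial.eval_finsetSum]
  simp only [Polynomial.eval_monomial]
  have h1 : ∀ h, p (a h + t • b h) * f h = ∑ i ∈ q.support, (q.coeff i h * f h) * t ^ i := by
    intro h
    rw [hq, Polynomial.eval_eq_sum, Polynomial.sum, ContinuousMap.sum_apply, Finset.sum_mul]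
    refine Finset.sum_congr rfl fun i _ ↦ ?_
    have h2 : algebraMap ℝ C(H, ℝ) t h = t := by simp
    rw [ContinuousMap.mul_apply, ContinuousMap.pow_apply, h2]
    ring
  simp only [h1]
  rw [integral_finsetSum (f := fun i h ↦ q.coeff i h * f h * t ^ i) _ fun i _ ↦
    integrable_of_continuous μ (((q.coeff i).continuous.mul hf).mul continuous_const)]
  simp only [integral_mul_const]

/-- By the Stone-Weierstrass theorem, the cut-off function in
`exists_continuousMap_integral_pos` can be chosen to be polynomial on lines. -/
theorem exists_polynomialOnLines_integral_pos [μ.IsOpenPosMeasure] {c : H → X} (hc : Continuous c)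
    {f : H → ℝ} (hf : Continuous f) {k₀ : H} (hpos : ∀ k, c k = c k₀ → 0 < f k) :
    ∃ p : X → ℝ, PolynomialOnLines H p ∧ 0 < ∫ k, p (c k) * f k ∂μ := by
  obtain ⟨ψ, hψ⟩ := exists_continuousMap_integral_pos μ hc hf hpos
  set K := range c
  have hK : CompactSpace K := isCompact_iff_compactSpace.1 (isCompact_range hc)
  let A : Subalgebra ℝ C(K, ℝ) :=
    { carrier := {g | ∃ p : X → ℝ, PolynomialOnLines H p ∧ ∀ z : K, g z = p z}
      mul_mem' := by
        rintro g g' ⟨p, hp, hg⟩ ⟨p', hp', hg'⟩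
        exact ⟨_, hp.mul hp', fun z ↦ by rw [ContinuousMap.mul_apply, hg, hg']⟩
      add_mem' := by
        rintro g g' ⟨p, hp, hg⟩ ⟨p', hp', hg'⟩
        exact ⟨_, hp.add hp', fun z ↦ by rw [ContinuousMap.add_apply, hg, hg']⟩
      algebraMap_mem' := fun r ↦ ⟨_, polynomialOnLines_const r, fun z ↦ by simp⟩ }
  have hA : A.SeparatesPoints := by
    intro z z' hne
    refine ⟨_, ⟨⟨fun w : K ↦ inner ℝ ((z : X) - z') w, by fun_prop⟩,
      ⟨_, polynomialOnLines_inner ((z : X) - z'), fun w ↦ rfl⟩, rfl⟩, fun h ↦ ?_⟩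
    have h1 : inner ℝ ((z : X) - z') ((z : X) - z') = 0 := by
      rw [inner_sub_right]
      exact sub_eq_zero.2 h
    exact hne (Subtype.ext (sub_eq_zero.1 (inner_self_eq_zero.1 h1)))
  set I := ∫ k, ψ (c k) * f k ∂μ
  set J := ∫ k, |f k| ∂μ
  have hJ : 0 ≤ J := integral_nonneg fun _ ↦ abs_nonneg _
  obtain ⟨⟨g, p, hp, hg⟩, hclose⟩ :=
    ContinuousMap.exists_mem_subalgebra_near_continuousMap_of_separatesPoints A hA
      (ψ.restrict K) (I / (J + 1)) (by positivity)
  refine ⟨p, hp, ?_⟩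
  have hpc : ∀ k, |p (c k) - ψ (c k)| ≤ I / (J + 1) := by
    intro k
    have := (ContinuousMap.norm_coe_le_norm (g - ψ.restrict K) ⟨c k, k, rfl⟩).trans hclose.le
    rw [ContinuousMap.sub_apply, hg] at this
    exact this
  have hi1 := integrable_of_continuous μ ((hp.1.comp hc).mul hf)
  have hi2 := integrable_of_continuous μ ((ψ.continuous.comp hc).mul hf)
  have h1 : |(∫ k, p (c k) * f k ∂μ) - I| ≤ I / (J + 1) * J := by
    have h2 : (∫ k, p (c k) * f k ∂μ) - I = ∫ k, (p (c k) - ψ (c k)) * f k ∂μ := by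
      simp only [sub_mul]
      exact (integral_sub hi1 hi2).symm
    rw [h2, ← integral_const_mul, ← Real.norm_eq_abs]
    refine norm_integral_le_of_norm_le
      ((integrable_of_continuous μ hf.abs).const_mul _) (Eventually.of_forall fun k ↦ ?_)
    rw [norm_mul, Real.norm_eq_abs, Real.norm_eq_abs]
    exact mul_le_mul_of_nonneg_right (hpc k) (abs_nonneg _)
  have h3 : I / (J + 1) * J < I := by
    rw [div_mul_eq_mul_div, div_lt_iff₀ (by positivity)]
    linarith [mul_pos hψ one_pos]
  linarith [(abs_le.1 h1).1]

end LinePolynomial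

/-! ### Equivariant maps which are nonzero on a dense set -/

section Density

variable {H : Type*} [Group H] [TopologicalSpace H] [IsTopologicalGroup H] [CompactSpace H]
  {X : Type*} [NormedAddCommGroup X] [InnerProductSpace ℝ X]
  {V B : Type*} [NormedAddCommGroup V] [InnerProductSpace ℂ V] [FiniteDimensional ℂ V]
  [NormedAddCommGroup B] [InnerProductSpace ℂ B] [FiniteDimensional ℂ B]

/-- Let a compact group `H` act linearly on `X`, `V` and `B`. A linear map `L : V → B` which is
equivariant under the stabilizer of a point `u₁` of `X` gives rise to an `H`-equivariant map `P`
from `X` to the space of linear maps `V → B`, polynomial on lines, which is not zero at `u₁`;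
hence it is not zero on a dense set. -/
theorem exists_equivariant_map_dense (D : H →* (X ≃ₗᵢ[ℝ] X)) (hD : ∀ u, Continuous fun h ↦ D h u)
    (α : H →* (V ≃ₗᵢ[ℂ] V)) (hα : ∀ v, Continuous fun h ↦ α h v)
    (β : H →* (B ≃ₗᵢ[ℂ] B)) (hβ : Continuous fun p : H × B ↦ β p.1 p.2)
    {u₁ : X} {L : V →ₗ[ℂ] B} (hL0 : L ≠ 0) (hL : ∀ h, D h u₁ = u₁ → ∀ v, β h (L v) = L (α h v)) :
    ∃ P : X → V →ₗ[ℂ] B, (∀ h u v, β h (P u v) = P (D h u) (α h v)) ∧ Dense {u | P u ≠ 0} := by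
  borelize H
  obtain ⟨μ, hμ1, hμ2, hμ3⟩ := exists_invariant_probability (G := H)
  have hcpl : CompleteSpace B := FiniteDimensional.complete ℂ B
  obtain ⟨v₀, hv₀⟩ : ∃ v, L v ≠ 0 := by
    by_contra! h
    exact hL0 (LinearMap.ext h)
  have hLc : Continuous L := L.continuous_of_finiteDimensional
  let τ : V → H → B := fun v h ↦ β h (L (α h⁻¹ v))
  have hτ : ∀ v, Continuous (τ v) := fun v ↦
    hβ.comp (continuous_id.prodMk (hLc.comp ((hα v).comp continuous_inv)))
  have hDc : ∀ u, Continuous fun h ↦ D h⁻¹ u := fun u ↦ (hD u).comp continuous_inv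
  let f : H → ℝ := fun h ↦ (inner ℂ (L v₀) (τ v₀ h)).re
  have hf : Continuous f := Complex.continuous_re.comp (continuous_const.inner (hτ v₀))
  obtain ⟨p, hp, hpos⟩ := exists_polynomialOnLines_integral_pos μ (c := fun h ↦ D h⁻¹ u₁)
    (hDc u₁) hf (k₀ := 1) (by
      intro h hh
      have h1 : D h⁻¹ u₁ = u₁ := by
        rw [hh, inv_one, map_one]
        rfl
      have h2 : D h u₁ = u₁ := by
        conv_lhs => rw [← h1]
        change (D h * D h⁻¹) u₁ = u₁
        rw [← map_mul, mul_inv_cancel, map_one]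
        rfl
      have h3 : τ v₀ h = L v₀ := by
        change β h (L (α h⁻¹ v₀)) = L v₀
        rw [hL h h2, rep_inv_apply']
      change 0 < (inner ℂ (L v₀) (τ v₀ h)).re
      rw [h3]
      exact (show 0 < ‖L v₀‖ ^ 2 by positivity).trans_eq
        (inner_self_eq_norm_sq (𝕜 := ℂ) (L v₀)).symm)
  have hc : ∀ u v, Continuous fun h ↦ (p (D h⁻¹ u) : ℂ) • τ v h := fun u v ↦
    (Complex.continuous_ofReal.comp (hp.1.comp (hDc u))).smul (hτ v)
  let P : X → V →ₗ[ℂ] B := fun u ↦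
    { toFun := fun v ↦ ∫ h, (p (D h⁻¹ u) : ℂ) • τ v h ∂μ
      map_add' := fun v w ↦ by
        rw [← integral_add (integrable_of_continuous μ (hc u v))
          (integrable_of_continuous μ (hc u w))]
        simp [τ]
      map_smul' := fun c v ↦ by
        rw [RingHom.id_apply, ← integral_smul]
        simp [τ, smul_comm c] }
  have hPinner : ∀ u, (inner ℂ (L v₀) (P u v₀)).re = ∫ h, p (D h⁻¹ u) * f h ∂μ := by
    intro u
    change (inner ℂ (L v₀) (∫ h, (p (D h⁻¹ u) : ℂ) • τ v₀ h ∂μ)).re = _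
    rw [← integral_inner (integrable_of_continuous μ (hc u v₀))]
    have h2 := integrable_of_continuous μ
      ((continuous_const (y := L v₀)).inner (𝕜 := ℂ) (hc u v₀))
    refine (integral_re h2).symm.trans ?_
    refine integral_congr_ae (Eventually.of_forall fun h ↦ ?_)
    change (inner ℂ (L v₀) ((p (D h⁻¹ u) : ℂ) • τ v₀ h)).re = _
    rw [inner_smul_right]
    exact Complex.re_ofReal_mul _ _
  refine ⟨P, fun k u v ↦ ?_, ?_⟩
  · change β k (∫ h, (p (D h⁻¹ u) : ℂ) • τ v h ∂μ) =
      ∫ h, (p (D h⁻¹ (D k u)) : ℂ) • τ (α k v) h ∂μ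
    rw [← integral_mul_left_eq_self (fun h ↦ (p (D h⁻¹ (D k u)) : ℂ) • τ (α k v) h) k]
    have : ∀ w, β k w = (β k).toContinuousLinearEquiv.toContinuousLinearMap w := fun _ ↦ rfl
    rw [this, ← ContinuousLinearMap.integral_comp_comm _ (integrable_of_continuous μ (hc u v))]
    refine integral_congr_ae (Eventually.of_forall fun h ↦ ?_)
    have h1 : D (k * h)⁻¹ (D k u) = D h⁻¹ u := by
      change (D (k * h)⁻¹ * D k) u = _
      rw [← map_mul, mul_inv_rev, inv_mul_cancel_right]
    have h2 : τ (α k v) (k * h) = β k (τ v h) := by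
      change β (k * h) (L (α (k * h)⁻¹ (α k v))) = β k (β h (L (α h⁻¹ v)))
      rw [← rep_mul_apply α, mul_inv_rev, inv_mul_cancel_right, rep_mul_apply β]
    change β k ((p (D h⁻¹ u) : ℂ) • τ v h) = (p (D (k * h)⁻¹ (D k u)) : ℂ) • τ (α k v) (k * h)
    rw [h1, h2, map_smul]
  · -- on the line through `u₁` and `u₂`, a matrix coefficient of `P` is a nonzero polynomial
    intro u₂
    obtain ⟨Q, hQ⟩ := hp.exists_eval_eq_integral μ ⟨fun h ↦ D h⁻¹ u₁, hDc u₁⟩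
      ⟨fun h ↦ D h⁻¹ (u₂ - u₁), hDc _⟩ hf
    have hQ' : ∀ t : ℝ, (inner ℂ (L v₀) (P (u₁ + t • (u₂ - u₁)) v₀)).re = Q.eval t := by
      intro t
      rw [hPinner, ← hQ]
      simp only [map_add, map_smul, ContinuousMap.coe_mk]
    have hQ0 : Q ≠ 0 := by
      rintro rfl
      have := hQ' 0
      rw [zero_smul, add_zero, hPinner, Polynomial.eval_zero] at this
      exact hpos.ne' this
    have hfin : ∃ᶠ t in 𝓝 (1 : ℝ), Q.eval t ≠ 0 := by
      have h1 : {t : ℝ | Q.eval t = 0}.Finite :=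
        Q.rootSet_finite ℝ |>.subset fun t ht ↦ by
          rw [Polynomial.mem_rootSet]
          exact ⟨hQ0, by simpa using ht⟩
      have h2 := h1.countable.dense_compl ℝ (1 : ℝ)
      rw [mem_closure_iff_frequently] at h2
      exact h2
    have hcont : Tendsto (fun t : ℝ ↦ u₁ + t • (u₂ - u₁)) (𝓝 1) (𝓝 u₂) := by
      have : ContinuousAt (fun t : ℝ ↦ u₁ + t • (u₂ - u₁)) 1 := by fun_prop
      simpa [ContinuousAt] using this
    rw [mem_closure_iff_frequently]
    refine hcont.frequently (hfin.mono fun t ht h0 ↦ ht ?_)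
    rw [← hQ', h0, LinearMap.zero_apply, inner_zero_right, Complex.zero_re]

end Density

/-! ### Density of the occurrences in a small tube -/

section EquivariantExtension

variable {m n : ℕ} {G : Type*} [Group G] [TopologicalSpace G]
  [ChartedSpace (EuclideanSpace ℝ (Fin m)) G]
  {M : Type*} [TopologicalSpace M] [ChartedSpace (EuclideanSpace ℝ (Fin n)) M] [MulAction G M]
  {F : Type*} [NormedAddCommGroup F] [NormedSpace ℂ F]
  {E : M → Type*} [TopologicalSpace (TotalSpace F E)] [∀ x, NormedAddCommGroup (E x)]
  [∀ x, InnerProductSpace ℂ (E x)] [FiberBundle F E]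

/-- The representation of the isotropy group of `x` on the fibre over `x`. -/
noncomputable def EquivariantStructure.isotropyRep (a : EquivariantStructure m n G F E) (x : M) :
    MulAction.stabilizer G x →* (E x ≃ₗᵢ[ℂ] E x) where
  toFun h := a.actTo h.2
  map_one' := LinearIsometryEquiv.ext fun w ↦ a.actTo_one _ w
  map_mul' h k := LinearIsometryEquiv.ext fun w ↦ (a.actTo_actTo k.2 h.2 (h * k).2 rfl w).symm

variable [IsTopologicalGroup G] [CompactSpace G] [CompactSpace M] [T2Space M]
  [ContinuousSMul G M] [FiniteDimensional ℂ F] [VectorBundle ℂ F E]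

/-- Around `x`, the bundle is trivialized by a family of maps `E_x → E_z` which is equivariant under
the isotropy group of `x`: the average over this group of any family extending the identity
of `E_x`. -/
theorem exists_equivariant_extension (a : EquivariantStructure m n G F E) (x : M) :
    ∃ τ : E x →ₗ[ℂ] (∀ z, E z), (∀ᶠ z in 𝓝 x, Function.Injective fun w ↦ τ w z) ∧
      ∀ (h : MulAction.stabilizer G x) (z z' : M) (hz : (h : G) • z = z') (w : E x),
        a.actTo hz (τ w z) = τ (a.isotropyRep x h w) z' := by
  have hcpt := isCompact_stabilizer (G := G) x
  borelize ↥(MulAction.stabilizer G x)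
  obtain ⟨μ, hμ1, hμ2, hμ3⟩ := exists_invariant_probability (G := MulAction.stabilizer G x)
  have hfin : ∀ z, FiniteDimensional ℂ (E z) := finiteDimensional_fiber F E
  have hcpl : ∀ z, CompleteSpace (E z) := fun z ↦ FiniteDimensional.complete ℂ (E z)
  obtain ⟨ext, hext, hextc⟩ := exists_linear_extension F E x
  let β := a.isotropyRep x
  have hβ : ∀ w, Continuous fun h ↦ β h w := fun w ↦
    (continuous_fiber_iff (F := F)).2 (a.continuous_actTo (fun h : MulAction.stabilizer G x ↦ h.2)
      (v := fun _ ↦ w) continuous_subtype_val continuous_const)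
  let σ : E x → MulAction.stabilizer G x → ∀ z, E z := fun w h z ↦
    a.actTo (smul_inv_smul (h : G) z) (ext (β h⁻¹ w) ((h : G)⁻¹ • z))
  have hσ : ∀ w, Continuous fun p : MulAction.stabilizer G x × M ↦
      TotalSpace.mk' F p.2 (σ w p.1 p.2) := fun w ↦ by
    have hg : Continuous fun p : MulAction.stabilizer G x × M ↦ (p.1 : G) :=
      continuous_subtype_val.comp continuous_fst
    refine a.continuous_actTo (X := MulAction.stabilizer G x × M) (g := fun p ↦ p.1)
      (fun p ↦ smul_inv_smul (p.1 : G) p.2) hg ?_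
    exact hextc.comp (((hβ w).comp (continuous_inv.comp continuous_fst)).prodMk
      (hg.inv.smul continuous_snd))
  have hσz : ∀ w z, Continuous fun h ↦ σ w h z := fun w z ↦
    (continuous_fiber_iff (F := F)).2 ((hσ w).comp (Continuous.prodMk_left z))
  let τ : E x →ₗ[ℂ] (∀ z, E z) :=
    { toFun := fun w z ↦ ∫ h, σ w h z ∂μ
      map_add' := fun v w ↦ by
        funext z
        simp only [Pi.add_apply]
        rw [← integral_add (integrable_of_continuous μ (hσz v z))
          (integrable_of_continuous μ (hσz w z))]
        simp [σ]
      map_smul' := fun c v ↦ by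
        funext z
        simp only [Pi.smul_apply, RingHom.id_apply]
        rw [← integral_smul]
        simp [σ] }
  have hτc : ∀ w, Continuous fun z ↦ TotalSpace.mk' F z (τ w z) := fun w ↦
    continuous_integral_section μ (hσ w)
  have hτx : ∀ w, τ w x = w := by
    intro w
    change ∫ h, σ w h x ∂μ = w
    have h1 : ∀ h, σ w h x = w := by
      intro h
      change a.actTo _ (ext (β h⁻¹ w) ((h : G)⁻¹ • x)) = w
      rw [a.actTo_section (smul_inv_smul (h : G) x) h.2, hext]
      exact rep_inv_apply' β h w
    simp only [h1, integral_const, probReal_univ, one_smul]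
  refine ⟨τ, ?_, fun k z z' hz w ↦ ?_⟩
  · set e := trivializationAt F E x
    have hx : x ∈ e.baseSet := mem_baseSet_trivializationAt F E x
    let Λ : M → E x →L[ℂ] F := fun z ↦
      LinearMap.toContinuousLinearMap (e.linearMapAt ℂ z ∘ₗ LinearMap.proj z ∘ₗ τ)
    have hΛ : ∀ z ∈ e.baseSet, ∀ w, Λ z w = (e (TotalSpace.mk' F z (τ w z))).2 := by
      intro z hz w
      change e.linearMapAt ℂ z (τ w z) = _
      rw [e.coe_linearMapAt_of_mem hz]
    have hΛc : ContinuousOn Λ e.baseSet := by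
      rw [continuousOn_clm_apply]
      intro w
      refine ContinuousOn.congr ?_ fun z hz ↦ hΛ z hz w
      exact continuous_snd.comp_continuousOn (e.continuousOn.comp (hτc w).continuousOn
        fun z hz ↦ e.mem_source.2 hz)
    have hΛx : Function.Injective (Λ x) := by
      intro w w' h
      have h1 : (e.continuousLinearEquivAt ℂ x hx) (τ w x) =
          (e.continuousLinearEquivAt ℂ x hx) (τ w' x) := by
        have h2 := (hΛ x hx w).symm.trans (h.trans (hΛ x hx w'))
        exact h2
      have h3 := (e.continuousLinearEquivAt ℂ x hx).injective h1
      rwa [hτx, hτx] at h3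
    have h4 := (hΛc.continuousAt (e.open_baseSet.mem_nhds hx)).eventually
      (ContinuousLinearMap.isOpen_injective.mem_nhds hΛx)
    filter_upwards [h4] with z hz w w' hw
    refine hz ?_
    change e.linearMapAt ℂ z (τ w z) = e.linearMapAt ℂ z (τ w' z)
    exact congrArg _ hw
  · change a.actTo hz (∫ h, σ w h z ∂μ) = ∫ h, σ (β k w) h z' ∂μ
    rw [← integral_mul_left_eq_self (fun h ↦ σ (β k w) h z') k]
    have : ∀ v, a.actTo hz v = (a.actTo hz).toContinuousLinearEquiv.toContinuousLinearMap v :=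
      fun _ ↦ rfl
    rw [this, ← ContinuousLinearMap.integral_comp_comm _ (integrable_of_continuous μ (hσz w z))]
    refine integral_congr_ae (Eventually.of_forall fun h ↦ ?_)
    subst hz
    have h2 : β (k * h)⁻¹ (β k w) = β h⁻¹ w := by
      rw [← rep_mul_apply β, mul_inv_rev, inv_mul_cancel_right]
    change a.actTo _ (a.actTo _ (ext (β h⁻¹ w) ((h : G)⁻¹ • z))) =
      a.actTo _ (ext (β (k * h)⁻¹ (β k w))
        (((k * h : MulAction.stabilizer G x) : G)⁻¹ • (k : G) • z))
    have h4 : ((k * h : MulAction.stabilizer G x) : G) • ((h : G)⁻¹ • z) = (k : G) • z := by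
      rw [Subgroup.coe_mul, mul_smul, smul_inv_smul]
    rw [h2, a.actTo_actTo _ _ h4 rfl]
    exact a.actTo_section _ _ _

variable {V : Type*} [NormedAddCommGroup V] [InnerProductSpace ℂ V] [FiniteDimensional ℂ V]

set_option linter.unusedSectionVars false in
/-- In a small tube, the points at which `α` occurs are dense, unless there are none. -/
theorem Tube.exists_occurs_mem_inter {x : M} (W : Tube m n G x)
    {a : EquivariantStructure m n G F E} {α : G →* (V ≃ₗᵢ[ℂ] V)}
    (hα : ∀ v, Continuous fun g ↦ α g v) {τ : E x →ₗ[ℂ] (∀ z, E z)}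
    (hinj : ∀ u ∈ Metric.ball 0 W.radius, Function.Injective fun w ↦ τ w (W.φ u))
    (hτ : ∀ (h : MulAction.stabilizer G x) (z z' : M) (hz : (h : G) • z = z') (w : E x),
      a.actTo hz (τ w z) = τ (a.isotropyRep x h w) z')
    {y : M} (hy : y ∈ W.carrier) (hocc : Occurs a α y) {U : Set M} (hU : IsOpen U)
    (hne : (U ∩ W.carrier).Nonempty) : ∃ z ∈ U, Occurs a α z := by
  have hfin : ∀ z, FiniteDimensional ℂ (E z) := finiteDimensional_fiber F E
  have hcpt := isCompact_stabilizer (G := G) x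
  obtain ⟨g₁, u₁, hu₁, rfl⟩ := hy
  rw [occurs_smul_iff] at hocc
  obtain ⟨L, hL0, hL⟩ := hocc
  obtain ⟨_, hzU, g₂, u₂, hu₂, rfl⟩ := hne
  let T : ∀ z, E x →ₗ[ℂ] E z := fun z ↦ LinearMap.proj z ∘ₗ τ
  have hrank : Module.finrank ℂ (E x) = Module.finrank ℂ (E (W.φ u₁)) := by
    have h : ∀ z, Module.finrank ℂ (E z) = Module.finrank ℂ F := fun z ↦
      ((trivializationAt F E z).continuousLinearEquivAt ℂ z
        (mem_baseSet_trivializationAt F E z)).toLinearEquiv.finrank_eq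
    rw [h, h]
  let T₁ : E x ≃ₗ[ℂ] E (W.φ u₁) :=
    LinearEquiv.ofInjectiveOfFinrankEq (T (W.φ u₁)) (hinj u₁ hu₁) hrank
  have hT₁ : ∀ w, T₁ w = τ w (W.φ u₁) := fun w ↦ rfl
  have hβ : Continuous fun p : MulAction.stabilizer G x × E x ↦ a.isotropyRep x p.1 p.2 := by
    refine (continuous_fiber_iff (F := F)).2 ?_
    exact a.continuous_actTo (X := MulAction.stabilizer G x × E x) (fun p ↦ p.1.2)
      (v := fun p ↦ p.2) (continuous_subtype_val.comp continuous_fst)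
      ((FiberBundle.totalSpaceMk_isInducing F E x).continuous.comp continuous_snd)
  obtain ⟨P, hP, hPd⟩ := exists_equivariant_map_dense W.rep W.continuous_rep
    (α.comp (MulAction.stabilizer G x).subtype)
    (fun v ↦ (hα v).comp continuous_subtype_val) (a.isotropyRep x) hβ (u₁ := u₁)
    (L := T₁.symm.toLinearMap ∘ₗ L) (by
      intro h0
      refine hL0 (LinearMap.ext fun v ↦ T₁.symm.injective ?_)
      exact (LinearMap.congr_fun h0 v).trans (_root_.map_zero T₁.symm).symm) (by
      intro h hh v
      refine T₁.injective ?_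
      have hz : (h : G) • W.φ u₁ = W.φ u₁ := by rw [W.smul_φ h hu₁, hh]
      change T₁ (a.isotropyRep x h (T₁.symm (L v))) = T₁ (T₁.symm (L (α h v)))
      rw [T₁.apply_symm_apply, hT₁, ← hτ h _ _ hz, ← hT₁, T₁.apply_symm_apply, hL])
  have hnear : ∀ᶠ u in 𝓝 u₂, u ∈ Metric.ball 0 W.radius ∧ g₂ • W.φ u ∈ U := by
    have h1 : ContinuousAt (fun u ↦ g₂ • W.φ u) u₂ :=
      ((continuous_const_smul g₂).continuousAt).comp (W.continuousAt_φ hu₂)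
    exact (Metric.isOpen_ball.eventually_mem hu₂).and (h1.eventually (hU.mem_nhds hzU))
  obtain ⟨u, hPu, hu, huU⟩ := ((mem_closure_iff_frequently.1 (hPd u₂)).and_eventually hnear).exists
  refine ⟨g₂ • W.φ u, huU, Occurs.smul ⟨T (W.φ u) ∘ₗ P u, fun h0 ↦ hPu ?_, fun k hk v ↦ ?_⟩ g₂⟩
  · refine LinearMap.ext fun v ↦ hinj u hu ?_
    have h1 : T (W.φ u) (P u v) = T (W.φ u) 0 :=
      (LinearMap.congr_fun h0 v).trans (_root_.map_zero _).symm
    exact h1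
  · obtain ⟨h, rfl, hh⟩ := W.exists_of_smul_φ_eq hu hu hk
    change a.actTo hk (τ (P u v) (W.φ u)) = τ (P u (α h v)) (W.φ u)
    rw [hτ h _ _ hk, hP, hh]
    rfl

end EquivariantExtension

/-! ### The points with a tube without occurrences -/

section Main

variable {m n : ℕ} {G : Type*} [Group G] [TopologicalSpace G]
  [ChartedSpace (EuclideanSpace ℝ (Fin m)) G] [CompactSpace G]
  {M : Type*} [TopologicalSpace M] [ChartedSpace (EuclideanSpace ℝ (Fin n)) M]
  [IsManifold (𝓡 n) ∞ M] [CompactSpace M] [T2Space M] [MeasurableSpace M] [BorelSpace M]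
  [RiemannianBundle (fun x : M ↦ TangentSpace (𝓡 n) x)]
  [IsContMDiffRiemannianBundle (𝓡 n) ∞ (EuclideanSpace ℝ (Fin n))
    (fun x : M ↦ TangentSpace (𝓡 n) x)]
  [MulAction G M] [ContMDiffSMul (𝓡 m) (𝓡 n) ∞ G M] [IsIsometricAction n G M]
  {F : Type*} [NormedAddCommGroup F] [NormedSpace ℂ F] [FiniteDimensional ℂ F]
  {E : M → Type*} [TopologicalSpace (TotalSpace F E)] [∀ x, NormedAddCommGroup (E x)]
  [∀ x, InnerProductSpace ℂ (E x)] [FiberBundle F E] [VectorBundle ℂ F E]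
  [IsSmoothHermitianBundle n F E]
  {a : EquivariantStructure m n G F E}
  {V : Type*} [NormedAddCommGroup V] [InnerProductSpace ℂ V] [CompleteSpace V]
  {α : G →* (V ≃ₗᵢ[ℂ] V)}

theorem mem_nullSet_iff [IsTopologicalGroup G] [ContinuousSMul G M]
    (hα : IsIrreducibleUnitaryRep α) {x : M} :
    x ∈ nullSet a α ↔ ∃ W : Tube m n G x, ∀ y ∈ W.carrier, ¬ Occurs a α y :=
  exists_congr fun W ↦ W.isotypicComponent_l2Rep_eq_bot_iff a hα

variable [LieGroup (𝓡 m) ∞ G]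

/-- A tube without occurrences of `α` lies in `nullSet a α`, since it contains a tube around each
of its points. -/
theorem carrier_subset_nullSet [IsTopologicalGroup G] [ContinuousSMul G M]
    (hα : IsIrreducibleUnitaryRep α) {x : M} (W : Tube m n G x)
    (hW : ∀ y ∈ W.carrier, ¬ Occurs a α y) : W.carrier ⊆ nullSet a α := by
  intro y hy
  obtain ⟨W', hW'⟩ := exists_tube (m := m) (n := n) (G := G) y (W.isOpen_carrier.mem_nhds hy)
  rw [mem_nullSet_iff hα]
  refine ⟨W', ?_⟩
  rintro _ ⟨g, u, hu, rfl⟩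
  exact hW _ (W.smul_mem_carrier g (hW' u hu))

theorem isOpen_nullSet [IsTopologicalGroup G] [ContinuousSMul G M]
    (hα : IsIrreducibleUnitaryRep α) : IsOpen (nullSet a α) := by
  rw [isOpen_iff_mem_nhds]
  intro x hx
  obtain ⟨W, hW⟩ := (mem_nullSet_iff hα).1 hx
  exact mem_of_superset (W.isOpen_carrier.mem_nhds W.self_mem_carrier)
    (carrier_subset_nullSet hα W hW)

theorem smul_mem_nullSet [IsTopologicalGroup G] [ContinuousSMul G M]
    (hα : IsIrreducibleUnitaryRep α) (g : G) {x : M} (hx : x ∈ nullSet a α) :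
    g • x ∈ nullSet a α := by
  obtain ⟨W, hW⟩ := (mem_nullSet_iff hα).1 hx
  exact carrier_subset_nullSet hα W hW (W.smul_mem_carrier g W.self_mem_carrier)

theorem isClosed_nullSet [IsTopologicalGroup G] [ContinuousSMul G M]
    (hα : IsIrreducibleUnitaryRep α) : IsClosed (nullSet a α) := by
  refine isClosed_of_closure_subset fun x hx ↦ ?_
  have := hα.finiteDimensional
  obtain ⟨τ, hinj, hτ⟩ := exists_equivariant_extension a x
  obtain ⟨W, hWφ⟩ := exists_tube (m := m) (n := n) (G := G) x hinj
  rw [mem_nullSet_iff hα]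
  refine ⟨W, fun y hy hocc ↦ ?_⟩
  -- a tube around a point of `nullSet a α` close to `x` meets `W`, but contains no occurrences
  obtain ⟨x', hx'W, hx'⟩ := mem_closure_iff.1 hx _ W.isOpen_carrier W.self_mem_carrier
  obtain ⟨W', hW'⟩ := (mem_nullSet_iff hα).1 hx'
  obtain ⟨z, hz, hzocc⟩ := W.exists_occurs_mem_inter hα.continuous hWφ hτ hy hocc
    W'.isOpen_carrier ⟨x', W'.self_mem_carrier, hx'W⟩
  exact hW' z hz hzocc

end Main

end EquivariantL2

theorem mainTheorem8 {m n : ℕ}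
    -- a compact Lie group `G`
    {G : Type*} [Group G] [TopologicalSpace G] [ChartedSpace (EuclideanSpace ℝ (Fin m)) G]
    [LieGroup (𝓡 m) ∞ G] [CompactSpace G] [T2Space G]
    -- a closed Riemannian manifold `M`
    {M : Type*} [TopologicalSpace M] [ChartedSpace (EuclideanSpace ℝ (Fin n)) M]
    [IsManifold (𝓡 n) ∞ M] [CompactSpace M] [T2Space M] [MeasurableSpace M] [BorelSpace M]
    [RiemannianBundle (fun x : M ↦ TangentSpace (𝓡 n) x)]
    [IsContMDiffRiemannianBundle (𝓡 n) ∞ (EuclideanSpace ℝ (Fin n))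
      (fun x : M ↦ TangentSpace (𝓡 n) x)]
    -- a smooth isometric action of `G` on `M`
    [MulAction G M] [ContMDiffSMul (𝓡 m) (𝓡 n) ∞ G M] [EquivariantL2.IsIsometricAction n G M]
    -- a smooth `G`-equivariant Hermitian vector bundle `E` over `M`
    {F : Type*} [NormedAddCommGroup F] [NormedSpace ℂ F] [FiniteDimensional ℂ F]
    {E : M → Type*} [TopologicalSpace (TotalSpace F E)] [∀ x, NormedAddCommGroup (E x)]
    [∀ x, InnerProductSpace ℂ (E x)] [FiberBundle F E] [VectorBundle ℂ F E] [VectorBundle ℝ F E]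
    [ContMDiffVectorBundle ∞ F E (𝓡 n)] [EquivariantL2.IsSmoothHermitianBundle n F E]
    (a : EquivariantL2.EquivariantStructure m n G F E)
    -- an irreducible unitary representation `α` of `G` on a Hilbert space `V`
    {V : Type*} [NormedAddCommGroup V] [InnerProductSpace ℂ V] [CompleteSpace V]
    (α : G →* (V ≃ₗᵢ[ℂ] V)) (hα : EquivariantL2.IsIrreducibleUnitaryRep α) :
    IsClopen (EquivariantL2.nullSet a α) ∧
      ∀ (g : G), ∀ x ∈ EquivariantL2.nullSet a α, g • x ∈ EquivariantL2.nullSet a α := by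
  have : IsTopologicalGroup G := topologicalGroup_of_lieGroup (𝓡 m) ∞
  have : ContinuousSMul G M :=
    ⟨(ContMDiffSMul.contMDiff_smul (I := 𝓡 m) (I' := 𝓡 n) (n := ∞) (G := G) (M := M)).continuous⟩
  exact ⟨⟨EquivariantL2.isClosed_nullSet hα, EquivariantL2.isOpen_nullSet hα⟩,
    fun g _ hx ↦ EquivariantL2.smul_mem_nullSet hα g hx⟩
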